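/- Let $\mathcal H_B$ be a complex Hilbert space, let $x\mapsto\rho_B^x$ assign to every letter $x$ of an alphabet $\mathcal X$ a density operator on $\mathcal H_B$ (a positive operator of trace one), and let $p_X$ be a probability distribution on $\mathcal X$. Put $$\rho_{XB}=\sum_{x}p_X(x)\,|x\rangle\langle x|\otimes\rho_B^x,\qquad \rho_X=\sum_x p_X(x)|x\rangle\langle x|,\qquad \rho_B=\sum_x p_X(x)\rho_B^x .$$ Logarithms are natural. For $\alpha\in(0,1)$ let $I^{\downarrow}_{\alpha}(X{:}B)_\rho=D_\alpha(\rho_{XB}\,\|\,\rho_X\otimes\rho_B)$, where $D_\alpha(\rho\|\sigma)=\frac1{\alpha-1}\log\operatorname{Tr}[\rho^\alpha\sigma^{1-\alpha}]$ is the Petz–Rényi divergence, and let $I(X{:}B)_\rho=D(\rho_{XB}\,\|\,\rho_X\otimes\rho_B)\in[0,\infty]$, where $D(\rho\|\sigma)=\operatorname{Tr}[\rho(\log\rho-\log\sigma)]$ is the quantum relative entropy. For $n,M\ge1$ let $\mathcal C^n=(x^n(1),\dots,x^n(M))$ be a random i.i.d. codebook of size $|\mathcal C^n|=M$: its codewords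 $x^n(m)\in\mathcal X^n$ are drawn independently from $p_X^{\otimes n}$. Its rate is $\frac1n\log M$, and it induces the state $$\rho_{B^n}^{\mathcal C^n}=\frac1M\sum_{m=1}^M\rho_B^{x_1(m)}\otimes\cdots\otimes\rho_B^{x_n(m)} .$$ Let $R>0$. Then the exponent $$E(R)=\sup_{\alpha\in(1/2,1)}\frac{1-\alpha}{\alpha}\Bigl(I^{\downarrow}_{2-1/\alpha}(X{:}B)_\rho-R\Bigr)$$ is finite, and the following hold. 1. For every $n\ge1$ and every random i.i.d. codebook $\mathcal C^n$ of rate $R=\frac1n\log|\mathcal C^n|$, $$\tfrac12\,\mathbb E_{\mathcal C^n}\bigl\|\rho_{B^n}^{\mathcal C^n}-\rho_B^{\otimes n}\bigr\|_1\;\ge\;1-4\,e^{-nE(R)} .$$ 2. $E(R)>0$ if and only if $R<I(X{:}B)_\rho$. 3. (Strong converse below $I(X{:}B)_\rho$.) If $R<I(X{:}B)_\rho$, then there is a $c>0$ such that for every $n\ge1$ and every random i.i.d. codebook $\mathcal C^n$ of rate $\frac1n\log|\mathcal C^n|\le R$, $$\tfrac12\,\mathbb E_{\mathcal C^n}\bigl\|\rho_{B^n}^{\mathcal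 C^n}-\rho_B^{\otimes n}\bigr\|_1\ge 1-4e^{-nc};$$ that is, the expected trace distance converges to $1$ exponentially fast. -/

import Mathlib

open UniformSpace
open scoped TensorProduct InnerProductSpace ENNReal

/-! ### Hilbert space tensor products of spaces and of bounded operators -/

noncomputable section

namespace SoftCovering

universe u v w

section Tensor

variable {E : Type u} [NormedAddCommGroup E] [InnerProductSpace ℂ E]
variable {F : Type v} [NormedAddCommGroup F] [InnerProductSpace ℂ F]

/-- The Hilbert space tensor product: the completion of the algebraic tensor product for the
inner product `⟪x ⊗ y, x' ⊗ y'⟫ = ⟪x, x'⟫ * ⟪y, y'⟫`. -/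
abbrev HTensor (E : Type u) [NormedAddCommGroup E] [InnerProductSpace ℂ E]
    (F : Type v) [NormedAddCommGroup F] [InnerProductSpace ℂ F] : Type (max u v) :=
  Completion (E ⊗[ℂ] F)

theorem inner_map_id [CompleteSpace E] (A : E →L[ℂ] E) (z w : E ⊗[ℂ] F) :
    ⟪TensorProduct.map A.toLinearMap LinearMap.id z, w⟫_ℂ
      = ⟪z, TensorProduct.map (star A).toLinearMap LinearMap.id w⟫_ℂ := by
  induction z with
  | zero => simp
  | add z₁ z₂ h₁ h₂ => simp only [map_add, inner_add_left, h₁, h₂]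
  | tmul x y =>
    induction w with
    | zero => simp
    | add w₁ w₂ h₁ h₂ => simp only [map_add, inner_add_right, h₁, h₂]
    | tmul x' y' =>
      simp [TensorProduct.inner_tmul, ContinuousLinearMap.star_eq_adjoint,
        ContinuousLinearMap.adjoint_inner_right]

theorem norm_map_id_le [CompleteSpace E] (A : E →L[ℂ] E) (z : E ⊗[ℂ] F) :
    ‖TensorProduct.map A.toLinearMap (LinearMap.id : F →ₗ[ℂ] F) z‖ ≤ ‖A‖ * ‖z‖ := by
  have hA : star A * A ≤ algebraMap ℝ (E →L[ℂ] E) (‖A‖ ^ 2) :=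
    CStarAlgebra.star_mul_le_algebraMap_norm_sq
  obtain ⟨C, hC⟩ := CStarAlgebra.nonneg_iff_eq_star_mul_self.mp (sub_nonneg.mpr hA)
  have key : ∀ (B : E →L[ℂ] E),
      ⟪z, TensorProduct.map (star B * B).toLinearMap (LinearMap.id : F →ₗ[ℂ] F) z⟫_ℂ
        = ((‖TensorProduct.map B.toLinearMap (LinearMap.id : F →ₗ[ℂ] F) z‖ ^ 2 : ℝ) : ℂ) := by
    intro B
    have h1 : TensorProduct.map (star B * B).toLinearMap (LinearMap.id : F →ₗ[ℂ] F) z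
        = TensorProduct.map (star B).toLinearMap (LinearMap.id : F →ₗ[ℂ] F)
          (TensorProduct.map B.toLinearMap (LinearMap.id : F →ₗ[ℂ] F) z) := by
      rw [← LinearMap.comp_apply, ← TensorProduct.map_comp]
      rfl
    rw [h1, ← inner_map_id]
    refine (inner_self_eq_norm_sq_to_K (𝕜 := ℂ)
      (TensorProduct.map B.toLinearMap (LinearMap.id : F →ₗ[ℂ] F) z)).trans ?_
    push_cast
    rfl
  have hsum : TensorProduct.map (algebraMap ℝ (E →L[ℂ] E) (‖A‖ ^ 2)).toLinearMap
        (LinearMap.id : F →ₗ[ℂ] F) z = ((‖A‖ ^ 2 : ℝ) : ℂ) • z := by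
    have : (algebraMap ℝ (E →L[ℂ] E) (‖A‖ ^ 2)).toLinearMap
        = ((‖A‖ ^ 2 : ℝ) : ℂ) • (LinearMap.id : E →ₗ[ℂ] E) := by
      ext x
      simp [Algebra.algebraMap_eq_smul_one]
      norm_cast
    rw [this, TensorProduct.map_smul_left, TensorProduct.map_id]
    rfl
  have hsub : TensorProduct.map (star C * C).toLinearMap (LinearMap.id : F →ₗ[ℂ] F) z
      = ((‖A‖ ^ 2 : ℝ) : ℂ) • z
        - TensorProduct.map (star A * A).toLinearMap (LinearMap.id : F →ₗ[ℂ] F) z := by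
    rw [← hsum, ← hC, eq_sub_iff_add_eq, ← LinearMap.add_apply, ← TensorProduct.map_add_left]
    congr 2
    ext x
    simp
  have h := key C
  have hz : ⟪z, ((‖A‖ ^ 2 : ℝ) : ℂ) • z⟫_ℂ = ((‖A‖ ^ 2 * ‖z‖ ^ 2 : ℝ) : ℂ) := by
    refine (inner_smul_right z z _).trans ?_
    rw [inner_self_eq_norm_sq_to_K (𝕜 := ℂ) z]
    push_cast
    rfl
  rw [hsub, inner_sub_right, key A, hz] at h
  have h' : ‖A‖ ^ 2 * ‖z‖ ^ 2
      - ‖TensorProduct.map A.toLinearMap (LinearMap.id : F →ₗ[ℂ] F) z‖ ^ 2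
      = ‖TensorProduct.map C.toLinearMap (LinearMap.id : F →ₗ[ℂ] F) z‖ ^ 2 := by
    have := congrArg Complex.re h
    norm_cast at this
  refine (sq_le_sq₀ (norm_nonneg _) (by positivity)).mp ?_
  nlinarith [sq_nonneg ‖TensorProduct.map C.toLinearMap (LinearMap.id : F →ₗ[ℂ] F) z‖]

theorem norm_map_le [CompleteSpace E] [CompleteSpace F] (A : E →L[ℂ] E) (B : F →L[ℂ] F)
    (z : E ⊗[ℂ] F) :
    ‖TensorProduct.map A.toLinearMap B.toLinearMap z‖ ≤ ‖A‖ * ‖B‖ * ‖z‖ := by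
  have h1 : TensorProduct.map A.toLinearMap B.toLinearMap z
      = TensorProduct.map A.toLinearMap LinearMap.id
        (TensorProduct.map LinearMap.id B.toLinearMap z) := by
    rw [← LinearMap.comp_apply, ← TensorProduct.map_comp]
    rfl
  have h2 : TensorProduct.comm ℂ E F (TensorProduct.map LinearMap.id B.toLinearMap z)
      = TensorProduct.map B.toLinearMap LinearMap.id (TensorProduct.comm ℂ E F z) := by
    rw [TensorProduct.map_comm]
  have h3 : ‖TensorProduct.map LinearMap.id B.toLinearMap z‖ ≤ ‖B‖ * ‖z‖ := by
    rw [← TensorProduct.norm_comm, h2, ← TensorProduct.norm_comm z]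
    exact norm_map_id_le B _
  rw [h1, mul_assoc]
  exact (norm_map_id_le A _).trans (mul_le_mul_of_nonneg_left h3 (norm_nonneg _))

/-- The tensor product `A ⊗ B` of bounded operators, acting on the Hilbert space tensor
product. -/
def opTensor [CompleteSpace E] [CompleteSpace F] (A : E →L[ℂ] E) (B : F →L[ℂ] F) :
    HTensor E F →L[ℂ] HTensor E F :=
  ((TensorProduct.map A.toLinearMap B.toLinearMap).mkContinuous (‖A‖ * ‖B‖)
    (norm_map_le A B)).completion

/-- The defining property of `A ⊗ B` on product vectors. -/
theorem opTensor_tmul [CompleteSpace E] [CompleteSpace F] (A : E →L[ℂ] E) (B : F →L[ℂ] F)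
    (x : E) (y : F) :
    opTensor A B ((x ⊗ₜ[ℂ] y : E ⊗[ℂ] F) : HTensor E F)
      = ((A x ⊗ₜ[ℂ] B y : E ⊗[ℂ] F) : HTensor E F) := by
  simp [opTensor]

end Tensor

section Power

/-- A complex Hilbert space, bundled. -/
structure HilbertSpace where
  carrier : Type u
  [normed : NormedAddCommGroup carrier]
  [innerProduct : InnerProductSpace ℂ carrier]
  [complete : CompleteSpace carrier]

attribute [instance] HilbertSpace.normed HilbertSpace.innerProduct HilbertSpace.complete

variable (H : Type u) [NormedAddCommGroup H] [InnerProductSpace ℂ H] [CompleteSpace H]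

/-- The tensor powers `H^{⊗0} = ℂ` (as the one-dimensional space `EuclideanSpace ℂ PUnit`) and
`H^{⊗(n+1)} = H ⊗ H^{⊗n}`. -/
def tensorPowerBundle : ℕ → HilbertSpace.{u}
  | 0 => { carrier := EuclideanSpace ℂ PUnit.{u + 1} }
  | n + 1 => { carrier := HTensor H (tensorPowerBundle n).carrier }

/-- The Hilbert space `H^{⊗n}`. -/
abbrev TensorPower (n : ℕ) : Type u := (tensorPowerBundle H n).carrier

variable {H}

/-- The product operator `A 0 ⊗ ⋯ ⊗ A (n-1)` on `H^{⊗n}`. -/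
def prodOp : (n : ℕ) → (Fin n → (H →L[ℂ] H)) → (TensorPower H n →L[ℂ] TensorPower H n)
  | 0, _ => ContinuousLinearMap.id ℂ _
  | n + 1, A => (opTensor (A 0) (prodOp n fun i => A i.succ) :
      HTensor H (TensorPower H n) →L[ℂ] HTensor H (TensorPower H n))

end Power

/-! ### Traces, density operators, trace norm -/

section Trace

variable {H : Type u} [NormedAddCommGroup H] [InnerProductSpace ℂ H] [CompleteSpace H]

/-- An index set of an orthonormal (Hilbert) basis of `H`. -/
def basisSet (H : Type u) [NormedAddCommGroup H] [InnerProductSpace ℂ H] [CompleteSpace H] :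
    Set H :=
  (exists_hilbertBasis ℂ H).choose

/-- An orthonormal (Hilbert) basis of `H`. The traces below do not depend on it. -/
def onb (H : Type u) [NormedAddCommGroup H] [InnerProductSpace ℂ H] [CompleteSpace H] :
    HilbertBasis (basisSet H) ℂ H :=
  (exists_hilbertBasis ℂ H).choose_spec.choose

/-- The trace of a trace class operator. -/
def trace (T : H →L[ℂ] H) : ℂ := ∑' i, ⟪onb H i, T (onb H i)⟫_ℂ

/-- The trace, in `[0, ∞]`, of a positive bounded operator. -/
def posTrace (T : H →L[ℂ] H) : ℝ≥0∞ :=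
  ∑' i, ENNReal.ofReal (⟪onb H i, T (onb H i)⟫_ℂ).re

theorem parseval_ennreal {K : Type u} [NormedAddCommGroup K] [InnerProductSpace ℂ K] {κ : Type w}
    (b : HilbertBasis κ ℂ K) (y : K) :
    ∑' k, ENNReal.ofReal (‖⟪b k, y⟫_ℂ‖ ^ 2) = ENNReal.ofReal (‖y‖ ^ 2) := by
  have h : HasSum (fun k => ‖⟪b k, y⟫_ℂ‖ ^ 2) (‖y‖ ^ 2) := by
    have h0 := Complex.hasSum_re (b.hasSum_inner_mul_inner y y)
    rw [show (⟪y, y⟫_ℂ).re = ‖y‖ ^ 2 from inner_self_eq_norm_sq (𝕜 := ℂ) y] at h0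
    refine h0.congr_fun fun k => ?_
    rw [← inner_conj_symm y (b k), mul_comm, Complex.mul_conj, Complex.ofReal_re,
      Complex.normSq_eq_norm_sq]
  rw [← h.tsum_eq, ENNReal.ofReal_tsum_of_nonneg (fun k => by positivity) h.summable]

/-- The trace of a positive operator may be computed in any Hilbert basis. -/
theorem posTrace_eq {κ : Type w} (b : HilbertBasis κ ℂ H) {T : H →L[ℂ] H} (hT : 0 ≤ T) :
    posTrace T = ∑' k, ENNReal.ofReal (⟪b k, T (b k)⟫_ℂ).re := by
  obtain ⟨S, rfl⟩ := CStarAlgebra.nonneg_iff_eq_star_mul_self.mp hT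
  have hin : ∀ x : H, (⟪x, (star S * S) x⟫_ℂ).re = ‖S x‖ ^ 2 := by
    intro x
    rw [show (star S * S) x = (star S) (S x) from rfl, ContinuousLinearMap.star_eq_adjoint,
      ContinuousLinearMap.adjoint_inner_right]
    exact inner_self_eq_norm_sq (𝕜 := ℂ) (S x)
  have hflip : ∀ i k, ‖⟪b k, S (onb H i)⟫_ℂ‖ = ‖⟪onb H i, (star S) (b k)⟫_ℂ‖ := by
    intro i k
    rw [ContinuousLinearMap.star_eq_adjoint, ContinuousLinearMap.adjoint_inner_right,
      norm_inner_symm]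
  have hflip' : ∀ k l, ‖⟪b l, (star S) (b k)⟫_ℂ‖ = ‖⟪b k, S (b l)⟫_ℂ‖ := by
    intro k l
    rw [ContinuousLinearMap.star_eq_adjoint, ContinuousLinearMap.adjoint_inner_right,
      norm_inner_symm]
  simp only [posTrace, hin]
  calc ∑' i, ENNReal.ofReal (‖S (onb H i)‖ ^ 2)
      = ∑' i, ∑' k, ENNReal.ofReal (‖⟪b k, S (onb H i)⟫_ℂ‖ ^ 2) := by
        simp only [parseval_ennreal]
    _ = ∑' k, ∑' i, ENNReal.ofReal (‖⟪onb H i, (star S) (b k)⟫_ℂ‖ ^ 2) := by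
        rw [ENNReal.tsum_comm]
        simp only [hflip]
    _ = ∑' k, ∑' l, ENNReal.ofReal (‖⟪b l, (star S) (b k)⟫_ℂ‖ ^ 2) := by
        simp only [parseval_ennreal]
    _ = ∑' l, ∑' k, ENNReal.ofReal (‖⟪b k, S (b l)⟫_ℂ‖ ^ 2) := by
        rw [ENNReal.tsum_comm]
        simp only [hflip']
    _ = ∑' l, ENNReal.ofReal (‖S (b l)‖ ^ 2) := by
        simp only [parseval_ennreal]

/-- Density operators: positive operators of unit trace. -/
def IsDensity (T : H →L[ℂ] H) : Prop := 0 ≤ T ∧ posTrace T = 1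

/-- The trace norm `‖T‖₁ = Tr |T|` of a trace class operator, where `|T| = (T* T)^{1/2}`. -/
def traceNorm (T : H →L[ℂ] H) : ℝ := (posTrace (CFC.abs T)).toReal

end Trace

/-! ### Divergences -/

section Divergence

variable {H : Type u} [NormedAddCommGroup H] [InnerProductSpace ℂ H] [CompleteSpace H]

/-- The Petz–Rényi divergence `(α - 1)⁻¹ log Tr[ρ^α σ^{1-α}]` of order `α ∈ (0,1)`, with natural
logarithm; it is `+∞` if the trace vanishes. -/
def petzDiv (α : ℝ) (ρ σ : H →L[ℂ] H) : EReal :=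
  (((α - 1)⁻¹ : ℝ) : EReal) * ENNReal.log (ENNReal.ofReal (trace (ρ ^ α * σ ^ (1 - α))).re)

/-- The orthogonal projection onto `ker (T - l)`; it is `0` unless `l` is an eigenvalue. -/
def eigenProj (T : H →L[ℂ] H) (l : ℝ) : H →L[ℂ] H :=
  (LinearMap.ker (T - (l : ℂ) • (1 : H →L[ℂ] H)).toLinearMap).starProjection

/-- `l (log l - log m) - l + m ≥ 0` for `l, m ≥ 0`, with `0 log 0 = 0` and value `+∞` if
`l > 0 = m`. -/
def klein (l m : ℝ) : ℝ≥0∞ :=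
  if m = 0 ∧ l ≠ 0 then ⊤ else ENNReal.ofReal (l * (Real.log l - Real.log m) - l + m)

/-- Umegaki's relative entropy `Tr[ρ (log ρ - log σ)] ∈ [0, ∞]` of density operators on a Hilbert
space of any dimension. With the spectral decompositions `ρ = ∑ l P_l` and `σ = ∑ m Q_m` it reads
`∑_{l,m} Tr[P_l Q_m] l (log l - log m)`. To each summand its multiple `Tr[P_l Q_m] (m - l)` is
added, which makes all summands nonnegative and contributes `Tr σ - Tr ρ = 0` in total. -/
def relEntropy (ρ σ : H →L[ℂ] H) : ℝ≥0∞ :=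
  ∑' (l : ℝ) (m : ℝ),
    klein l m * posTrace (eigenProj ρ l * eigenProj σ m * eigenProj ρ l)

end Divergence

/-! ### Classical-quantum states and their information quantities -/

section CQ

variable {X : Type v} {H : Type u} [NormedAddCommGroup H] [InnerProductSpace ℂ H]
  [CompleteSpace H]

/-- The Hilbert space `ℓ²(X)` of the classical register. -/
abbrev Register (X : Type v) : Type v := lp (fun _ : X => ℂ) 2

open scoped Classical in
/-- The projection `|x⟩⟨x|` on `ℓ²(X)`. -/
def ketbra (x : X) : Register X →L[ℂ] Register X :=
  InnerProductSpace.rankOne ℂ (lp.single 2 x (1 : ℂ)) (lp.single 2 x (1 : ℂ))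

/-- `ρ_XB = ∑ₓ p(x) |x⟩⟨x| ⊗ ρ_x`. -/
def stateXB (p : PMF X) (ρ : X → (H →L[ℂ] H)) :
    HTensor (Register X) H →L[ℂ] HTensor (Register X) H :=
  ∑' x, (p x).toReal • opTensor (ketbra x) (ρ x)

/-- `ρ_X = ∑ₓ p(x) |x⟩⟨x|`. -/
def stateX (p : PMF X) : Register X →L[ℂ] Register X := ∑' x, (p x).toReal • ketbra x

/-- `ρ_B = ∑ₓ p(x) ρ_x`. -/
def stateB (p : PMF X) (ρ : X → (H →L[ℂ] H)) : H →L[ℂ] H := ∑' x, (p x).toReal • ρ x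

/-- `I^↓_α(X:B) = D_α(ρ_XB ‖ ρ_X ⊗ ρ_B)`, for `α ∈ (0,1)`. -/
def petzInfo (α : ℝ) (p : PMF X) (ρ : X → (H →L[ℂ] H)) : EReal :=
  petzDiv α (stateXB p ρ) (opTensor (stateX p) (stateB p ρ))

/-- The mutual information `I(X:B) = D(ρ_XB ‖ ρ_X ⊗ ρ_B) ∈ [0, ∞]`. -/
def mutualInfo (p : PMF X) (ρ : X → (H →L[ℂ] H)) : ℝ≥0∞ :=
  relEntropy (stateXB p ρ) (opTensor (stateX p) (stateB p ρ))

/-- The exponent `sup_{α ∈ (1/2,1)} ((1-α)/α) (I^↓_{2-1/α}(X:B) - R)`. -/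
def scExponent (p : PMF X) (ρ : X → (H →L[ℂ] H)) (R : ℝ) : EReal :=
  ⨆ α ∈ Set.Ioo (1 / 2 : ℝ) 1,
    (((1 - α) / α : ℝ) : EReal) * (petzInfo (2 - 1 / α) p ρ - (R : EReal))

/-! ### Random i.i.d. codebooks -/

/-- The output `ρ_{x_1} ⊗ ⋯ ⊗ ρ_{x_n}` of the `n`-fold product channel. -/
def outputState (ρ : X → (H →L[ℂ] H)) {n : ℕ} (x : Fin n → X) :
    TensorPower H n →L[ℂ] TensorPower H n :=
  prodOp n fun i => ρ (x i)

/-- The state `(1/M) ∑ₘ ρ_{x^n(m)}` induced by a codebook `c = (x^n(1), …, x^n(M))`. -/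
def codebookState (ρ : X → (H →L[ℂ] H)) {n M : ℕ} (c : Fin M → Fin n → X) :
    TensorPower H n →L[ℂ] TensorPower H n :=
  (1 / (M : ℝ)) • ∑ m, outputState ρ (c m)

/-- The probability of the codebook `c` when its `M` codewords are drawn independently from
`p^{⊗n}`. -/
def codebookProb (p : PMF X) {n M : ℕ} (c : Fin M → Fin n → X) : ℝ :=
  ∏ m, ∏ i, (p (c m i)).toReal

/-- `½ 𝔼 ‖ρ^C - ρ_B^{⊗n}‖₁` over the random i.i.d. codebook `C` of `M` codewords of length
`n`. -/
def expectedTraceDist (p : PMF X) (ρ : X → (H →L[ℂ] H)) (n M : ℕ) : ℝ :=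
  1 / 2 * ∑' c : Fin M → Fin n → X,
    codebookProb p c * traceNorm (codebookState ρ c - prodOp n fun _ => stateB p ρ)

end CQ

end SoftCovering

end

/-! Below the critical rate, M codewords are too few to cover the output space: a test assembled
from one test per codeword distinguishes the codebook state from its mean, so the trace distance is
close to 1.

One shot. Let C = ∑ A_m with A_m = W(c_m)/M, let S be the mean output state, D = C + S and P_m =
D^{-1/2} A_m D^{-1/2}. The test ∑ P_m has equal errors on C and S, because Tr[D ∑ P_m] = Tr C, so 1
- ½‖C - S‖₁ ≤ 2 ∑ Tr[A_m (1 - P_m)] (`one_sub_traceNorm_sum_le`). By near-optimality of the pretty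
good measurement (`trPair_quotient_le`), Tr[A_m (1 - P_m)] is at most Tr[A_m (1 - T_m)] + Tr[(D -
A_m) T_m] for any projections T_m. Take for T_m the quantum Chernoff test between A_m and S
(`exists_test`). It depends on its own codeword only, so the other codewords may be averaged first,
and D - A_m becomes at most 2S. In expectation the deficit is at most 4 M · E Tr[(W/M)^{1-s} S^s] =
4 M^s E Tr[W^{1-s} S^s] for every s in (0,1) (`tsum_codebook_le`).

For n letters the last expectation is Q(s)^n with Q(s) = ∑ p(x) Tr[ρ_x^{1-s} ρ_B^s] (`chernoffSum`),
so the exponent is -log Q(s) - sR. Since -log Q(s) = s I_{1-s}, the substitution s = (1-α)/α turns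
the supremum over s into E(R) (`scExponent_eq`).

Sign of E(R). In the eigenbases of ρ_x and ρ_B both Q(s) and I(X:B) are classical sums ∑ u r^{1-s}
t^s and ∑ u klein(r,t) with the same weights u (`exists_classical`). The bound e^z ≥ 1 + z gives
-log Q(s) ≤ s I (`one_le_exp_mul_tsum_rpow`), so E(R) ≤ 0 for R ≥ I. Conversely (1 - Q(s))/s
eventually exceeds every R < I as s → 0 (`exists_tsum_rpow_lt`), so some s has a positive exponent.
-/

open scoped NNReal

noncomputable section

namespace SoftCovering

universe u v w

/-! ### Positive traces and Hilbert–Schmidt operators -/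

section HilbertSchmidt

variable {H : Type u} [NormedAddCommGroup H] [InnerProductSpace ℂ H] [CompleteSpace H]
variable {ι : Type v} {κ : Type w}

theorem re_inner_star_mul_self (S : H →L[ℂ] H) (x : H) :
    (⟪x, (star S * S) x⟫_ℂ).re = ‖S x‖ ^ 2 := by
  rw [show (star S * S) x = (star S) (S x) from rfl, ContinuousLinearMap.star_eq_adjoint,
    ContinuousLinearMap.adjoint_inner_right]
  exact inner_self_eq_norm_sq (𝕜 := ℂ) (S x)

theorem inner_star_right (S : H →L[ℂ] H) (x y : H) : ⟪x, (star S) y⟫_ℂ = ⟪S x, y⟫_ℂ := by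
  rw [ContinuousLinearMap.star_eq_adjoint, ContinuousLinearMap.adjoint_inner_right]

theorem inner_star_left (S : H →L[ℂ] H) (x y : H) : ⟪(star S) x, y⟫_ℂ = ⟪x, S y⟫_ℂ := by
  rw [ContinuousLinearMap.star_eq_adjoint, ContinuousLinearMap.adjoint_inner_left]

theorem inner_apply_comm {T : H →L[ℂ] H} (hT : IsSelfAdjoint T) (x y : H) :
    ⟪T x, y⟫_ℂ = ⟪x, T y⟫_ℂ := by
  conv_lhs => rw [← hT.star_eq]
  exact inner_star_left T x y

theorem re_inner_nonneg {T : H →L[ℂ] H} (hT : 0 ≤ T) (x : H) : 0 ≤ (⟪x, T x⟫_ℂ).re := by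
  obtain ⟨S, rfl⟩ := CStarAlgebra.nonneg_iff_eq_star_mul_self.mp hT
  rw [re_inner_star_mul_self]
  positivity

theorem nonneg_of_re_inner {T : H →L[ℂ] H} (hT : IsSelfAdjoint T)
    (h : ∀ x, 0 ≤ (⟪x, T x⟫_ℂ).re) : 0 ≤ T := by
  rw [ContinuousLinearMap.nonneg_iff_isPositive, ContinuousLinearMap.isPositive_def']
  refine ⟨hT, fun x => ?_⟩
  rw [ContinuousLinearMap.reApplyInnerSelf_apply, inner_apply_comm hT]
  exact h x

theorem posTrace_star_mul_self (b : HilbertBasis ι ℂ H) (S : H →L[ℂ] H) :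
    posTrace (star S * S) = ∑' i, ENNReal.ofReal (‖S (b i)‖ ^ 2) := by
  rw [posTrace_eq b (star_mul_self_nonneg S)]
  simp only [re_inner_star_mul_self]

/-- Both sides are the sum of all squared matrix entries of S, by Parseval. This is the source of
every cyclicity of the trace used below. -/
theorem posTrace_star_mul_comm (S : H →L[ℂ] H) : posTrace (star S * S) = posTrace (S * star S) := by
  have h := posTrace_star_mul_self (onb H) (star S)
  rw [star_star] at h
  rw [h, posTrace_star_mul_self (onb H)]
  calc ∑' i, ENNReal.ofReal (‖S (onb H i)‖ ^ 2)
      = ∑' i, ∑' k, ENNReal.ofReal (‖⟪onb H k, S (onb H i)⟫_ℂ‖ ^ 2) := by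
        simp only [parseval_ennreal]
    _ = ∑' k, ∑' i, ENNReal.ofReal (‖⟪onb H i, (star S) (onb H k)⟫_ℂ‖ ^ 2) := by
        rw [ENNReal.tsum_comm]
        simp only [inner_star_right, norm_inner_symm (onb H _)]
    _ = _ := by simp only [parseval_ennreal]

theorem posTrace_add {A B : H →L[ℂ] H} (hA : 0 ≤ A) (hB : 0 ≤ B) :
    posTrace (A + B) = posTrace A + posTrace B := by
  simp only [posTrace, ← ENNReal.tsum_add]
  refine tsum_congr fun i => ?_
  rw [← ENNReal.ofReal_add (re_inner_nonneg hA _) (re_inner_nonneg hB _), ← Complex.add_re,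
    ← inner_add_right]
  rfl

theorem posTrace_mono {A B : H →L[ℂ] H} (hA : 0 ≤ A) (hAB : A ≤ B) : posTrace A ≤ posTrace B := by
  have h := posTrace_add hA (sub_nonneg.mpr hAB)
  rw [add_sub_cancel] at h
  rw [h]
  exact le_self_add

theorem posTrace_smul {r : ℝ} (hr : 0 ≤ r) (A : H →L[ℂ] H) :
    posTrace (r • A) = ENNReal.ofReal r * posTrace A := by
  simp only [posTrace, ← ENNReal.tsum_mul_left]
  refine tsum_congr fun i => ?_
  rw [← ENNReal.ofReal_mul hr, smul_apply, inner_smul_right_eq_smul]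
  simp

theorem posTrace_tsum {A : ι → H →L[ℂ] H} (hA : ∀ i, 0 ≤ A i) (hs : Summable A) :
    posTrace (∑' i, A i) = ∑' i, posTrace (A i) := by
  simp only [posTrace]
  rw [ENNReal.tsum_comm]
  refine tsum_congr fun k => ?_
  have h1 : HasSum (fun i => (⟪onb H k, A i (onb H k)⟫_ℂ).re)
      (⟪onb H k, (∑' i, A i) (onb H k)⟫_ℂ).re := by
    have := hs.hasSum.mapL (ContinuousLinearMap.apply ℂ H (onb H k))
    exact Complex.hasSum_re (this.mapL (innerSL ℂ (onb H k)))
  rw [← h1.tsum_eq, ENNReal.ofReal_tsum_of_nonneg (fun i => re_inner_nonneg (hA i) _) h1.summable]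

theorem hasSum_norm_sq (b : HilbertBasis ι ℂ H) {S : H →L[ℂ] H}
    (hS : posTrace (star S * S) ≠ ⊤) :
    HasSum (fun i => ‖S (b i)‖ ^ 2) (posTrace (star S * S)).toReal := by
  rw [posTrace_star_mul_self b] at hS ⊢
  have h := ENNReal.summable_toReal hS
  rw [ENNReal.tsum_toReal_eq (fun i => ENNReal.ofReal_ne_top)]
  simp only [ENNReal.toReal_ofReal (sq_nonneg _)] at h ⊢
  exact h.hasSum

/-- Parallelogram law for operators: (U+V)*(U+V) + (U-V)*(U-V) = 2 U*U + 2 V*V. -/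
theorem posTrace_add_star_mul_add_ne_top {U V : H →L[ℂ] H} (hU : posTrace (star U * U) ≠ ⊤)
    (hV : posTrace (star V * V) ≠ ⊤) : posTrace (star (U + V) * (U + V)) ≠ ⊤ := by
  have h : star (U + V) * (U + V) ≤ (2 : ℝ) • (star U * U) + (2 : ℝ) • (star V * V) := by
    rw [← sub_nonneg]
    have : (2 : ℝ) • (star U * U) + (2 : ℝ) • (star V * V) - star (U + V) * (U + V)
        = star (U - V) * (U - V) := by
      simp only [star_add, star_sub, two_smul, add_mul, mul_add, sub_mul, mul_sub]
      abel
    rw [this]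
    exact star_mul_self_nonneg _
  refine ne_top_of_le_ne_top ?_ (posTrace_mono (star_mul_self_nonneg _) h)
  have hsm : ∀ W : H →L[ℂ] H, 0 ≤ (2 : ℝ) • (star W * W) := fun W =>
    smul_nonneg zero_le_two (star_mul_self_nonneg W)
  rw [posTrace_add (hsm U) (hsm V), posTrace_smul zero_le_two, posTrace_smul zero_le_two]
  exact ENNReal.add_ne_top.mpr ⟨ENNReal.mul_ne_top ENNReal.ofReal_ne_top hU,
    ENNReal.mul_ne_top ENNReal.ofReal_ne_top hV⟩

/-- The real part of the Hilbert–Schmidt inner product, by polarization. -/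
theorem hasSum_re_inner (b : HilbertBasis ι ℂ H) {U V : H →L[ℂ] H}
    (hU : posTrace (star U * U) ≠ ⊤) (hV : posTrace (star V * V) ≠ ⊤) :
    HasSum (fun i => (⟪U (b i), V (b i)⟫_ℂ).re)
      (((posTrace (star (U + V) * (U + V))).toReal
        - (posTrace (star (U - V) * (U - V))).toReal) / 4) := by
  have hV' : posTrace (star (-V) * (-V)) ≠ ⊤ := by simpa using hV
  have h1 := hasSum_norm_sq b (posTrace_add_star_mul_add_ne_top hU hV)
  have h2 := hasSum_norm_sq b (posTrace_add_star_mul_add_ne_top hU hV')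
  rw [← sub_eq_add_neg] at h2
  refine ((h1.sub h2).div_const 4).congr_fun fun i => ?_
  have e1 := norm_add_sq (𝕜 := ℂ) (U (b i)) (V (b i))
  have e2 := norm_sub_sq (𝕜 := ℂ) (U (b i)) (V (b i))
  simp only [add_apply, sub_apply, e1, e2]
  simp only [RCLike.re_to_complex]
  ring

/-- The polarized value contains only traces Tr[S*S], which are unchanged by S ↦ S*. In effect, Re
Tr[U*V] = Re Tr[U V*]. -/
theorem hasSum_re_inner_star (b : HilbertBasis ι ℂ H) {U V : H →L[ℂ] H}
    (hU : posTrace (star U * U) ≠ ⊤) (hV : posTrace (star V * V) ≠ ⊤) {r : ℝ}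
    (h : HasSum (fun i => (⟪U (b i), V (b i)⟫_ℂ).re) r) :
    HasSum (fun i => (⟪star U (b i), star V (b i)⟫_ℂ).re) r := by
  have e := h.unique (hasSum_re_inner b hU hV)
  have h' := hasSum_re_inner b (U := star U) (V := star V)
    (by rwa [star_star, ← posTrace_star_mul_comm]) (by rwa [star_star, ← posTrace_star_mul_comm])
  rw [← star_add, ← star_sub, star_star, star_star, ← posTrace_star_mul_comm,
    ← posTrace_star_mul_comm, ← e] at h'
  exact h'

/-- The trace of a product of two Hilbert–Schmidt operators may be computed in any basis. -/
theorem re_trace_star_mul (b : HilbertBasis ι ℂ H) {U V : H →L[ℂ] H}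
    (hU : posTrace (star U * U) ≠ ⊤) (hV : posTrace (star V * V) ≠ ⊤) :
    HasSum (fun i => (⟪U (b i), V (b i)⟫_ℂ).re) (trace (star U * V)).re := by
  have h0 := hasSum_re_inner (onb H) hU hV
  have hs : Summable fun i => ⟪onb H i, (star U * V) (onb H i)⟫_ℂ := by
    have h1 := (hasSum_norm_sq (onb H) hU).summable.add (hasSum_norm_sq (onb H) hV).summable
    refine Summable.of_norm_bounded h1 fun i => ?_
    rw [show (star U * V) (onb H i) = (star U) (V (onb H i)) from rfl, inner_star_right]
    refine (norm_inner_le_norm _ _).trans ?_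
    nlinarith [sq_nonneg (‖U (onb H i)‖ - ‖V (onb H i)‖), sq_nonneg ‖U (onb H i)‖,
      sq_nonneg ‖V (onb H i)‖]
  have h2 := Complex.hasSum_re hs.hasSum
  have h3 : (fun i => (⟪onb H i, (star U * V) (onb H i)⟫_ℂ).re)
      = fun i => (⟪U (onb H i), V (onb H i)⟫_ℂ).re := by
    funext i
    rw [show (star U * V) (onb H i) = (star U) (V (onb H i)) from rfl, inner_star_right]
  rw [h3] at h2
  rw [trace, h2.unique h0]
  exact hasSum_re_inner b hU hV

end HilbertSchmidt

/-! ### The pairing Tr[XY] of positive operators -/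

section TracePairing

variable {H : Type u} [NormedAddCommGroup H] [InnerProductSpace ℂ H] [CompleteSpace H]
variable {ι : Type v}

/-- `Tr[X Y] ∈ [0, ∞]` for positive operators `X` and `Y`. -/
def trPair (X Y : H →L[ℂ] H) : ℝ≥0∞ := posTrace (CFC.sqrt X * Y * CFC.sqrt X)

theorem isSelfAdjoint_sqrt (X : H →L[ℂ] H) : IsSelfAdjoint (CFC.sqrt X) :=
  (CFC.sqrt_nonneg X).isSelfAdjoint

theorem star_sqrt (X : H →L[ℂ] H) : star (CFC.sqrt X) = CFC.sqrt X := (isSelfAdjoint_sqrt X).star_eq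

theorem sqrt_conj_nonneg (X : H →L[ℂ] H) {Y : H →L[ℂ] H} (hY : 0 ≤ Y) :
    0 ≤ CFC.sqrt X * Y * CFC.sqrt X := by
  have := star_left_conjugate_nonneg hY (CFC.sqrt X)
  rwa [star_sqrt] at this

/-- With S = √Y √X the two sides are Tr[S*S] and Tr[S S*]. -/
theorem trPair_comm {X Y : H →L[ℂ] H} (hX : 0 ≤ X) (hY : 0 ≤ Y) : trPair X Y = trPair Y X := by
  have h := posTrace_star_mul_comm (CFC.sqrt Y * CFC.sqrt X)
  rw [star_mul, star_sqrt, star_sqrt] at h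
  rw [trPair, trPair]
  convert h using 2
  · rw [mul_assoc, mul_assoc, ← mul_assoc (CFC.sqrt Y), CFC.sqrt_mul_sqrt_self Y hY]
  · rw [mul_assoc, mul_assoc, ← mul_assoc (CFC.sqrt X), CFC.sqrt_mul_sqrt_self X hX]

theorem trPair_add_right (X : H →L[ℂ] H) {Y Z : H →L[ℂ] H} (hY : 0 ≤ Y) (hZ : 0 ≤ Z) :
    trPair X (Y + Z) = trPair X Y + trPair X Z := by
  rw [trPair, mul_add, add_mul, posTrace_add (sqrt_conj_nonneg X hY) (sqrt_conj_nonneg X hZ)]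
  rfl

theorem trPair_add_left {X Y Z : H →L[ℂ] H} (hX : 0 ≤ X) (hY : 0 ≤ Y) (hZ : 0 ≤ Z) :
    trPair (X + Y) Z = trPair X Z + trPair Y Z := by
  rw [trPair_comm (add_nonneg hX hY) hZ, trPair_add_right Z hX hY, trPair_comm hX hZ,
    trPair_comm hY hZ]

theorem trPair_mono_right (X : H →L[ℂ] H) {Y Z : H →L[ℂ] H} (hY : 0 ≤ Y) (h : Y ≤ Z) :
    trPair X Y ≤ trPair X Z := by
  have e := trPair_add_right X hY (sub_nonneg.mpr h)
  rw [add_sub_cancel] at e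
  rw [e]
  exact le_self_add

theorem trPair_mono_left {X Y Z : H →L[ℂ] H} (hX : 0 ≤ X) (h : X ≤ Y) (hZ : 0 ≤ Z) :
    trPair X Z ≤ trPair Y Z := by
  rw [trPair_comm hX hZ, trPair_comm (hX.trans h) hZ]
  exact trPair_mono_right Z hX h

theorem trPair_smul_right (X : H →L[ℂ] H) {r : ℝ} (hr : 0 ≤ r) (Y : H →L[ℂ] H) :
    trPair X (r • Y) = ENNReal.ofReal r * trPair X Y := by
  rw [trPair, mul_smul_comm, smul_mul_assoc, posTrace_smul hr]
  rfl

theorem trPair_smul_left {X Y : H →L[ℂ] H} (hX : 0 ≤ X) (hY : 0 ≤ Y) {r : ℝ} (hr : 0 ≤ r) :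
    trPair (r • X) Y = ENNReal.ofReal r * trPair X Y := by
  rw [trPair_comm (smul_nonneg hr hX) hY, trPair_smul_right Y hr, trPair_comm hX hY]

theorem trPair_tsum_right (X : H →L[ℂ] H) {A : ι → H →L[ℂ] H} (hA : ∀ i, 0 ≤ A i)
    (hs : Summable A) : trPair X (∑' i, A i) = ∑' i, trPair X (A i) := by
  rw [trPair, ← hs.tsum_mul_left, ← (hs.mul_left _).tsum_mul_right,
    posTrace_tsum (fun i => sqrt_conj_nonneg X (hA i)) ((hs.mul_left _).mul_right _)]
  rfl

theorem trPair_tsum_left {A : ι → H →L[ℂ] H} (hA : ∀ i, 0 ≤ A i) (hs : Summable A)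
    {Y : H →L[ℂ] H} (hY : 0 ≤ Y) : trPair (∑' i, A i) Y = ∑' i, trPair (A i) Y := by
  rw [trPair_comm (tsum_nonneg hA) hY, trPair_tsum_right Y hA hs]
  exact tsum_congr fun i => trPair_comm hY (hA i)

theorem trPair_sum_left {s : Finset ι} {A : ι → H →L[ℂ] H} (hA : ∀ i, 0 ≤ A i)
    {Y : H →L[ℂ] H} (hY : 0 ≤ Y) : trPair (∑ i ∈ s, A i) Y = ∑ i ∈ s, trPair (A i) Y := by
  classical
  induction s using Finset.induction_on with
  | empty => simp [trPair, posTrace]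
  | insert a s ha ih =>
    rw [Finset.sum_insert ha, Finset.sum_insert ha,
      trPair_add_left (hA a) (Finset.sum_nonneg fun i _ => hA i) hY, ih]

theorem trPair_one_right {X : H →L[ℂ] H} (hX : 0 ≤ X) : trPair X 1 = posTrace X := by
  rw [trPair, mul_one, CFC.sqrt_mul_sqrt_self X hX]

theorem trPair_le_posTrace {X Y : H →L[ℂ] H} (hX : 0 ≤ X) (hY : 0 ≤ Y) (hY1 : Y ≤ 1) :
    trPair X Y ≤ posTrace X := by
  rw [← trPair_one_right hX]
  exact trPair_mono_right X hY hY1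

theorem trPair_eq_of_isStarProjection {X T : H →L[ℂ] H} (hX : 0 ≤ X) (hT : IsStarProjection T) :
    trPair X T = posTrace (T * X * T) := by
  have hs : CFC.sqrt T = T := CFC.sqrt_unique hT.isIdempotentElem.eq hT.nonneg
  rw [trPair_comm hX hT.nonneg, trPair, hs]

/-- `Tr[X Y]` for a positive trace class operator `X`, computed in any basis. -/
theorem hasSum_trPair (b : HilbertBasis ι ℂ H) {X Y : H →L[ℂ] H} (hX : 0 ≤ X) (hY : 0 ≤ Y)
    (hXt : posTrace X ≠ ⊤) :
    HasSum (fun i => (⟪X (b i), Y (b i)⟫_ℂ).re) (trPair X Y).toReal := by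
  set S := CFC.sqrt X with hS
  have hSS : S * S = X := CFC.sqrt_mul_sqrt_self X hX
  have hstar : star S = S := star_sqrt X
  have hU : posTrace (star S * S) ≠ ⊤ := by rwa [hstar, hSS]
  -- Y√X is Hilbert–Schmidt because Y*Y ≤ ‖Y‖².
  have hV : posTrace (star (Y * S) * (Y * S)) ≠ ⊤ := by
    have h1 : star (Y * S) * (Y * S) ≤ (‖Y‖ ^ 2 : ℝ) • X := by
      have h2 : star Y * Y ≤ algebraMap ℝ (H →L[ℂ] H) (‖Y‖ ^ 2) :=
        CStarAlgebra.star_mul_le_algebraMap_norm_sq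
      have h3 := star_left_conjugate_le_conjugate h2 S
      rw [hstar, Algebra.algebraMap_eq_smul_one, mul_smul_comm, smul_mul_assoc, mul_one, hSS] at h3
      rw [star_mul, hstar]
      convert h3 using 1
      simp only [mul_assoc]
    refine ne_top_of_le_ne_top ?_ (posTrace_mono (star_mul_self_nonneg _) h1)
    rw [posTrace_smul (by positivity)]
    exact ENNReal.mul_ne_top ENNReal.ofReal_ne_top hXt
  have hpos := sqrt_conj_nonneg X hY
  have hfin : posTrace (S * Y * S) ≠ ⊤ := by
    have h1 : S * Y * S ≤ ‖Y‖ • X := by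
      have h2 : Y ≤ algebraMap ℝ (H →L[ℂ] H) ‖Y‖ := IsSelfAdjoint.le_algebraMap_norm_self
      have h3 := star_left_conjugate_le_conjugate h2 S
      rwa [hstar, Algebra.algebraMap_eq_smul_one, mul_smul_comm, smul_mul_assoc, mul_one, hSS] at h3
    refine ne_top_of_le_ne_top ?_ (posTrace_mono hpos h1)
    rw [posTrace_smul (by positivity)]
    exact ENNReal.mul_ne_top ENNReal.ofReal_ne_top hXt
  have h0 : HasSum (fun i => (⟪S (b i), (Y * S) (b i)⟫_ℂ).re) (trPair X Y).toReal := by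
    have e : ∀ i, (⟪S (b i), (Y * S) (b i)⟫_ℂ).re = (⟪b i, (S * Y * S) (b i)⟫_ℂ).re := by
      intro i
      rw [inner_apply_comm (isSelfAdjoint_sqrt X)]
      rfl
    simp only [e]
    rw [trPair, posTrace_eq b hpos, ENNReal.tsum_toReal_eq (fun i => ENNReal.ofReal_ne_top)]
    rw [posTrace_eq b hpos] at hfin
    have h := ENNReal.summable_toReal hfin
    simp only [ENNReal.toReal_ofReal (re_inner_nonneg hpos _)] at h ⊢
    exact h.hasSum
  -- Taking adjoints carries one square root across: ⟪√X b, Y√X b⟫ becomes ⟪√X b, √X Y b⟫ = ⟪X b, Y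
  -- b⟫.
  have h1 := hasSum_re_inner_star b hU hV h0
  refine h1.congr_fun fun i => ?_
  have hYs : star Y = Y := hY.isSelfAdjoint.star_eq
  rw [star_mul, hstar, hYs, ← hSS]
  exact congrArg Complex.re (inner_apply_comm (isSelfAdjoint_sqrt X) (S (b i)) (Y (b i)))

end TracePairing

/-! ### Compactness, eigenbases and functional calculus on eigenvectors -/

section Spectral

variable {H : Type u} [NormedAddCommGroup H] [InnerProductSpace ℂ H] [CompleteSpace H]
variable {ι : Type v} {κ : Type w}

omit [CompleteSpace H] in
theorem clm_ext_basis {K : Type*} [NormedAddCommGroup K] [NormedSpace ℂ K]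
    (b : HilbertBasis ι ℂ H) {S T : H →L[ℂ] K} (h : ∀ i, S (b i) = T (b i)) : S = T := by
  refine ContinuousLinearMap.ext_on (s := Set.range b) ?_ ?_
  · exact Submodule.dense_iff_topologicalClosure_eq_top.mpr b.dense_span
  · rintro _ ⟨i, rfl⟩
    exact h i

omit [CompleteSpace H] in
theorem inner_basis_self (b : HilbertBasis ι ℂ H) (i : ι) : ⟪b i, b i⟫_ℂ = 1 := by
  rw [inner_self_eq_norm_sq_to_K, b.orthonormal.1 i]
  simp

omit [CompleteSpace H] in
theorem isCompactOperator_rankOne (x y : H) :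
    IsCompactOperator (InnerProductSpace.rankOne ℂ x y) := by
  have h1 : IsCompactOperator (innerSL ℂ y) :=
    isCompactOperator_of_locallyCompactSpace_dom (innerSL ℂ y)
  exact h1.clm_comp (ContinuousLinearMap.toSpanSingleton ℂ x)

/-- Parseval for S*y: ‖S*y‖² = ∑ |⟪S b_i, y⟫|² ≤ ‖y‖² ∑ ‖S b_i‖², and ‖S*‖ = ‖S‖. -/
theorem norm_sq_le_posTrace (b : HilbertBasis ι ℂ H) (S : H →L[ℂ] H) :
    ENNReal.ofReal (‖S‖ ^ 2) ≤ ∑' i, ENNReal.ofReal (‖S (b i)‖ ^ 2) := by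
  by_cases htop : ∑' i, ENNReal.ofReal (‖S (b i)‖ ^ 2) = ⊤
  · rw [htop]
    exact le_top
  rw [← ENNReal.ofReal_toReal htop]
  refine ENNReal.ofReal_le_ofReal ?_
  rw [← norm_star S]
  set c := (∑' i, ENNReal.ofReal (‖S (b i)‖ ^ 2)).toReal with hc
  have hc0 : 0 ≤ c := ENNReal.toReal_nonneg
  refine (Real.le_sqrt (norm_nonneg _) hc0).mp ?_
  refine ContinuousLinearMap.opNorm_le_bound _ (Real.sqrt_nonneg _) fun y => ?_
  refine (sq_le_sq₀ (norm_nonneg _) (by positivity)).mp ?_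
  rw [mul_pow, Real.sq_sqrt hc0]
  rw [← ENNReal.ofReal_le_ofReal_iff (by positivity), ← parseval_ennreal b,
    ENNReal.ofReal_mul hc0, hc, ENNReal.ofReal_toReal htop, ← ENNReal.tsum_mul_right]
  refine ENNReal.tsum_le_tsum fun i => ?_
  rw [inner_star_right, ← ENNReal.ofReal_mul (by positivity), ← mul_pow]
  exact ENNReal.ofReal_le_ofReal
    (pow_le_pow_left₀ (norm_nonneg _) (norm_inner_le_norm _ _) 2)

/-- Hilbert–Schmidt operators are compact. -/
theorem isCompactOperator_of_hilbertSchmidt {S : H →L[ℂ] H} (hS : posTrace (star S * S) ≠ ⊤) :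
    IsCompactOperator S := by
  classical
  set b := onb H
  rw [posTrace_star_mul_self b] at hS
  -- Finite-rank truncations of S. The squared norm of S - F s is at most the tail of the convergent
  -- sum ∑ ‖S b_i‖².
  let F : Finset (basisSet H) → (H →L[ℂ] H) := fun s =>
    ∑ i ∈ s, InnerProductSpace.rankOne ℂ (S (b i)) (b i)
  have hF : ∀ s, IsCompactOperator (F s) := by
    intro s
    have : F s ∈ compactOperator (RingHom.id ℂ) H H :=
      Submodule.sum_mem _ fun i _ => isCompactOperator_rankOne _ _
    exact this
  have hFb : ∀ s i, F s (b i) = if i ∈ s then S (b i) else 0 := by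
    intro s i
    simp only [F, sum_apply, InnerProductSpace.rankOne_apply,
      orthonormal_iff_ite.mp b.orthonormal]
    simp
  have hlim := ENNReal.tendsto_tsum_compl_atTop_zero hS
  have hle : ∀ s, ENNReal.ofReal (‖S - F s‖ ^ 2)
      ≤ ∑' i : {i // i ∉ s}, ENNReal.ofReal (‖S (b i)‖ ^ 2) := by
    intro s
    refine (norm_sq_le_posTrace b (S - F s)).trans (le_of_eq ?_)
    refine Eq.trans ?_ (tsum_subtype {i | i ∉ s} fun i => ENNReal.ofReal (‖S (b i)‖ ^ 2)).symm
    refine tsum_congr fun i => ?_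
    by_cases hi : i ∈ s <;> simp [hFb, hi]
  have h0 : Filter.Tendsto (fun s => ENNReal.ofReal (‖S - F s‖ ^ 2)) Filter.atTop (nhds 0) :=
    tendsto_of_tendsto_of_tendsto_of_le_of_le tendsto_const_nhds hlim (fun _ => zero_le) hle
  have h1 : Filter.Tendsto (fun s => ‖S - F s‖ ^ 2) Filter.atTop (nhds 0) := by
    have := (ENNReal.tendsto_toReal ENNReal.zero_ne_top).comp h0
    simpa [Function.comp_def] using this
  have h2 : Filter.Tendsto (fun s => ‖S - F s‖) Filter.atTop (nhds 0) := by
    have := h1.sqrt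
    simpa using this
  refine isCompactOperator_of_tendsto (l := Filter.atTop) (F := F) ?_
    (Filter.Eventually.of_forall hF)
  rw [tendsto_iff_norm_sub_tendsto_zero]
  simpa only [norm_sub_rev] using h2

theorem isCompactOperator_of_posTrace {T : H →L[ℂ] H} (hT : 0 ≤ T) (ht : posTrace T ≠ ⊤) :
    IsCompactOperator T := by
  have h : IsCompactOperator (CFC.sqrt T : H →L[ℂ] H) := by
    refine isCompactOperator_of_hilbertSchmidt ?_
    rwa [star_sqrt, CFC.sqrt_mul_sqrt_self T hT]
  have h' := h.comp_clm (CFC.sqrt T)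
  have e : (CFC.sqrt T : H →L[ℂ] H) ∘ (CFC.sqrt T : H →L[ℂ] H) = T := by
    conv_rhs => rw [← CFC.sqrt_mul_sqrt_self T hT]
    rfl
  rwa [e] at h'

/-- An orthonormal basis of eigenvectors of a compact self-adjoint operator. -/
theorem exists_eigenbasis {T : H →L[ℂ] H} (hT : IsCompactOperator T) (hs : IsSelfAdjoint T) :
    ∃ (ι : Type u) (b : HilbertBasis ι ℂ H) (a : ι → ℝ), ∀ i, T (b i) = (a i : ℂ) • b i := by
  have hsym : T.IsSymmetric := ContinuousLinearMap.isSelfAdjoint_iff_isSymmetric.mp hs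
  let G : ℂ → Submodule ℂ H := fun μ => Module.End.eigenspace (T : Module.End ℂ H) μ
  have hclosed : ∀ μ, IsClosed (G μ : Set H) := by
    intro μ
    have : (G μ : Set H) = {x | T x = μ • x} := by
      ext x
      exact Module.End.mem_eigenspace_iff
    rw [this]
    exact isClosed_eq T.continuous (continuous_const_smul μ)
  have : ∀ μ, CompleteSpace (G μ) := fun μ => (hclosed μ).completeSpace_coe
  have hfam : OrthogonalFamily ℂ (fun μ => G μ) fun μ => (G μ).subtypeₗᵢ :=
    hsym.orthogonalFamily_eigenspaces
  -- Orthonormal bases of all eigenspaces, the kernel included, are glued together. The family is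
  -- total because the eigenspaces of a compact self-adjoint operator have dense span.
  let e : (Σ μ, basisSet (G μ)) → H := fun a => (onb (G a.1) a.2 : G a.1)
  have hon : Orthonormal ℂ e := hfam.orthonormal_sigma_orthonormal fun μ => (onb (G μ)).orthonormal
  have hbot : (Submodule.span ℂ (Set.range e))ᗮ = ⊥ := by
    rw [eq_bot_iff, ← T.orthogonalComplement_iSup_eigenspaces_eq_bot hT hsym]
    intro x hx
    rw [Submodule.mem_orthogonal] at hx ⊢
    have key : ∀ μ, G μ ≤ (Submodule.span ℂ {x})ᗮ := by
      intro μ y hy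
      rw [Submodule.mem_orthogonal_singleton_iff_inner_right]
      have : (innerSL ℂ x).comp (G μ).subtypeL = 0 := by
        refine clm_ext_basis (onb (G μ)) fun i => ?_
        have h1 := hx (e ⟨μ, i⟩) (Submodule.subset_span ⟨⟨μ, i⟩, rfl⟩)
        have h2 : ⟪x, e ⟨μ, i⟩⟫_ℂ = 0 := inner_eq_zero_symm.mp h1
        exact h2
      exact congrArg (fun f => f ⟨y, hy⟩) this
    intro y hy
    have h3 : y ∈ (Submodule.span ℂ {x})ᗮ := (iSup_le key : (⨆ μ, G μ) ≤ _) hy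
    rw [Submodule.mem_orthogonal_singleton_iff_inner_left] at h3
    exact h3
  refine ⟨_, HilbertBasis.mkOfOrthogonalEqBot hon hbot, fun a => a.1.re, fun a => ?_⟩
  rw [HilbertBasis.coe_mkOfOrthogonalEqBot]
  have hmem : T (e a) = a.1 • e a := Module.End.mem_eigenspace_iff.mp (onb (G a.1) a.2).2
  have hne : e a ≠ 0 := fun h => by simpa [h] using hon.1 a
  have hev : Module.End.HasEigenvalue (T : Module.End ℂ H) a.1 :=
    Module.End.hasEigenvalue_of_hasEigenvector ⟨Module.End.mem_eigenspace_iff.mpr hmem, hne⟩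
  have := hsym.conj_eigenvalue_eq_self hev
  rw [Complex.conj_eq_iff_re.mp this]
  exact hmem

/-- The continuous functional calculus on eigenvectors. -/
theorem cfc_apply_eigenvector {T : H →L[ℂ] H} (hT : IsSelfAdjoint T) {x : H} {l : ℝ}
    (hx : T x = (l : ℂ) • x) {f : ℝ → ℝ} (hf : ContinuousOn f (spectrum ℝ T)) :
    cfc f T x = (f l : ℂ) • x := by
  by_cases hx0 : x = 0
  · simp [hx0]
  have hl : l ∈ spectrum ℝ T := by
    rw [spectrum.mem_iff]
    intro hu
    obtain ⟨S, hS⟩ := hu.exists_left_inv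
    have h1 : (algebraMap ℝ (H →L[ℂ] H) l - T) x = 0 := by
      rw [Algebra.algebraMap_eq_smul_one]
      simp [hx]
    have h2 : (S * (algebraMap ℝ (H →L[ℂ] H) l - T)) x = 0 := by
      exact (congrArg S h1).trans (map_zero S)
    rw [hS] at h2
    exact hx0 h2
  -- The claim is closed under sums, products and uniform limits in g, so by Stone–Weierstrass
  -- constants and the identity suffice.
  have key : ∀ g : C(spectrum ℝ T, ℝ), cfcHom hT g x = (g ⟨l, hl⟩ : ℂ) • x := by
    open scoped ContinuousFunctionalCalculus in
    intro g
    induction g using ContinuousMap.induction_on_of_compact with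
    | const r =>
      have : cfcHom hT (ContinuousMap.const _ r) = algebraMap ℝ (H →L[ℂ] H) r :=
        AlgHomClass.commutes (cfcHom hT) r
      rw [this, Algebra.algebraMap_eq_smul_one]
      simp
    | id => rw [cfcHom_id hT]; simpa using hx
    | star_id => rw [map_star, cfcHom_id, hT.star_eq]; simpa using hx
    | add f g hf hg => rw [map_add, add_apply, hf, hg]; simp [add_smul]
    | mul f g hf hg =>
      rw [map_mul, show (cfcHom hT f * cfcHom hT g) x = cfcHom hT f (cfcHom hT g x) from rfl, hg,
        map_smul, hf, smul_smul]
      simp [mul_comm]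
    | frequently f hf =>
      have hcl : IsClosed {g : C(spectrum ℝ T, ℝ) | cfcHom hT g x = (g ⟨l, hl⟩ : ℂ) • x} := by
        refine isClosed_eq ?_ ?_
        · exact (ContinuousLinearMap.apply ℂ H x).continuous.comp (cfcHom_continuous hT)
        · exact (Complex.continuous_ofReal.comp (continuous_eval_const _)).smul
            continuous_const
      change f ∈ {g : C(spectrum ℝ T, ℝ) | cfcHom hT g x = (g ⟨l, hl⟩ : ℂ) • x}
      rw [← hcl.closure_eq]
      exact mem_closure_of_frequently_of_tendsto hf Filter.tendsto_id
  rw [cfc_apply f T hT hf, key]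
  rfl

theorem rpow_apply_eigenvector {T : H →L[ℂ] H} (hT : 0 ≤ T) {x : H} {l : ℝ}
    (hx : T x = (l : ℂ) • x) {s : ℝ} (hs : 0 ≤ s) : (T ^ s) x = ((l ^ s : ℝ) : ℂ) • x := by
  rw [CFC.rpow_eq_cfc_real hT]
  exact cfc_apply_eigenvector hT.isSelfAdjoint hx
    (Real.continuous_rpow_const hs).continuousOn

theorem sqrt_apply_eigenvector {T : H →L[ℂ] H} (hT : 0 ≤ T) {x : H} {l : ℝ}
    (hx : T x = (l : ℂ) • x) : CFC.sqrt T x = ((Real.sqrt l : ℝ) : ℂ) • x := by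
  rw [CFC.sqrt_eq_rpow, Real.sqrt_eq_rpow]
  exact rpow_apply_eigenvector hT hx (by norm_num)

/-- `T` is diagonal in the basis `b`, with eigenvalues `a i ≥ 0`. -/
def Diag (b : HilbertBasis ι ℂ H) (a : ι → ℝ≥0) (T : H →L[ℂ] H) : Prop :=
  ∀ i, T (b i) = ((a i : ℝ) : ℂ) • b i

theorem exists_diag {T : H →L[ℂ] H} (hT : 0 ≤ T) (ht : posTrace T ≠ ⊤) :
    ∃ (ι : Type u) (b : HilbertBasis ι ℂ H) (a : ι → ℝ≥0), Diag b a T := by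
  obtain ⟨ι, b, a, h⟩ := exists_eigenbasis (isCompactOperator_of_posTrace hT ht) hT.isSelfAdjoint
  have ha : ∀ i, 0 ≤ a i := by
    intro i
    have := re_inner_nonneg hT (b i)
    rw [h i, inner_smul_right, inner_basis_self] at this
    simpa using this
  exact ⟨ι, b, fun i => ⟨a i, ha i⟩, h⟩

namespace Diag

variable {b : HilbertBasis ι ℂ H} {a : ι → ℝ≥0} {T : H →L[ℂ] H}

theorem rpow (h : Diag b a T) (hT : 0 ≤ T) {s : ℝ} (hs : 0 ≤ s) :
    Diag b (fun i => a i ^ s) (T ^ s) := by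
  intro i
  rw [rpow_apply_eigenvector hT (h i) hs]
  simp

theorem sqrt (h : Diag b a T) (hT : 0 ≤ T) :
    Diag b (fun i => NNReal.sqrt (a i)) (CFC.sqrt T) := by
  intro i
  rw [sqrt_apply_eigenvector hT (h i)]
  simp

theorem posTrace (h : Diag b a T) (hT : 0 ≤ T) : posTrace T = ∑' i, (a i : ℝ≥0∞) := by
  rw [posTrace_eq b hT]
  refine tsum_congr fun i => ?_
  rw [h i, inner_smul_right, inner_basis_self, mul_one, Complex.ofReal_re,
    ENNReal.ofReal_coe_nnreal]

theorem trPair (h : Diag b a T) (hT : 0 ≤ T) {Y : H →L[ℂ] H} (hY : 0 ≤ Y) :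
    trPair T Y = ∑' i, (a i : ℝ≥0∞) * ENNReal.ofReal (⟪b i, Y (b i)⟫_ℂ).re := by
  rw [SoftCovering.trPair, posTrace_eq b (sqrt_conj_nonneg T hY)]
  refine tsum_congr fun i => ?_
  have e : (CFC.sqrt T * Y * CFC.sqrt T) (b i) = CFC.sqrt T (Y (CFC.sqrt T (b i))) := rfl
  rw [e, ← inner_apply_comm (isSelfAdjoint_sqrt T), h.sqrt hT i, inner_smul_left, map_smul,
    inner_smul_right, Complex.conj_ofReal, ← mul_assoc, ← Complex.ofReal_mul,
    Complex.re_ofReal_mul, Real.coe_sqrt, Real.mul_self_sqrt (a i).coe_nonneg,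
    ENNReal.ofReal_mul (a i).coe_nonneg, ENNReal.ofReal_coe_nnreal]

/-- Quadratic forms of a diagonal operator. -/
theorem re_inner (h : Diag b a T) (hT : 0 ≤ T) (x : H) :
    ENNReal.ofReal (⟪x, T x⟫_ℂ).re
      = ∑' i, (a i : ℝ≥0∞) * ENNReal.ofReal (‖⟪b i, x⟫_ℂ‖ ^ 2) := by
  have e : (⟪x, T x⟫_ℂ).re = ‖CFC.sqrt T x‖ ^ 2 := by
    rw [← re_inner_star_mul_self, star_sqrt, CFC.sqrt_mul_sqrt_self T hT]
  rw [e, ← parseval_ennreal b]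
  refine tsum_congr fun i => ?_
  rw [← inner_apply_comm (isSelfAdjoint_sqrt T), h.sqrt hT i, inner_smul_left, norm_mul, mul_pow,
    ENNReal.ofReal_mul (by positivity)]
  congr 1
  simp [sq_abs]

theorem trPair_diag {c : HilbertBasis κ ℂ H} {a' : κ → ℝ≥0} {S : H →L[ℂ] H} (h : Diag b a T)
    (hT : 0 ≤ T) (h' : Diag c a' S) (hS : 0 ≤ S) :
    SoftCovering.trPair T S = ∑' i, ∑' j, (a i : ℝ≥0∞) * a' j *
      ENNReal.ofReal (‖⟪b i, c j⟫_ℂ‖ ^ 2) := by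
  rw [h.trPair hT hS]
  refine tsum_congr fun i => ?_
  rw [h'.re_inner hS, ← ENNReal.tsum_mul_left]
  refine tsum_congr fun j => ?_
  rw [norm_inner_symm, mul_assoc]

-- Self-adjointness need not be assumed: ⟪x, T x⟫ = ∑ a_i |⟪b_i, x⟫|² is real and nonnegative, and
-- over ℂ this suffices.
omit [CompleteSpace H] in
theorem nonneg (h : Diag b a T) : 0 ≤ T := by
  have hinner : ∀ x i, ⟪b i, T x⟫_ℂ = ((a i : ℝ) : ℂ) * ⟪b i, x⟫_ℂ := by
    intro x i
    have : (innerSL ℂ (b i)).comp T = ((a i : ℝ) : ℂ) • innerSL ℂ (b i) := by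
      refine clm_ext_basis b fun j => ?_
      by_cases hij : i = j
      · subst hij
        simp [h i]
      · simp [h j, b.orthonormal.2 hij]
    exact congrArg (fun f => f x) this
  have hsum : ∀ x, HasSum (fun i => (((a i : ℝ) * ‖⟪b i, x⟫_ℂ‖ ^ 2 : ℝ) : ℂ)) ⟪x, T x⟫_ℂ := by
    intro x
    refine (b.hasSum_inner_mul_inner x (T x)).congr_fun fun i => ?_
    rw [hinner, ← inner_conj_symm x (b i), mul_left_comm, ← Complex.normSq_eq_conj_mul_self,
      Complex.normSq_eq_norm_sq]
    push_cast
    rfl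
  rw [ContinuousLinearMap.nonneg_iff_isPositive, ContinuousLinearMap.isPositive_iff_complex]
  intro x
  have h1 := Complex.hasSum_re (hsum x)
  have h2 := h1.tsum_eq
  have h3 : ⟪x, T x⟫_ℂ = (((⟪x, T x⟫_ℂ).re : ℝ) : ℂ) := by
    rw [← h2]
    refine (hsum x).unique ?_
    exact Complex.hasSum_ofReal.mpr h1.summable.hasSum
  have h4 : 0 ≤ (⟪x, T x⟫_ℂ).re := by
    rw [← h2]
    exact tsum_nonneg fun i => mul_nonneg (a i).2 (by positivity)
  rw [← inner_conj_symm (T x) x, h3, Complex.conj_ofReal]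
  exact ⟨by simp, by simpa using h4⟩

end Diag

end Spectral

/-! ### Tests and the quantum Chernoff bound -/

section Tests

variable {H : Type u} [NormedAddCommGroup H] [InnerProductSpace ℂ H] [CompleteSpace H]
variable {ι : Type v}

theorem isStarProjection_starProjection (K : Submodule ℂ H) [K.HasOrthogonalProjection] :
    IsStarProjection K.starProjection :=
  ⟨K.isIdempotentElem_starProjection, ContinuousLinearMap.isSelfAdjoint_iff_isSymmetric.mpr
    K.starProjection_isSymmetric⟩

/-- The support projection of the positive part. -/
theorem exists_posPart_projection {D : H →L[ℂ] H} (hD : IsSelfAdjoint D) :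
    ∃ T : H →L[ℂ] H, IsStarProjection T ∧ T * D * T = D⁺ := by
  -- The projection sought is 1 - P, with P the projection onto ker D⁺. It annihilates D⁻, whose
  -- range lies in ker D⁺.
  let K : Submodule ℂ H := LinearMap.ker (D⁺).toLinearMap
  have hP := isStarProjection_starProjection K
  set P := K.starProjection with hPdef
  have hpos : IsSelfAdjoint D⁺ := (CFC.posPart_nonneg D).isSelfAdjoint
  have hneg : IsSelfAdjoint D⁻ := (CFC.negPart_nonneg D).isSelfAdjoint
  have h1 : D⁺ * P = 0 := by
    ext x
    exact K.starProjection_apply_mem x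
  have h2 : P * D⁻ = D⁻ := by
    ext x
    refine Submodule.starProjection_eq_self_iff.mpr ?_
    change D⁺ (D⁻ x) = 0
    exact congrArg (fun f : H →L[ℂ] H => f x) (CFC.posPart_mul_negPart D)
  have h1' : P * D⁺ = 0 := by
    have := congrArg star h1
    rwa [star_mul, hpos.star_eq, hP.isSelfAdjoint.star_eq, star_zero] at this
  have h2' : D⁻ * P = D⁻ := by
    have := congrArg star h2
    rwa [star_mul, hneg.star_eq, hP.isSelfAdjoint.star_eq] at this
  refine ⟨1 - P, hP.one_sub, ?_⟩
  conv_lhs => rw [← CFC.posPart_sub_negPart D hD]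
  simp only [mul_sub, sub_mul, one_mul, mul_one, h1, h1', h2, h2']
  simp

theorem trPair_rpow_self {A : H →L[ℂ] H} (hA : 0 ≤ A) (ht : posTrace A ≠ ⊤) {s : ℝ}
    (hs : s ∈ Set.Ioo (0 : ℝ) 1) : trPair (A ^ (1 - s)) (A ^ s) = posTrace A := by
  obtain ⟨ι, b, a, h⟩ := exists_diag hA ht
  rw [(h.rpow hA (by linarith [hs.2] : 0 ≤ 1 - s)).trPair CFC.rpow_nonneg CFC.rpow_nonneg,
    h.posTrace hA]
  refine tsum_congr fun i => ?_
  rw [h.rpow hA hs.1.le i, inner_smul_right, inner_basis_self, mul_one, Complex.ofReal_re,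
    ENNReal.ofReal_coe_nnreal, ← ENNReal.coe_mul]
  congr 1
  rcases eq_or_ne (a i) 0 with h0 | h0
  · rw [h0, NNReal.zero_rpow (by linarith [hs.2] : 1 - s ≠ 0), zero_mul]
  · rw [← NNReal.rpow_add h0]
    simp

/-- The quantum Chernoff bound of Audenaert et al.: the optimal test between `A` and `B` has total
error at most `Tr[A^{1-s} B^s]`. -/
theorem exists_test {A B : H →L[ℂ] H} (hA : 0 ≤ A) (hB : 0 ≤ B) (tA : posTrace A ≠ ⊤)
    (tB : posTrace B ≠ ⊤) {s : ℝ} (hs : s ∈ Set.Ioo (0 : ℝ) 1) :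
    ∃ T : H →L[ℂ] H, IsStarProjection T ∧
      trPair A (1 - T) + trPair B T ≤ trPair (A ^ (1 - s)) (B ^ s) := by
  have hD : IsSelfAdjoint (A - B) := hA.isSelfAdjoint.sub hB.isSelfAdjoint
  obtain ⟨T, hT, hTD⟩ := exists_posPart_projection hD
  refine ⟨T, hT, ?_⟩
  set D := (A - B)⁺ with hDdef
  have hD0 : 0 ≤ D := CFC.posPart_nonneg _
  have hT1 : 0 ≤ 1 - T := hT.one_sub.nonneg
  have hconj : ∀ {Y : H →L[ℂ] H}, 0 ≤ Y → 0 ≤ T * Y * T := fun hY => by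
    have := star_left_conjugate_nonneg hY T
    rwa [hT.isSelfAdjoint.star_eq] at this
  have e1 : T * A * T = T * B * T + D := by
    rw [← hTD]
    simp [mul_sub, sub_mul]
  have e2 : trPair A T = trPair B T + posTrace D := by
    rw [trPair_eq_of_isStarProjection hA hT, trPair_eq_of_isStarProjection hB hT, e1,
      posTrace_add (hconj hB) hD0]
  -- The total error of T is Tr A - Tr D, so Tr A ≤ Tr[A^{1-s} B^s] + Tr D remains to be shown.
  have e3 : trPair A (1 - T) + trPair B T + posTrace D = posTrace A := by
    rw [add_assoc, ← e2, ← trPair_add_right A hT1 hT.nonneg, sub_add_cancel, trPair_one_right hA]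
  have hDt : posTrace D ≠ ⊤ := ne_top_of_le_ne_top tA (e3 ▸ le_add_self)
  have hs' : s ∈ Set.Icc (0 : ℝ) 1 := ⟨hs.1.le, hs.2.le⟩
  have hs'' : 1 - s ∈ Set.Icc (0 : ℝ) 1 := ⟨by linarith [hs.2], by linarith [hs.1]⟩
  -- G = B + (A-B)⁺ = A + (A-B)⁻ dominates both A and B, hence so do its powers with exponents in
  -- [0,1] (Löwner–Heinz).
  set G := B + D with hG
  have hG0 : 0 ≤ G := add_nonneg hB hD0
  have hAG : A ≤ G := by
    have h1 := CFC.posPart_sub_negPart (A - B) hD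
    have h2 : G = A + (A - B)⁻ := by
      rw [hG, hDdef, eq_add_of_sub_eq h1]
      abel
    rw [h2]
    exact le_add_of_nonneg_right (CFC.negPart_nonneg _)
  have hBG : B ≤ G := le_add_of_nonneg_right hD0
  have hGt : posTrace G = posTrace B + posTrace D := posTrace_add hB hD0
  have hN : 0 ≤ G ^ s - B ^ s := sub_nonneg.mpr (CFC.rpow_le_rpow hs' hBG)
  have split : ∀ X : H →L[ℂ] H, trPair X (G ^ s) = trPair X (B ^ s) + trPair X (G ^ s - B ^ s) := by
    intro X
    rw [← trPair_add_right X CFC.rpow_nonneg hN, add_sub_cancel]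
  -- The left side is Tr G - Tr[G^{1-s} B^s] ≤ Tr G - Tr B = Tr D, written without subtraction in
  -- [0,∞].
  have i1 : trPair (G ^ (1 - s)) (G ^ s - B ^ s) ≤ posTrace D := by
    have h1 : posTrace B ≤ trPair (G ^ (1 - s)) (B ^ s) := by
      rw [← trPair_rpow_self hB tB hs]
      exact trPair_mono_left CFC.rpow_nonneg (CFC.rpow_le_rpow hs'' hBG) CFC.rpow_nonneg
    have h2 := split (G ^ (1 - s))
    rw [trPair_rpow_self hG0 (by rw [hGt]; exact ENNReal.add_ne_top.mpr ⟨tB, hDt⟩) hs, hGt] at h2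
    refine (ENNReal.add_le_add_iff_left tB).mp ?_
    rw [h2]
    gcongr
  -- A^s is enlarged to G^s, and then A^{1-s} to G^{1-s}, but the latter only against the increment
  -- G^s - B^s.
  have i2 : posTrace A ≤ trPair (A ^ (1 - s)) (B ^ s) + posTrace D := by
    calc posTrace A = trPair (A ^ (1 - s)) (A ^ s) := (trPair_rpow_self hA tA hs).symm
      _ ≤ trPair (A ^ (1 - s)) (G ^ s) :=
        trPair_mono_right _ CFC.rpow_nonneg (CFC.rpow_le_rpow hs' hAG)
      _ = trPair (A ^ (1 - s)) (B ^ s) + trPair (A ^ (1 - s)) (G ^ s - B ^ s) := split _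
      _ ≤ trPair (A ^ (1 - s)) (B ^ s) + trPair (G ^ (1 - s)) (G ^ s - B ^ s) := by
        gcongr
        exact trPair_mono_left CFC.rpow_nonneg (CFC.rpow_le_rpow hs'' hAG) hN
      _ ≤ _ := by gcongr
  rw [← e3] at i2
  exact (ENNReal.add_le_add_iff_right hDt).mp i2

end Tests

/-! ### Trace distance of density operators -/

section TraceNorm

variable {H : Type u} [NormedAddCommGroup H] [InnerProductSpace ℂ H] [CompleteSpace H]
variable {ι : Type v}

theorem IsDensity.ne_top {C : H →L[ℂ] H} (hC : IsDensity C) : posTrace C ≠ ⊤ := by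
  rw [hC.2]
  exact ENNReal.one_ne_top

theorem posTrace_abs {D : H →L[ℂ] H} (hD : IsSelfAdjoint D) {b : HilbertBasis ι ℂ H} {l : ι → ℝ}
    (h : ∀ i, D (b i) = (l i : ℂ) • b i) :
    posTrace (CFC.abs D) = ∑' i, ENNReal.ofReal |l i| := by
  rw [posTrace_eq b (CFC.abs_nonneg D)]
  refine tsum_congr fun i => ?_
  have h2 : (star D * D) (b i) = ((l i ^ 2 : ℝ) : ℂ) • b i := by
    rw [hD.star_eq, show (D * D) (b i) = D (D (b i)) from rfl, h, map_smul, h, smul_smul]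
    push_cast
    rw [sq]
  rw [CFC.abs, sqrt_apply_eigenvector (star_mul_self_nonneg D) h2, inner_smul_right,
    inner_basis_self, Real.sqrt_sq_eq_abs]
  simp

theorem hasSum_density {C : H →L[ℂ] H} (hC : IsDensity C) (b : HilbertBasis ι ℂ H) :
    HasSum (fun i => (⟪b i, C (b i)⟫_ℂ).re) 1 := by
  have h := hasSum_trPair b hC.1 zero_le_one hC.ne_top
  rw [trPair_one_right hC.1, hC.2] at h
  refine (h.congr_fun fun i => ?_)
  rw [inner_apply_comm hC.1.isSelfAdjoint]
  rfl

/-- Each eigenvalue l i is the difference of the diagonal entries of C and S, so |l i| is at most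
their sum, and these sums add up to 2. -/
theorem traceNorm_sub_hasSum {C S : H →L[ℂ] H} (hC : IsDensity C) (hS : IsDensity S)
    {b : HilbertBasis ι ℂ H} {l : ι → ℝ} (h : ∀ i, (C - S) (b i) = (l i : ℂ) • b i) :
    HasSum (fun i => |l i|) (traceNorm (C - S)) ∧ traceNorm (C - S) ≤ 2 ∧ HasSum l 0 := by
  have hl : ∀ i, l i = (⟪b i, C (b i)⟫_ℂ).re - (⟪b i, S (b i)⟫_ℂ).re := by
    intro i
    have := congrArg (fun y => (⟪b i, y⟫_ℂ).re) (h i)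
    simp only [inner_smul_right, inner_basis_self] at this
    rw [sub_apply, inner_sub_right] at this
    simpa using this.symm
  have hCb := hasSum_density hC b
  have hSb := hasSum_density hS b
  have habs : ∀ i, |l i| ≤ (⟪b i, C (b i)⟫_ℂ).re + (⟪b i, S (b i)⟫_ℂ).re := by
    intro i
    rw [hl]
    have h1 := re_inner_nonneg hC.1 (b i)
    have h2 := re_inner_nonneg hS.1 (b i)
    rw [abs_le]
    constructor <;> linarith
  have hsum : Summable fun i => |l i| :=
    Summable.of_nonneg_of_le (fun i => abs_nonneg _) habs (hCb.add hSb).summable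
  have htn : traceNorm (C - S) = ∑' i, |l i| := by
    rw [traceNorm, posTrace_abs (hC.1.isSelfAdjoint.sub hS.1.isSelfAdjoint) h,
      ENNReal.tsum_toReal_eq (fun i => ENNReal.ofReal_ne_top)]
    exact tsum_congr fun i => ENNReal.toReal_ofReal (abs_nonneg _)
  refine ⟨htn ▸ hsum.hasSum, ?_, ?_⟩
  · rw [htn]
    have := hasSum_le habs hsum.hasSum (hCb.add hSb)
    linarith
  · have := hCb.sub hSb
    rw [sub_self] at this
    exact this.congr_fun hl

theorem exists_eigenbasis_sub {C S : H →L[ℂ] H} (hC : IsDensity C) (hS : IsDensity S) :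
    ∃ (ι : Type u) (b : HilbertBasis ι ℂ H) (l : ι → ℝ), ∀ i, (C - S) (b i) = (l i : ℂ) • b i :=
  exists_eigenbasis ((isCompactOperator_of_posTrace hC.1 hC.ne_top).sub
    (isCompactOperator_of_posTrace hS.1 hS.ne_top)) (hC.1.isSelfAdjoint.sub hS.1.isSelfAdjoint)

theorem traceNorm_sub_le_two {C S : H →L[ℂ] H} (hC : IsDensity C) (hS : IsDensity S) :
    traceNorm (C - S) ≤ 2 := by
  obtain ⟨ι, b, l, h⟩ := exists_eigenbasis_sub hC hS
  exact (traceNorm_sub_hasSum hC hS h).2.1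

theorem traceNorm_nonneg (T : H →L[ℂ] H) : 0 ≤ traceNorm T := ENNReal.toReal_nonneg

/-- Every test bounds the trace distance from below. -/
theorem one_sub_traceNorm_le {C S T : H →L[ℂ] H} (hC : IsDensity C) (hS : IsDensity S)
    (hT : 0 ≤ T) (hT1 : T ≤ 1) :
    ENNReal.ofReal (1 - 1 / 2 * traceNorm (C - S)) ≤ trPair C (1 - T) + trPair S T := by
  obtain ⟨ι, b, l, h⟩ := exists_eigenbasis_sub hC hS
  obtain ⟨h1, -, h2⟩ := traceNorm_sub_hasSum hC hS h
  have hT' : 0 ≤ 1 - T := sub_nonneg.mpr hT1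
  have fC := ne_top_of_le_ne_top hC.ne_top (trPair_le_posTrace hC.1 hT' (sub_le_self 1 hT))
  have fS := ne_top_of_le_ne_top hS.ne_top (trPair_le_posTrace hS.1 hT hT1)
  have s1 := hasSum_trPair b hC.1 hT' hC.ne_top
  have s2 := hasSum_trPair b hS.1 hT hS.ne_top
  have s3 := hasSum_density hC b
  -- As ∑ l i = 0, the diagonal of T may be shifted by 1/2. The shifted entries lie in [-1/2, 1/2],
  -- which produces the factor ½ of the trace norm.
  have key : HasSum (fun i => l i * ((⟪b i, T (b i)⟫_ℂ).re - 1 / 2))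
      (1 - ((trPair C (1 - T)).toReal + (trPair S T).toReal)) := by
    have := (s3.sub (s1.add s2)).sub (h2.mul_right (1 / 2))
    rw [zero_mul, sub_zero] at this
    refine this.congr_fun fun i => ?_
    have e := congrArg (fun y => (⟪y, T (b i)⟫_ℂ).re) (h i)
    simp only [sub_apply, inner_sub_left, inner_smul_left, Complex.conj_ofReal,
      Complex.re_ofReal_mul, Complex.sub_re] at e
    have e' : (⟪C (b i), (1 - T) (b i)⟫_ℂ).re
        = (⟪b i, C (b i)⟫_ℂ).re - (⟪C (b i), T (b i)⟫_ℂ).re := by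
      rw [sub_apply, inner_sub_right, Complex.sub_re, ← inner_apply_comm hC.1.isSelfAdjoint]
      rfl
    rw [e', mul_sub, ← e]
    ring
  have hle : 1 - ((trPair C (1 - T)).toReal + (trPair S T).toReal)
      ≤ 1 / 2 * traceNorm (C - S) := by
    refine hasSum_le (fun i => ?_) key (h1.mul_left (1 / 2))
    have t0 := re_inner_nonneg hT (b i)
    have t1 := re_inner_nonneg hT' (b i)
    rw [sub_apply, inner_sub_right, Complex.sub_re,
      show (1 : H →L[ℂ] H) (b i) = b i from rfl, inner_basis_self, Complex.one_re] at t1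
    calc l i * ((⟪b i, T (b i)⟫_ℂ).re - 1 / 2) ≤ |l i| * |(⟪b i, T (b i)⟫_ℂ).re - 1 / 2| := by
          rw [← abs_mul]
          exact le_abs_self _
      _ ≤ |l i| * (1 / 2) := by
          gcongr
          rw [abs_le]
          constructor <;> linarith
      _ = _ := mul_comm _ _
  rw [← ENNReal.ofReal_toReal (ENNReal.add_ne_top.mpr ⟨fC, fS⟩), ENNReal.toReal_add fC fS]
  exact ENNReal.ofReal_le_ofReal (by linarith)

end TraceNorm

/-! ### The pretty good measurement -/

section Quotient

variable {H : Type u} [NormedAddCommGroup H] [InnerProductSpace ℂ H] [CompleteSpace H]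

/-- Simultaneous noncommutative quotients `P m = D^{-1/2} A m D^{-1/2}` (Douglas' lemma). -/
theorem exists_quotients {ι : Type*} [Fintype ι] {D : H →L[ℂ] H} (hD : 0 ≤ D)
    {A : ι → H →L[ℂ] H} (hA : ∀ m, 0 ≤ A m) (hle : ∑ m, A m ≤ D) :
    ∃ P : ι → H →L[ℂ] H, (∀ m, 0 ≤ P m) ∧ ∑ m, P m ≤ 1 ∧
      ∀ m, CFC.sqrt D * P m * CFC.sqrt D = A m := by
  set d := CFC.sqrt D with hd
  have hds : IsSelfAdjoint d := isSelfAdjoint_sqrt D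
  have hdd : d * d = D := CFC.sqrt_mul_sqrt_self D hD
  let K : Submodule ℂ H := LinearMap.ker d.toLinearMap
  -- The summand K = ker d makes the range of e dense. Hence `f m` factors through e as a bounded
  -- operator `k m` on all of H, which plays the part of √(A m) D^{-1/2} and vanishes on ker d.
  let e : (H × K) →ₗ[ℂ] H := d.toLinearMap.coprod K.subtype
  let f : ι → (H × K) →ₗ[ℂ] H := fun m =>
    (CFC.sqrt (A m)).toLinearMap ∘ₗ LinearMap.fst ℂ H K
  have hDn : ∀ x, ‖d x‖ ^ 2 = (⟪x, D x⟫_ℂ).re := by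
    intro x
    rw [← re_inner_star_mul_self, hds.star_eq, hdd]
  have hAn : ∀ m x, ‖CFC.sqrt (A m) x‖ ^ 2 = (⟪x, A m x⟫_ℂ).re := by
    intro m x
    rw [← re_inner_star_mul_self, star_sqrt, CFC.sqrt_mul_sqrt_self _ (hA m)]
  have hsum : ∀ x, ∑ m, ‖CFC.sqrt (A m) x‖ ^ 2 ≤ ‖d x‖ ^ 2 := by
    intro x
    have h1 := re_inner_nonneg (sub_nonneg.mpr hle) x
    rw [sub_apply, inner_sub_right, Complex.sub_re, sum_apply, inner_sum, Complex.re_sum] at h1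
    simp only [hAn, hDn]
    linarith
  -- The range of d is orthogonal to its kernel, so the K-component only enlarges ‖e z‖.
  have hen : ∀ z : H × K, ‖d z.1‖ ^ 2 ≤ ‖e z‖ ^ 2 := by
    intro z
    have h0 : ⟪d z.1, (z.2 : H)⟫_ℂ = 0 := by
      rw [inner_apply_comm hds, show d (z.2 : H) = 0 from z.2.2, inner_zero_right]
    have h1 : ‖e z‖ ^ 2 = ‖d z.1‖ ^ 2 + ‖(z.2 : H)‖ ^ 2 := by
      have := norm_add_sq (𝕜 := ℂ) (d z.1) (z.2 : H)
      rw [h0] at this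
      simpa [e] using this
    rw [h1]
    nlinarith [sq_nonneg ‖(z.2 : H)‖]
  have hfn : ∀ z, ∑ m, ‖f m z‖ ^ 2 ≤ ‖e z‖ ^ 2 := fun z => (hsum z.1).trans (hen z)
  have hb : ∀ m z, ‖f m z‖ ≤ 1 * ‖e z‖ := by
    intro m z
    rw [one_mul]
    refine (sq_le_sq₀ (norm_nonneg _) (norm_nonneg _)).mp ((hfn z).trans' ?_)
    exact Finset.single_le_sum (f := fun m => ‖f m z‖ ^ 2) (fun i _ => sq_nonneg _)
      (Finset.mem_univ m)
  have hdense : DenseRange e := by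
    have h1 : (LinearMap.range e)ᗮ = ⊥ := by
      rw [eq_bot_iff]
      intro w hw
      rw [Submodule.mem_orthogonal] at hw
      have h2 : d w = 0 := by
        refine ext_inner_left ℂ fun x => ?_
        rw [← inner_apply_comm hds, inner_zero_right]
        exact hw _ ⟨(x, 0), by simp [e]⟩
      have h3 := hw w ⟨(0, ⟨w, h2⟩), by simp [e]⟩
      exact inner_self_eq_zero.mp h3
    have h2 := (Submodule.topologicalClosure_eq_top_iff).mpr h1
    exact Submodule.dense_iff_topologicalClosure_eq_top.mpr h2
  let k : ι → H →L[ℂ] H := fun m => (f m).extendOfNorm e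
  have hk : ∀ m z, k m (e z) = f m z := fun m z =>
    LinearMap.extendOfNorm_eq hdense ⟨1, hb m⟩ z
  have hkd : ∀ m, k m * d = CFC.sqrt (A m) := by
    intro m
    ext x
    have := hk m (x, 0)
    simpa [e, f] using this
  refine ⟨fun m => star (k m) * k m, fun m => star_mul_self_nonneg _, ?_, fun m => ?_⟩
  · rw [← sub_nonneg]
    have hsa : IsSelfAdjoint (1 - ∑ m, star (k m) * k m) :=
      (IsSelfAdjoint.one _).sub (isSelfAdjoint_sum _ fun m _ => IsSelfAdjoint.star_mul_self (k m))
    refine nonneg_of_re_inner hsa fun x => ?_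
    rw [sub_apply, inner_sub_right, Complex.sub_re, sum_apply, inner_sum, Complex.re_sum,
      sub_nonneg]
    simp only [re_inner_star_mul_self]
    rw [show (⟪x, (1 : H →L[ℂ] H) x⟫_ℂ).re = ‖x‖ ^ 2 from inner_self_eq_norm_sq (𝕜 := ℂ) x]
    refine hdense.induction_on (p := fun x => ∑ m, ‖k m x‖ ^ 2 ≤ ‖x‖ ^ 2) x ?_ ?_
    · exact isClosed_le (by fun_prop) (by fun_prop)
    · intro z
      simp only [hk]
      exact hfn z
  · calc d * (star (k m) * k m) * d = star (k m * d) * (k m * d) := by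
          rw [star_mul, hds.star_eq]
          simp only [mul_assoc]
      _ = A m := by rw [hkd, star_sqrt, CFC.sqrt_mul_sqrt_self _ (hA m)]

theorem conj_sqrt_nonneg (D : H →L[ℂ] H) {X : H →L[ℂ] H} (hX : 0 ≤ X) :
    0 ≤ CFC.sqrt D * X * CFC.sqrt D := sqrt_conj_nonneg D hX

theorem posTrace_conj_sqrt_ne_top {D X : H →L[ℂ] H} (hD : 0 ≤ D) (hDt : posTrace D ≠ ⊤)
    (hX : 0 ≤ X) (hX1 : X ≤ 1) : posTrace (CFC.sqrt D * X * CFC.sqrt D) ≠ ⊤ :=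
  ne_top_of_le_ne_top hDt (trPair_le_posTrace hD hX hX1)

/-- Expand Tr[√D (X-Y) √D (X-Y)] ≥ 0. In an eigenbasis of D the nonnegativity holds term by term, so
real sums can be compared directly. -/
theorem two_mul_trPair_conj_le {D X Y : H →L[ℂ] H} (hD : 0 ≤ D) (hDt : posTrace D ≠ ⊤)
    (hX : 0 ≤ X) (hX1 : X ≤ 1) (hY : 0 ≤ Y) (hY1 : Y ≤ 1) :
    2 * trPair (CFC.sqrt D * X * CFC.sqrt D) Y
      ≤ trPair (CFC.sqrt D * X * CFC.sqrt D) X + trPair (CFC.sqrt D * Y * CFC.sqrt D) Y := by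
  obtain ⟨ι, b, a, h⟩ := exists_diag hD hDt
  have hd := h.sqrt hD
  set d := CFC.sqrt D with hddef
  have hds : IsSelfAdjoint d := isSelfAdjoint_sqrt D
  have hd0 : 0 ≤ d := CFC.sqrt_nonneg D
  have key : ∀ {X Y : H →L[ℂ] H}, 0 ≤ X → X ≤ 1 → 0 ≤ Y → Y ≤ 1 →
      trPair (d * X * d) Y ≠ ⊤ ∧
      HasSum (fun i => (NNReal.sqrt (a i) : ℝ) * (⟪X (b i), d (Y (b i))⟫_ℂ).re)
        (trPair (d * X * d) Y).toReal := by
    intro X Y hX hX1 hY hY1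
    have ht := posTrace_conj_sqrt_ne_top hD hDt hX hX1
    refine ⟨ne_top_of_le_ne_top ht (trPair_le_posTrace (conj_sqrt_nonneg D hX) hY hY1), ?_⟩
    refine (hasSum_trPair b (conj_sqrt_nonneg D hX) hY ht).congr_fun fun i => ?_
    rw [show (CFC.sqrt D * X * CFC.sqrt D) (b i) = d (X (d (b i))) from rfl, hd i, map_smul,
      map_smul, inner_smul_left, Complex.conj_ofReal, Complex.re_ofReal_mul, inner_apply_comm hds]
  obtain ⟨f1, s1⟩ := key hX hX1 hY hY1
  obtain ⟨f2, s2⟩ := key hX hX1 hX hX1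
  obtain ⟨f3, s3⟩ := key hY hY1 hY hY1
  have hle := hasSum_le (fun i => ?_) (s1.mul_left 2) (s2.add s3)
  · rw [← ENNReal.toReal_le_toReal (ENNReal.mul_ne_top (by simp) f1)
      (ENNReal.add_ne_top.mpr ⟨f2, f3⟩), ENNReal.toReal_add f2 f3, ENNReal.toReal_mul]
    simpa using hle
  · have h1 := re_inner_nonneg hd0 (X (b i) - Y (b i))
    rw [map_sub, inner_sub_left, inner_sub_right, inner_sub_right] at h1
    have h2 : (⟪Y (b i), d (X (b i))⟫_ℂ).re = (⟪X (b i), d (Y (b i))⟫_ℂ).re := by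
      rw [← inner_apply_comm hds, ← inner_conj_symm, Complex.conj_re]
    simp only [Complex.sub_re, h2] at h1
    nlinarith [(NNReal.sqrt (a i)).coe_nonneg]

/-- The pretty good measurement is at most twice as bad as any other test. -/
theorem trPair_quotient_le {D P T : H →L[ℂ] H} (hD : 0 ≤ D) (hDt : posTrace D ≠ ⊤)
    (hP : 0 ≤ P) (hP1 : P ≤ 1) (hT : 0 ≤ T) (hT1 : T ≤ 1) :
    trPair (CFC.sqrt D * P * CFC.sqrt D) (1 - P)
      ≤ trPair (CFC.sqrt D * P * CFC.sqrt D) (1 - T)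
        + trPair (D - CFC.sqrt D * P * CFC.sqrt D) T := by
  have h2 := two_mul_trPair_conj_le hD hDt hP hP1 hT hT1
  set d := CFC.sqrt D with hd
  have hdd : d * d = D := CFC.sqrt_mul_sqrt_self D hD
  have hA : 0 ≤ d * P * d := conj_sqrt_nonneg D hP
  have hB : 0 ≤ d * T * d := conj_sqrt_nonneg D hT
  have hDA : 0 ≤ D - d * P * d := by
    have := conj_sqrt_nonneg D (sub_nonneg.mpr hP1)
    rw [mul_sub, sub_mul, mul_one] at this
    rwa [← hd, hdd] at this
  have hAt := posTrace_conj_sqrt_ne_top hD hDt hP hP1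
  have hBt := posTrace_conj_sqrt_ne_top hD hDt hT hT1
  have e1 : trPair (d * P * d) (1 - P) + trPair (d * P * d) P = posTrace (d * P * d) := by
    rw [← trPair_add_right _ (sub_nonneg.mpr hP1) hP, sub_add_cancel, trPair_one_right hA]
  have e2 : trPair (d * P * d) (1 - T) + trPair (d * P * d) T = posTrace (d * P * d) := by
    rw [← trPair_add_right _ (sub_nonneg.mpr hT1) hT, sub_add_cancel, trPair_one_right hA]
  have e3 : trPair (d * P * d) T + trPair (D - d * P * d) T = posTrace (d * T * d) := by
    rw [← trPair_add_left hA hDA hT, add_sub_cancel]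
    rfl
  have e4 : trPair (d * T * d) T ≤ posTrace (d * T * d) := trPair_le_posTrace hB hT hT1
  have f1 : trPair (d * P * d) P ≠ ⊤ := ne_top_of_le_ne_top hAt (trPair_le_posTrace hA hP hP1)
  -- The finite quantity Tr[AP] + Tr[DT], with A = √D P √D, is added to both sides. The inequality
  -- then reads 2 Tr[AT] ≤ Tr[AP] + Tr[DT].
  refine (ENNReal.add_le_add_iff_right (ENNReal.add_ne_top.mpr ⟨f1, hBt⟩)).mp ?_
  calc trPair (d * P * d) (1 - P) + (trPair (d * P * d) P + posTrace (d * T * d))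
      = trPair (d * P * d) (1 - T) + trPair (d * P * d) T
        + (trPair (d * P * d) T + trPair (D - d * P * d) T) := by rw [← add_assoc, e1, e2, e3]
    _ = trPair (d * P * d) (1 - T) + trPair (D - d * P * d) T + 2 * trPair (d * P * d) T := by ring
    _ ≤ trPair (d * P * d) (1 - T) + trPair (D - d * P * d) T
        + (trPair (d * P * d) P + posTrace (d * T * d)) := by
      gcongr
      exact h2.trans (by gcongr)

end Quotient

/-! ### Sums over product distributions -/

section Product

variable {Y : Type v}

theorem tsum_prod_pi (n : ℕ) (g : Fin n → Y → ℝ≥0∞) :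
    ∑' c : Fin n → Y, ∏ j, g j (c j) = ∏ j, ∑' y, g j y := by
  induction n with
  | zero => simp
  | succ n ih =>
    rw [← (Fin.insertNthEquiv (fun _ => Y) 0).tsum_eq, ENNReal.tsum_prod', Fin.prod_univ_succ, ← ih,
      ← ENNReal.tsum_mul_right]
    refine tsum_congr fun y => ?_
    rw [← ENNReal.tsum_mul_left]
    refine tsum_congr fun c => ?_
    rw [Fin.prod_univ_succ]
    simp [Fin.insertNthEquiv]

variable {q : Y → ℝ≥0∞}

theorem tsum_prod_eq_one (hq : ∑' y, q y = 1) (n : ℕ) :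
    ∑' c : Fin n → Y, ∏ j, q (c j) = 1 := by
  rw [tsum_prod_pi n fun _ => q]
  simp [hq]

theorem tsum_insertNth {n : ℕ} (m : Fin (n + 1)) (F : (Fin (n + 1) → Y) → ℝ≥0∞) :
    ∑' c, F c = ∑' y, ∑' c : Fin n → Y, F (m.insertNth (α := fun _ => Y) y c) := by
  rw [← (Fin.insertNthEquiv (fun _ => Y) m).tsum_eq, ENNReal.tsum_prod']
  rfl

theorem tsum_prod_mul_apply (hq : ∑' y, q y = 1) {n : ℕ} (m : Fin n) (f : Y → ℝ≥0∞) :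
    ∑' c : Fin n → Y, (∏ j, q (c j)) * f (c m) = ∑' y, q y * f y := by
  obtain ⟨n, rfl⟩ : ∃ k, n = k + 1 := ⟨n - 1, by have := m.pos; omega⟩
  rw [tsum_insertNth m]
  refine tsum_congr fun y => ?_
  simp only [Fin.prod_univ_succAbove _ m, Fin.insertNth_apply_same, Fin.insertNth_apply_succAbove]
  rw [ENNReal.tsum_mul_right, ENNReal.tsum_mul_left, tsum_prod_eq_one hq, mul_one]

/-- Pairwise independence: every index other than m has the form `m.succAbove i`. -/
theorem tsum_prod_mul_apply₂ (hq : ∑' y, q y = 1) {n : ℕ} (m : Fin (n + 1)) (i : Fin n)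
    (f : Y → Y → ℝ≥0∞) :
    ∑' c : Fin (n + 1) → Y, (∏ j, q (c j)) * f (c m) (c (m.succAbove i))
      = ∑' y, q y * ∑' z, q z * f y z := by
  rw [tsum_insertNth m]
  refine tsum_congr fun y => ?_
  simp only [Fin.prod_univ_succAbove _ m, Fin.insertNth_apply_same, Fin.insertNth_apply_succAbove,
    mul_assoc]
  rw [ENNReal.tsum_mul_left, tsum_prod_mul_apply hq i (f y)]

end Product

/-! ### The one-shot bound for random codebooks -/

section OneShot

variable {K : Type u} [NormedAddCommGroup K] [InnerProductSpace ℂ K] [CompleteSpace K]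
variable {Y : Type v}

theorem smul_rpow {A : K →L[ℂ] K} (hA : 0 ≤ A) (ht : posTrace A ≠ ⊤) {r t : ℝ} (hr : 0 ≤ r)
    (ht0 : 0 ≤ t) : (r • A) ^ t = (r ^ t) • A ^ t := by
  lift r to ℝ≥0 using hr
  obtain ⟨ι, b, a, h⟩ := exists_diag hA ht
  have h' : Diag b (fun i => r * a i) ((r : ℝ) • A) := by
    intro i
    rw [smul_apply, h i, ← Complex.coe_smul, smul_smul, NNReal.coe_mul, Complex.ofReal_mul]
  refine clm_ext_basis b fun i => ?_
  rw [h'.rpow (smul_nonneg r.coe_nonneg hA) ht0 i, smul_apply, h.rpow hA ht0 i]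
  simp only
  rw [← Complex.coe_smul, smul_smul, ← Complex.ofReal_mul, NNReal.mul_rpow, NNReal.coe_mul,
    NNReal.coe_rpow r]

/-- Testing the codebook state against `S` is at most twice as good as testing every codeword
separately. -/
theorem one_sub_traceNorm_sum_le {ι : Type*} [Fintype ι] {A : ι → K →L[ℂ] K} {S : K →L[ℂ] K}
    (hA : ∀ m, 0 ≤ A m) (hC : IsDensity (∑ m, A m)) (hS : IsDensity S) {T : ι → K →L[ℂ] K}
    (hT : ∀ m, IsStarProjection (T m)) :
    ENNReal.ofReal (1 - 1 / 2 * traceNorm (∑ m, A m - S))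
      ≤ 2 * ∑ m, (trPair (A m) (1 - T m) + trPair (∑ m, A m + S - A m) (T m)) := by
  set C := ∑ m, A m with hCdef
  set D := C + S with hDdef
  have hD : 0 ≤ D := add_nonneg hC.1 hS.1
  have hDt : posTrace D ≠ ⊤ := by
    rw [posTrace_add hC.1 hS.1]
    exact ENNReal.add_ne_top.mpr ⟨hC.ne_top, hS.ne_top⟩
  obtain ⟨P, hP, hP1, hPA⟩ := exists_quotients hD hA (le_add_of_nonneg_right hS.1)
  have hPC : CFC.sqrt D * (∑ m, P m) * CFC.sqrt D = C := by
    rw [Finset.mul_sum, Finset.sum_mul, hCdef]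
    exact Finset.sum_congr rfl fun m _ => hPA m
  have hPs : 0 ≤ ∑ m, P m := Finset.sum_nonneg fun m _ => hP m
  have hPle : ∀ m, P m ≤ ∑ m, P m := fun m =>
    Finset.single_le_sum (fun i _ => hP i) (Finset.mem_univ m)
  -- The two errors of ∑ P_m agree: Tr[C P] + Tr[S P] = Tr[√D P √D] = Tr C for P = ∑ P_m.
  have e1 : trPair S (∑ m, P m) = trPair C (1 - ∑ m, P m) := by
    have f1 : trPair C (∑ m, P m) ≠ ⊤ :=
      ne_top_of_le_ne_top hC.ne_top (trPair_le_posTrace hC.1 hPs hP1)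
    refine (ENNReal.add_right_inj f1).mp ?_
    rw [← trPair_add_left hC.1 hS.1 hPs, ← trPair_add_right C hPs (sub_nonneg.mpr hP1),
      add_sub_cancel, trPair_one_right hC.1]
    exact congrArg posTrace hPC
  calc ENNReal.ofReal (1 - 1 / 2 * traceNorm (C - S))
      ≤ trPair C (1 - ∑ m, P m) + trPair S (∑ m, P m) := one_sub_traceNorm_le hC hS hPs hP1
    _ = 2 * ∑ m, trPair (A m) (1 - ∑ m, P m) := by
      rw [e1, ← two_mul, hCdef, trPair_sum_left hA (sub_nonneg.mpr hP1)]
    _ ≤ 2 * ∑ m, (trPair (A m) (1 - T m) + trPair (D - A m) (T m)) := by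
      gcongr with m
      -- Only the part P_m of ∑ P_m is kept against A_m.
      refine (trPair_mono_right _ (sub_nonneg.mpr hP1) (sub_le_sub_left (hPle m) 1)).trans ?_
      have := trPair_quotient_le hD hDt (hP m) ((hPle m).trans hP1) (hT m).nonneg (hT m).le_one
      rwa [hPA] at this

variable {q : Y → ℝ≥0∞} {W : Y → K →L[ℂ] K} {S : K →L[ℂ] K}

theorem isDensity_average {M : ℕ} (hM : 0 < M) (hW : ∀ y, IsDensity (W y)) (c : Fin M → Y) :
    IsDensity (∑ m, (1 / (M : ℝ)) • W (c m)) := by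
  have h0 : ∀ m, 0 ≤ (1 / (M : ℝ)) • W (c m) := fun m => smul_nonneg (by positivity) (hW _).1
  have h1 : 0 ≤ ∑ m, (1 / (M : ℝ)) • W (c m) := Finset.sum_nonneg fun m _ => h0 m
  refine ⟨h1, ?_⟩
  rw [← trPair_one_right h1, trPair_sum_left h0 zero_le_one]
  have : ∀ m, trPair ((1 / (M : ℝ)) • W (c m)) 1 = ENNReal.ofReal (1 / M) := by
    intro m
    rw [trPair_one_right (h0 m), posTrace_smul (by positivity), (hW _).2, mul_one]
  simp only [this, Finset.sum_const, Finset.card_univ, Fintype.card_fin, nsmul_eq_mul]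
  rw [← ENNReal.ofReal_natCast, ← ENNReal.ofReal_mul (by positivity)]
  have : (M : ℝ) ≠ 0 := by positivity
  field_simp
  simp

theorem four_mul_ofReal_rpow {M : ℕ} (hM : 0 < M) (s : ℝ) :
    4 * (M : ℝ≥0∞) * ENNReal.ofReal ((1 / (M : ℝ)) ^ (1 - s)) = ENNReal.ofReal (4 * (M : ℝ) ^ s) := by
  rw [show (4 : ℝ≥0∞) = ENNReal.ofReal 4 by simp, ← ENNReal.ofReal_natCast,
    ← ENNReal.ofReal_mul (by norm_num), ← ENNReal.ofReal_mul (by positivity), mul_assoc]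
  congr 2
  have hM' : (0 : ℝ) < M := by exact_mod_cast hM
  rw [one_div, Real.inv_rpow hM'.le, ← Real.rpow_neg hM'.le]
  nth_rw 1 [← Real.rpow_one (M : ℝ)]
  rw [← Real.rpow_add hM']
  congr 1
  ring

set_option maxHeartbeats 800000 in
/-- One-shot strong converse bound for random codebooks. -/
theorem tsum_codebook_le (hq : ∑' y, q y = 1) (hW : ∀ y, IsDensity (W y)) (hS : IsDensity S)
    (hqS : ∀ T : K →L[ℂ] K, 0 ≤ T → trPair S T = ∑' y, q y * trPair (W y) T)
    {M : ℕ} (hM : 0 < M) {s : ℝ} (hs : s ∈ Set.Ioo (0 : ℝ) 1) :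
    ∑' c : Fin M → Y, (∏ m, q (c m)) * ENNReal.ofReal
        (1 - 1 / 2 * traceNorm (∑ m, (1 / (M : ℝ)) • W (c m) - S))
      ≤ ENNReal.ofReal (4 * (M : ℝ) ^ s) * ∑' y, q y * trPair (W y ^ (1 - s)) (S ^ s) := by
  have hr : (0 : ℝ) ≤ 1 / M := by positivity
  set A : Y → K →L[ℂ] K := fun y => (1 / (M : ℝ)) • W y with hAdef
  have hA : ∀ y, 0 ≤ A y := fun y => smul_nonneg hr (hW y).1
  have hAt : ∀ y, posTrace (A y) ≠ ⊤ := fun y => by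
    rw [posTrace_smul hr, (hW y).2, mul_one]
    exact ENNReal.ofReal_ne_top
  -- The test depends on its codeword y alone and is therefore independent of all other codewords.
  choose T hT hTle using fun y => exists_test (hA y) hS.1 (hAt y) hS.ne_top hs
  have hqT : ∀ y, ∑' z, q z * trPair (A z) (T y) = ENNReal.ofReal (1 / M) * trPair S (T y) := by
    intro y
    rw [hqS _ (hT y).nonneg, ← ENNReal.tsum_mul_left]
    refine tsum_congr fun z => ?_
    rw [trPair_smul_left (hW z).1 (hT y).nonneg hr]
    ring
  -- In mean the other M - 1 codewords contribute (M-1)/M · S ≤ S, and the reference state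
  -- contributes another S, whence the factor 2.
  have hone : ∀ m : Fin M, ∑' c : Fin M → Y, (∏ j, q (c j)) *
      trPair (∑ j, A (c j) + S - A (c m)) (T (c m)) ≤ 2 * ∑' y, q y * trPair S (T y) := by
    obtain ⟨n, rfl⟩ : ∃ k, M = k + 1 := ⟨M - 1, by omega⟩
    intro m
    have e : ∀ c : Fin (n + 1) → Y, trPair (∑ j, A (c j) + S - A (c m)) (T (c m))
        = ∑ i, trPair (A (c (m.succAbove i))) (T (c m)) + trPair S (T (c m)) := by
      intro c
      rw [Fin.sum_univ_succAbove _ m,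
        show A (c m) + ∑ i, A (c (m.succAbove i)) + S - A (c m)
          = ∑ i, A (c (m.succAbove i)) + S by abel,
        trPair_add_left (Finset.sum_nonneg fun i _ => hA _) hS.1 (hT _).nonneg,
        trPair_sum_left (fun i => hA _) (hT _).nonneg]
    simp only [e, mul_add, Finset.mul_sum]
    rw [ENNReal.tsum_add, Summable.tsum_finsetSum fun i _ => ENNReal.summable,
      tsum_prod_mul_apply hq m fun y => trPair S (T y)]
    simp only [fun i => tsum_prod_mul_apply₂ hq m i fun y z => trPair (A z) (T y), hqT]
    rw [two_mul, Finset.sum_const, Finset.card_univ, Fintype.card_fin, nsmul_eq_mul]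
    gcongr
    rw [← ENNReal.tsum_mul_left]
    refine ENNReal.tsum_le_tsum fun y => ?_
    calc (n : ℝ≥0∞) * (q y * (ENNReal.ofReal (1 / ((n + 1 : ℕ) : ℝ)) * trPair S (T y)))
        = (n * ENNReal.ofReal (1 / ((n + 1 : ℕ) : ℝ))) * (q y * trPair S (T y)) := by ring
      _ ≤ 1 * (q y * trPair S (T y)) := by
        gcongr
        rw [← ENNReal.ofReal_natCast, ← ENNReal.ofReal_mul (by positivity), ← ENNReal.ofReal_one]
        refine ENNReal.ofReal_le_ofReal ?_
        rw [mul_one_div, div_le_one (by positivity)]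
        push_cast
        linarith
      _ = _ := one_mul _
  calc ∑' c : Fin M → Y, (∏ m, q (c m)) * ENNReal.ofReal
        (1 - 1 / 2 * traceNorm (∑ m, A (c m) - S))
      ≤ ∑' c : Fin M → Y, (∏ m, q (c m)) * (2 * ∑ m, (trPair (A (c m)) (1 - T (c m))
          + trPair (∑ j, A (c j) + S - A (c m)) (T (c m)))) := by
        gcongr with c
        exact one_sub_traceNorm_sum_le (fun m => hA (c m)) (isDensity_average hM hW c) hS
          fun m => hT (c m)
    _ = 2 * ∑ m, (∑' c : Fin M → Y, (∏ j, q (c j)) * trPair (A (c m)) (1 - T (c m))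
          + ∑' c : Fin M → Y, (∏ j, q (c j)) *
            trPair (∑ j, A (c j) + S - A (c m)) (T (c m))) := by
        simp only [← ENNReal.tsum_add, ← mul_add]
        rw [← Summable.tsum_finsetSum fun i _ => ENNReal.summable, ← ENNReal.tsum_mul_left]
        refine tsum_congr fun c => ?_
        rw [← Finset.mul_sum]
        ring
    -- The first error is doubled too, so that both fit the Chernoff bound. Together with the outer
    -- 2 this gives the constant 4.
    _ ≤ 2 * ∑ _m : Fin M, (2 * ∑' y, q y * trPair (A y) (1 - T y)
          + 2 * ∑' y, q y * trPair S (T y)) := by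
        gcongr with m
        · rw [tsum_prod_mul_apply hq m fun y => trPair (A y) (1 - T y), two_mul]
          exact le_self_add
        · exact hone m
    _ = 4 * M * ∑' y, q y * (trPair (A y) (1 - T y) + trPair S (T y)) := by
        rw [Finset.sum_const, Finset.card_univ, Fintype.card_fin, nsmul_eq_mul]
        simp only [mul_add, ENNReal.tsum_add]
        ring
    _ ≤ 4 * M * ∑' y, q y * trPair (A y ^ (1 - s)) (S ^ s) := by
        gcongr with y
        exact hTle y
    _ = ENNReal.ofReal (4 * (M : ℝ) ^ s) * ∑' y, q y * trPair (W y ^ (1 - s)) (S ^ s) := by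
        have hs1 : 0 ≤ 1 - s := by linarith [hs.2]
        have e : ∀ y, q y * trPair (A y ^ (1 - s)) (S ^ s) = ENNReal.ofReal ((1 / (M : ℝ)) ^ (1 - s))
            * (q y * trPair (W y ^ (1 - s)) (S ^ s)) := by
          intro y
          rw [smul_rpow (hW y).1 (hW y).ne_top hr hs1,
            trPair_smul_left CFC.rpow_nonneg CFC.rpow_nonneg (by positivity), mul_left_comm]
        rw [tsum_congr e, ENNReal.tsum_mul_left, ← mul_assoc, four_mul_ofReal_rpow hM]

/-- The bound passes from [0,∞] to ℝ without loss, because trace norms of differences of density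
operators are at most 2 and thus 1 - t/2 is nonnegative. -/
theorem one_sub_le_expectation (hq : ∑' y, q y = 1) (hW : ∀ y, IsDensity (W y))
    (hS : IsDensity S)
    (hqS : ∀ T : K →L[ℂ] K, 0 ≤ T → trPair S T = ∑' y, q y * trPair (W y) T)
    {M : ℕ} (hM : 0 < M) {s Q : ℝ} (hs : s ∈ Set.Ioo (0 : ℝ) 1) (hQ : 0 ≤ Q)
    (hQe : ∑' y, q y * trPair (W y ^ (1 - s)) (S ^ s) = ENNReal.ofReal Q) :
    1 - 4 * (M : ℝ) ^ s * Q ≤ 1 / 2 * ∑' c : Fin M → Y, (∏ m, (q (c m)).toReal) *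
      traceNorm (∑ m, (1 / (M : ℝ)) • W (c m) - S) := by
  have h := tsum_codebook_le hq hW hS hqS hM hs
  rw [hQe, ← ENNReal.ofReal_mul (by positivity)] at h
  set t : (Fin M → Y) → ℝ := fun c => traceNorm (∑ m, (1 / (M : ℝ)) • W (c m) - S) with ht
  have ht2 : ∀ c, t c ≤ 2 := fun c => traceNorm_sub_le_two (isDensity_average hM hW c) hS
  have ht0 : ∀ c, 0 ≤ t c := fun c => traceNorm_nonneg _
  have h1 := tsum_prod_eq_one hq M
  have hsum : HasSum (fun c : Fin M → Y => ∏ m, (q (c m)).toReal) 1 := by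
    have h2 : ∑' c : Fin M → Y, ∏ j, q (c j) ≠ ⊤ := h1 ▸ ENNReal.one_ne_top
    have h3 := (ENNReal.summable_toReal h2).hasSum
    rw [← ENNReal.tsum_toReal_eq (ENNReal.ne_top_of_tsum_ne_top h2), h1] at h3
    simpa [ENNReal.toReal_prod] using h3
  have hw : ∀ c : Fin M → Y, 0 ≤ ∏ m, (q (c m)).toReal :=
    fun c => Finset.prod_nonneg fun m _ => ENNReal.toReal_nonneg
  have hs2 : Summable fun c : Fin M → Y => (∏ m, (q (c m)).toReal) * t c :=
    Summable.of_nonneg_of_le (fun c => mul_nonneg (hw c) (ht0 c))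
      (fun c => mul_le_mul_of_nonneg_left (ht2 c) (hw c)) (hsum.summable.mul_right 2)
  have h4 : HasSum (fun c : Fin M → Y => (∏ m, (q (c m)).toReal) * (1 - 1 / 2 * t c))
      (1 - 1 / 2 * ∑' c, (∏ m, (q (c m)).toReal) * t c) := by
    refine (hsum.sub (hs2.hasSum.mul_left (1 / 2))).congr_fun fun c => ?_
    ring
  have h5 : ∑' c : Fin M → Y, (∏ m, q (c m)) * ENNReal.ofReal (1 - 1 / 2 * t c)
      = ENNReal.ofReal (1 - 1 / 2 * ∑' c, (∏ m, (q (c m)).toReal) * t c) := by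
    rw [← h4.tsum_eq, ENNReal.ofReal_tsum_of_nonneg (fun c => mul_nonneg (hw c)
      (by linarith [ht2 c])) h4.summable]
    refine tsum_congr fun c => ?_
    rw [ENNReal.ofReal_mul (hw c), ← ENNReal.toReal_prod, ENNReal.ofReal_toReal]
    exact ENNReal.ne_top_of_tsum_ne_top (h1 ▸ ENNReal.one_ne_top) c
  rw [h5, ENNReal.ofReal_le_ofReal_iff (by positivity)] at h
  linarith

end OneShot

/-! ### Traces of products of powers -/

section PowTrace

variable {H : Type u} [NormedAddCommGroup H] [InnerProductSpace ℂ H] [CompleteSpace H]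
variable {ι : Type v} {κ : Type w}

/-- `Tr[A^r B^t]`. -/
def powTrace (r t : ℝ) (A B : H →L[ℂ] H) : ℝ≥0∞ := trPair (A ^ r) (B ^ t)

theorem powTrace_one_one (r t : ℝ) : powTrace r t (1 : H →L[ℂ] H) 1 = posTrace (1 : H →L[ℂ] H) := by
  rw [powTrace, CFC.one_rpow, CFC.one_rpow, trPair_one_right zero_le_one]

theorem Diag.powTrace {b : HilbertBasis ι ℂ H} {a : ι → ℝ≥0} {A : H →L[ℂ] H} (h : Diag b a A)
    {c : HilbertBasis κ ℂ H} {a' : κ → ℝ≥0} {B : H →L[ℂ] H} (h' : Diag c a' B) {r t : ℝ}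
    (hr : 0 ≤ r) (ht : 0 ≤ t) :
    powTrace r t A B = ∑' i, ∑' j, ((a i ^ r : ℝ≥0) : ℝ≥0∞) * ((a' j ^ t : ℝ≥0) : ℝ≥0∞) *
      ENNReal.ofReal (‖⟪b i, c j⟫_ℂ‖ ^ 2) :=
  (h.rpow h.nonneg hr).trPair_diag CFC.rpow_nonneg (h'.rpow h'.nonneg ht) CFC.rpow_nonneg

end PowTrace

/-! ### Bases of Hilbert tensor products -/

section TensorBasis

variable {E : Type u} [NormedAddCommGroup E] [InnerProductSpace ℂ E]
variable {F : Type v} [NormedAddCommGroup F] [InnerProductSpace ℂ F]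
variable {ι : Type w} {κ : ι → Type*}

theorem clm_ext_tmul {G : Type*} [NormedAddCommGroup G] [NormedSpace ℂ G]
    {S T : HTensor E F →L[ℂ] G}
    (h : ∀ (x : E) (y : F), S ((x ⊗ₜ[ℂ] y : E ⊗[ℂ] F) : HTensor E F)
      = T ((x ⊗ₜ[ℂ] y : E ⊗[ℂ] F) : HTensor E F)) : S = T := by
  ext z
  induction z using Completion.induction_on with
  | hp => exact isClosed_eq S.continuous T.continuous
  | ih z =>
    induction z with
    | zero => rw [Completion.coe_zero, map_zero, map_zero]
    | add z w hz hw => rw [Completion.coe_add, map_add, map_add, hz, hw]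
    | tmul x y => exact h x y

theorem inner_tmul_coe (x x' : E) (y y' : F) :
    ⟪((x ⊗ₜ[ℂ] y : E ⊗[ℂ] F) : HTensor E F), ((x' ⊗ₜ[ℂ] y' : E ⊗[ℂ] F) : HTensor E F)⟫_ℂ
      = ⟪x, x'⟫_ℂ * ⟪y, y'⟫_ℂ := by
  rw [Completion.inner_coe, TensorProduct.inner_tmul]

theorem norm_tmul_coe (x : E) (y : F) :
    ‖((x ⊗ₜ[ℂ] y : E ⊗[ℂ] F) : HTensor E F)‖ = ‖x‖ * ‖y‖ := by
  rw [Completion.norm_coe, TensorProduct.norm_tmul]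

/-- `y ↦ x ⊗ y` as a bounded operator. -/
def tmulRight (x : E) : F →L[ℂ] HTensor E F :=
  (Completion.toComplₗᵢ (𝕜 := ℂ) (E := E ⊗[ℂ] F)).toLinearMap ∘ₗ (TensorProduct.mk ℂ E F x)
    |>.mkContinuous ‖x‖ fun y => (norm_tmul_coe x y).le

/-- `x ↦ x ⊗ y` as a bounded operator. -/
def tmulLeft (y : F) : E →L[ℂ] HTensor E F :=
  (Completion.toComplₗᵢ (𝕜 := ℂ) (E := E ⊗[ℂ] F)).toLinearMap ∘ₗ ((TensorProduct.mk ℂ E F).flip y)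
    |>.mkContinuous ‖y‖ fun x => (norm_tmul_coe x y).le.trans (mul_comm _ _).le

/-- A family of vectors spanning the Hilbert tensor product. -/
def tensorFamily (b : HilbertBasis ι ℂ E) (f : ∀ i, HilbertBasis (κ i) ℂ F) (p : Σ i, κ i) :
    HTensor E F :=
  ((b p.1 ⊗ₜ[ℂ] f p.1 p.2 : E ⊗[ℂ] F) : HTensor E F)

/-- The second basis may vary with the first index. This is needed for ρ_XB, where the eigenbasis of
ρ_x depends on x. -/
theorem orthonormal_tensorFamily (b : HilbertBasis ι ℂ E) (f : ∀ i, HilbertBasis (κ i) ℂ F) :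
    Orthonormal ℂ (tensorFamily b f) := by
  refine ⟨fun p => ?_, ?_⟩
  · rw [tensorFamily, norm_tmul_coe, b.orthonormal.1, (f p.1).orthonormal.1, mul_one]
  · rintro ⟨i, j⟩ ⟨i', j'⟩ hne
    change ⟪tensorFamily b f ⟨i, j⟩, tensorFamily b f ⟨i', j'⟩⟫_ℂ = 0
    rw [tensorFamily, tensorFamily, inner_tmul_coe]
    by_cases hi : i = i'
    · subst hi
      have hj : j ≠ j' := fun h => hne (by rw [h])
      rw [(f i).orthonormal.2 hj, mul_zero]
    · rw [b.orthonormal.2 hi, zero_mul]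

/-- If z is orthogonal to the family, the functional ⟪z, ·⟫ vanishes on b_i ⊗ y for all y, then on
all x ⊗ y, then everywhere by density. -/
theorem tensorFamily_orthogonal (b : HilbertBasis ι ℂ E) (f : ∀ i, HilbertBasis (κ i) ℂ F) :
    (Submodule.span ℂ (Set.range (tensorFamily b f)))ᗮ = ⊥ := by
  rw [eq_bot_iff]
  intro z hz
  rw [Submodule.mem_orthogonal] at hz
  have h0 : ∀ i j, ⟪z, tensorFamily b f ⟨i, j⟩⟫_ℂ = 0 := fun i j =>
    inner_eq_zero_symm.mp (hz _ (Submodule.subset_span ⟨⟨i, j⟩, rfl⟩))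
  have h1 : ∀ i, (innerSL ℂ z).comp (tmulRight (b i)) = (0 : F →L[ℂ] ℂ) := fun i =>
    clm_ext_basis (f i) fun j => h0 i j
  have h2 : ∀ y, (innerSL ℂ z).comp (tmulLeft y) = (0 : E →L[ℂ] ℂ) := fun y =>
    clm_ext_basis b fun i => congrArg (fun g => g y) (h1 i)
  have h3 : innerSL ℂ z = (0 : HTensor E F →L[ℂ] ℂ) :=
    clm_ext_tmul fun x y => congrArg (fun g => g x) (h2 y)
  exact inner_self_eq_zero.mp (congrArg (fun g => g z) h3)

/-- Hilbert bases of the Hilbert tensor product. -/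
def tensorBasis (b : HilbertBasis ι ℂ E) (f : ∀ i, HilbertBasis (κ i) ℂ F) :
    HilbertBasis (Σ i, κ i) ℂ (HTensor E F) :=
  HilbertBasis.mkOfOrthogonalEqBot (orthonormal_tensorFamily b f) (tensorFamily_orthogonal b f)

theorem tensorBasis_apply (b : HilbertBasis ι ℂ E) (f : ∀ i, HilbertBasis (κ i) ℂ F)
    (p : Σ i, κ i) : tensorBasis b f p = ((b p.1 ⊗ₜ[ℂ] f p.1 p.2 : E ⊗[ℂ] F) : HTensor E F) := by
  rw [tensorBasis, HilbertBasis.coe_mkOfOrthogonalEqBot]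
  rfl

theorem norm_inner_tensorBasis {ι' : Type*} {κ' : ι' → Type*} (b : HilbertBasis ι ℂ E)
    (f : ∀ i, HilbertBasis (κ i) ℂ F) (b' : HilbertBasis ι' ℂ E)
    (f' : ∀ i, HilbertBasis (κ' i) ℂ F) (p : Σ i, κ i) (p' : Σ i, κ' i) :
    ENNReal.ofReal (‖⟪tensorBasis b f p, tensorBasis b' f' p'⟫_ℂ‖ ^ 2)
      = ENNReal.ofReal (‖⟪b p.1, b' p'.1⟫_ℂ‖ ^ 2)
        * ENNReal.ofReal (‖⟪f p.1 p.2, f' p'.1 p'.2⟫_ℂ‖ ^ 2) := by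
  rw [tensorBasis_apply, tensorBasis_apply, inner_tmul_coe, norm_mul, mul_pow,
    ENNReal.ofReal_mul (by positivity)]

end TensorBasis

/-! ### Tensor products of density operators -/

section OpTensor

variable {E : Type u} [NormedAddCommGroup E] [InnerProductSpace ℂ E] [CompleteSpace E]
variable {F : Type v} [NormedAddCommGroup F] [InnerProductSpace ℂ F] [CompleteSpace F]

theorem norm_opTensor_le (A : E →L[ℂ] E) (B : F →L[ℂ] F) : ‖opTensor A B‖ ≤ ‖A‖ * ‖B‖ := by
  refine ContinuousLinearMap.opNorm_le_bound _ (by positivity) fun z => ?_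
  induction z using Completion.induction_on with
  | hp => exact isClosed_le (by fun_prop) (by fun_prop)
  | ih z =>
    have h : opTensor A B (z : HTensor E F)
        = ((TensorProduct.map A.toLinearMap B.toLinearMap z : E ⊗[ℂ] F) : HTensor E F) := by
      simp [opTensor]
    rw [h, Completion.norm_coe, Completion.norm_coe]
    exact norm_map_le A B z

theorem opTensor_add_left (A A' : E →L[ℂ] E) (B : F →L[ℂ] F) :
    opTensor (A + A') B = opTensor A B + opTensor A' B :=
  clm_ext_tmul fun x y => by
    rw [add_apply, opTensor_tmul, opTensor_tmul, opTensor_tmul, add_apply, TensorProduct.add_tmul,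
      Completion.coe_add]

theorem opTensor_add_right (A : E →L[ℂ] E) (B B' : F →L[ℂ] F) :
    opTensor A (B + B') = opTensor A B + opTensor A B' :=
  clm_ext_tmul fun x y => by
    rw [add_apply, opTensor_tmul, opTensor_tmul, opTensor_tmul, add_apply, TensorProduct.tmul_add,
      Completion.coe_add]

theorem opTensor_smul_left (r : ℂ) (A : E →L[ℂ] E) (B : F →L[ℂ] F) :
    opTensor (r • A) B = r • opTensor A B :=
  clm_ext_tmul fun x y => by
    rw [smul_apply, opTensor_tmul, opTensor_tmul, smul_apply, ← TensorProduct.smul_tmul',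
      Completion.coe_smul]

theorem opTensor_smul_right (r : ℂ) (A : E →L[ℂ] E) (B : F →L[ℂ] F) :
    opTensor A (r • B) = r • opTensor A B :=
  clm_ext_tmul fun x y => by
    rw [smul_apply, opTensor_tmul, opTensor_tmul, smul_apply, TensorProduct.tmul_smul,
      Completion.coe_smul]

/-- Additivity with a norm bound gives continuity, which carries infinite sums through one slot of a
tensor product and through evaluation at a vector. -/
theorem hasSum_of_additive_of_bound {V : Type*} {V' : Type*} [NormedAddCommGroup V]
    [NormedAddCommGroup V'] (g : V → V') (hadd : ∀ x y, g (x + y) = g x + g y) {C : ℝ}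
    (hC : ∀ x, ‖g x‖ ≤ C * ‖x‖) {α : Type*} {f : α → V} {x : V} (h : HasSum f x) :
    HasSum (fun i => g (f i)) (g x) :=
  h.map (AddMonoidHom.mk' g hadd) (AddMonoidHomClass.continuous_of_bound _ C hC)

theorem hasSum_opTensor_left {α : Type*} {f : α → E →L[ℂ] E} {A : E →L[ℂ] E} (h : HasSum f A)
    (B : F →L[ℂ] F) : HasSum (fun x => opTensor (f x) B) (opTensor A B) :=
  hasSum_of_additive_of_bound (fun A => opTensor A B) (fun A A' => opTensor_add_left A A' B)
    (C := ‖B‖) (fun A => by rw [mul_comm]; exact norm_opTensor_le A B) h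

theorem hasSum_opTensor_right {α : Type*} (A : E →L[ℂ] E) {f : α → F →L[ℂ] F} {B : F →L[ℂ] F}
    (h : HasSum f B) : HasSum (fun x => opTensor A (f x)) (opTensor A B) :=
  hasSum_of_additive_of_bound (fun B => opTensor A B) (fun B B' => opTensor_add_right A B B')
    (C := ‖A‖) (fun B => norm_opTensor_le A B) h

theorem opTensor_smul_smul (r t : ℝ) (A : E →L[ℂ] E) (B : F →L[ℂ] F) :
    opTensor (r • A) (t • B) = (r * t) • opTensor A B := by
  rw [← Complex.coe_smul, ← Complex.coe_smul, ← Complex.coe_smul, opTensor_smul_left,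
    opTensor_smul_right, smul_smul, Complex.ofReal_mul]

variable {ι : Type*} {κ : Type*}

theorem Diag.tensor {b : HilbertBasis ι ℂ E} {a : ι → ℝ≥0} {A : E →L[ℂ] E} (h : Diag b a A)
    {c : HilbertBasis κ ℂ F} {a' : κ → ℝ≥0} {B : F →L[ℂ] F} (h' : Diag c a' B) :
    Diag (tensorBasis b fun _ => c) (fun p => a p.1 * a' p.2) (opTensor A B) := by
  intro p
  rw [tensorBasis_apply, opTensor_tmul, h, h', TensorProduct.smul_tmul_smul, Completion.coe_smul,
    NNReal.coe_mul, Complex.ofReal_mul]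

theorem opTensor_nonneg {A : E →L[ℂ] E} {B : F →L[ℂ] F} (hA : IsDensity A) (hB : IsDensity B) :
    0 ≤ opTensor A B := by
  obtain ⟨ι, b, a, h⟩ := exists_diag hA.1 hA.ne_top
  obtain ⟨κ, c, a', h'⟩ := exists_diag hB.1 hB.ne_top
  exact (h.tensor h').nonneg

theorem isDensity_opTensor {A : E →L[ℂ] E} {B : F →L[ℂ] F} (hA : IsDensity A)
    (hB : IsDensity B) : IsDensity (opTensor A B) := by
  refine ⟨opTensor_nonneg hA hB, ?_⟩
  obtain ⟨ι, b, a, h⟩ := exists_diag hA.1 hA.ne_top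
  obtain ⟨κ, c, a', h'⟩ := exists_diag hB.1 hB.ne_top
  rw [(h.tensor h').posTrace (h.tensor h').nonneg, ENNReal.tsum_sigma']
  simp only [ENNReal.coe_mul, ENNReal.tsum_mul_left]
  rw [ENNReal.tsum_mul_right, ← h.posTrace hA.1, ← h'.posTrace hB.1, hA.2, hB.2, one_mul]

/-- In product eigenbases the eigenvalues and the squared overlaps both factor, so the sum over four
indices splits. -/
theorem powTrace_opTensor {A A' : E →L[ℂ] E} {B B' : F →L[ℂ] F} (hA : IsDensity A)
    (hA' : IsDensity A') (hB : IsDensity B) (hB' : IsDensity B') {r t : ℝ} (hr : 0 ≤ r)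
    (ht : 0 ≤ t) :
    powTrace r t (opTensor A B) (opTensor A' B') = powTrace r t A A' * powTrace r t B B' := by
  obtain ⟨_, b, a, h⟩ := exists_diag hA.1 hA.ne_top
  obtain ⟨_, b', a', h'⟩ := exists_diag hA'.1 hA'.ne_top
  obtain ⟨_, c, d, g⟩ := exists_diag hB.1 hB.ne_top
  obtain ⟨_, c', d', g'⟩ := exists_diag hB'.1 hB'.ne_top
  rw [(h.tensor g).powTrace (h'.tensor g') hr ht, h.powTrace h' hr ht, g.powTrace g' hr ht]
  rw [ENNReal.tsum_sigma', ← ENNReal.tsum_mul_right]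
  refine tsum_congr fun i => ?_
  rw [← ENNReal.tsum_mul_left]
  refine tsum_congr fun j => ?_
  rw [ENNReal.tsum_sigma', ← ENNReal.tsum_mul_right]
  refine tsum_congr fun k => ?_
  rw [← ENNReal.tsum_mul_left]
  refine tsum_congr fun l => ?_
  rw [norm_inner_tensorBasis]
  simp only [NNReal.mul_rpow, ENNReal.coe_mul]
  ring

end OpTensor

/-! ### Product channels and the bound for blocks of n letters -/

section ProdOp

variable {X : Type v} {H : Type u} [NormedAddCommGroup H] [InnerProductSpace ℂ H]
  [CompleteSpace H]

theorem norm_le_one_of_isDensity {T : H →L[ℂ] H} (hT : IsDensity T) : ‖T‖ ≤ 1 := by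
  have h := norm_sq_le_posTrace (onb H) (CFC.sqrt T)
  rw [← posTrace_star_mul_self, star_sqrt, CFC.sqrt_mul_sqrt_self T hT.1, hT.2,
    ENNReal.ofReal_le_one] at h
  calc ‖T‖ = ‖CFC.sqrt T * CFC.sqrt T‖ := by rw [CFC.sqrt_mul_sqrt_self T hT.1]
    _ ≤ ‖CFC.sqrt T‖ * ‖CFC.sqrt T‖ := norm_mul_le _ _
    _ ≤ 1 := by rwa [← sq]

/-- The zeroth tensor power is one-dimensional, so its identity has trace one. -/
theorem isDensity_prodOp_zero (A : Fin 0 → H →L[ℂ] H) : IsDensity (prodOp 0 A) := by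
  have h1 : prodOp 0 A = 1 := rfl
  rw [h1]
  refine ⟨zero_le_one, ?_⟩
  let b : HilbertBasis PUnit.{u + 1} ℂ (TensorPower H 0) :=
    (EuclideanSpace.basisFun PUnit.{u + 1} ℂ).toHilbertBasis
  rw [posTrace_eq b zero_le_one]
  have e : ∀ i, ⟪b i, (1 : TensorPower H 0 →L[ℂ] TensorPower H 0) (b i)⟫_ℂ = 1 := inner_basis_self b
  simp only [e]
  simp

theorem isDensity_prodOp {n : ℕ} {A : Fin n → H →L[ℂ] H} (hA : ∀ i, IsDensity (A i)) :
    IsDensity (prodOp n A) := by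
  induction n with
  | zero => exact isDensity_prodOp_zero A
  | succ n ih => exact isDensity_opTensor (hA 0) (ih fun i => hA i.succ)

theorem powTrace_prodOp {n : ℕ} {A B : Fin n → H →L[ℂ] H} (hA : ∀ i, IsDensity (A i))
    (hB : ∀ i, IsDensity (B i)) {r t : ℝ} (hr : 0 ≤ r) (ht : 0 ≤ t) :
    powTrace r t (prodOp n A) (prodOp n B) = ∏ i, powTrace r t (A i) (B i) := by
  induction n with
  | zero =>
    rw [Finset.univ_eq_empty, Finset.prod_empty, ← (isDensity_prodOp_zero A).2]
    exact powTrace_one_one r t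
  | succ n ih =>
    rw [Fin.prod_univ_succ, ← ih (fun i => hA i.succ) fun i => hB i.succ]
    exact powTrace_opTensor (hA 0) (hB 0) (isDensity_prodOp fun i => hA i.succ)
      (isDensity_prodOp fun i => hB i.succ) hr ht

theorem hasSum_toReal (p : PMF X) : HasSum (fun x => (p x).toReal) 1 := by
  have h := (ENNReal.summable_toReal p.tsum_coe_ne_top).hasSum
  rw [← ENNReal.tsum_toReal_eq (fun x => p.apply_ne_top x), p.tsum_coe] at h
  exact h

theorem hasSum_stateB (p : PMF X) {ρ : X → H →L[ℂ] H} (hρ : ∀ x, IsDensity (ρ x)) :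
    HasSum (fun x => (p x).toReal • ρ x) (stateB p ρ) := by
  refine Summable.hasSum (Summable.of_norm_bounded (hasSum_toReal p).summable fun x => ?_)
  rw [norm_smul, Real.norm_of_nonneg ENNReal.toReal_nonneg]
  exact mul_le_of_le_one_right ENNReal.toReal_nonneg (norm_le_one_of_isDensity (hρ x))

theorem trPair_stateB (p : PMF X) {ρ : X → H →L[ℂ] H} (hρ : ∀ x, IsDensity (ρ x))
    {T : H →L[ℂ] H} (hT : 0 ≤ T) : trPair (stateB p ρ) T = ∑' x, p x * trPair (ρ x) T := by
  rw [stateB, trPair_tsum_left (fun x => smul_nonneg ENNReal.toReal_nonneg (hρ x).1)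
    (hasSum_stateB p hρ).summable hT]
  refine tsum_congr fun x => ?_
  rw [trPair_smul_left (hρ x).1 hT ENNReal.toReal_nonneg, ENNReal.ofReal_toReal (p.apply_ne_top x)]

theorem isDensity_stateB (p : PMF X) {ρ : X → H →L[ℂ] H} (hρ : ∀ x, IsDensity (ρ x)) :
    IsDensity (stateB p ρ) := by
  have h0 : 0 ≤ stateB p ρ := tsum_nonneg fun x => smul_nonneg ENNReal.toReal_nonneg (hρ x).1
  refine ⟨h0, ?_⟩
  rw [← trPair_one_right h0, trPair_stateB p hρ zero_le_one]
  simp only [trPair_one_right (hρ _).1, (hρ _).2, mul_one, p.tsum_coe]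

theorem summable_prod_toReal (p : PMF X) (n : ℕ) :
    Summable fun y : Fin n → X => ∏ i, (p (y i)).toReal := by
  have h1 := tsum_prod_eq_one p.tsum_coe n
  have h3 := ENNReal.summable_toReal (h1 ▸ ENNReal.one_ne_top : ∑' y : Fin n → X, ∏ i, p (y i) ≠ ⊤)
  simpa [ENNReal.toReal_prod] using h3

/-- Multilinear expansion of ρ_B^{⊗n}, one factor at a time. Density operators have norm at most 1,
so the series converges absolutely and may be regrouped by first letter. -/
theorem hasSum_prodOp (p : PMF X) {ρ : X → H →L[ℂ] H} (hρ : ∀ x, IsDensity (ρ x)) (n : ℕ) :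
    HasSum (fun y : Fin n → X => (∏ i, (p (y i)).toReal) • outputState ρ y)
      (prodOp n fun _ => stateB p ρ) := by
  induction n with
  | zero =>
    convert hasSum_unique (fun y : Fin 0 → X => (∏ i, (p (y i)).toReal) • outputState ρ y) using 1
    simp only [Finset.univ_eq_empty, Finset.prod_empty, one_smul]
    rfl
  | succ n ih =>
    rw [← (Fin.insertNthEquiv (fun _ => X) 0).hasSum_iff]
    set f : X × (Fin n → X) → (TensorPower H (n + 1) →L[ℂ] TensorPower H (n + 1)) :=
      (fun y : Fin (n + 1) → X => (∏ i, (p (y i)).toReal) • outputState ρ y) ∘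
        (Fin.insertNthEquiv (fun _ => X) 0) with hf
    have hsum : Summable f := by
      have h1 := (Fin.insertNthEquiv (fun _ => X) 0).summable_iff.mpr (summable_prod_toReal p (n + 1))
      refine Summable.of_norm_bounded h1 fun z => ?_
      simp only [hf, Function.comp_apply]
      have h0 : ∀ y : Fin (n + 1) → X, 0 ≤ ∏ i, (p (y i)).toReal :=
        fun y => Finset.prod_nonneg fun i _ => ENNReal.toReal_nonneg
      rw [norm_smul, Real.norm_of_nonneg (h0 _)]
      exact mul_le_of_le_one_right (h0 _)
        (norm_le_one_of_isDensity (isDensity_prodOp fun i => hρ _))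
    have hfx : ∀ x y, f (x, y) = (opTensor ((p x).toReal • ρ x)
        ((∏ i, (p (y i)).toReal) • outputState ρ y) :
          HTensor H (TensorPower H n) →L[ℂ] HTensor H (TensorPower H n)) := by
      intro x y
      rw [opTensor_smul_smul]
      simp only [hf, Function.comp_apply, Fin.prod_univ_succ]
      rfl
    have hfib : ∀ x, HasSum (fun y => f (x, y)) (opTensor ((p x).toReal • ρ x)
        (prodOp n fun _ => stateB p ρ) :
          HTensor H (TensorPower H n) →L[ℂ] HTensor H (TensorPower H n)) := by
      intro x
      simp only [hfx]
      exact hasSum_opTensor_right _ ih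
    have h2 := hsum.hasSum.prod_fiberwise hfib
    have h3 := hasSum_opTensor_left (hasSum_stateB p hρ) (prodOp n fun _ => stateB p ρ)
    have h4 := hsum.hasSum
    rw [h2.unique h3] at h4
    exact h4

theorem trPair_prodOp_stateB (p : PMF X) {ρ : X → H →L[ℂ] H} (hρ : ∀ x, IsDensity (ρ x)) (n : ℕ)
    {T : TensorPower H n →L[ℂ] TensorPower H n} (hT : 0 ≤ T) :
    trPair (prodOp n fun _ => stateB p ρ) T
      = ∑' y : Fin n → X, (∏ i, p (y i)) * trPair (outputState ρ y) T := by
  have h := hasSum_prodOp p hρ n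
  have h0 : ∀ y : Fin n → X, 0 ≤ ∏ i, (p (y i)).toReal :=
    fun y => Finset.prod_nonneg fun i _ => ENNReal.toReal_nonneg
  have hd : ∀ y : Fin n → X, IsDensity (outputState ρ y) := fun y => isDensity_prodOp fun i => hρ _
  rw [← h.tsum_eq, trPair_tsum_left (fun y => smul_nonneg (h0 y) (hd y).1) h.summable hT]
  refine tsum_congr fun y => ?_
  rw [trPair_smul_left (hd y).1 hT (h0 y), ← ENNReal.toReal_prod, ENNReal.ofReal_toReal]
  exact ENNReal.prod_ne_top fun i _ => p.apply_ne_top _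

/-- `∑ₓ p(x) Tr[ρ_x^{1-s} ρ_B^s]`. -/
def chernoffSum (p : PMF X) (ρ : X → H →L[ℂ] H) (s : ℝ) : ℝ≥0∞ :=
  ∑' x, p x * powTrace (1 - s) s (ρ x) (stateB p ρ)

/-- The one-shot bound for the alphabet of words: both p and the power traces are multiplicative, so
the sum over words is an n-th power. -/
theorem expectedTraceDist_ge (p : PMF X) {ρ : X → H →L[ℂ] H} (hρ : ∀ x, IsDensity (ρ x)) {n M : ℕ}
    (hM : 0 < M) {s : ℝ} (hs : s ∈ Set.Ioo (0 : ℝ) 1) (hfin : chernoffSum p ρ s ≠ ⊤) :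
    1 - 4 * (M : ℝ) ^ s * (chernoffSum p ρ s).toReal ^ n ≤ expectedTraceDist p ρ n M := by
  have hB := isDensity_stateB p hρ
  have hQ : ∑' y : Fin n → X, (∏ i, p (y i)) *
      powTrace (1 - s) s (outputState ρ y) (prodOp n fun _ => stateB p ρ)
        = ENNReal.ofReal ((chernoffSum p ρ s).toReal ^ n) := by
    rw [← ENNReal.toReal_pow, ENNReal.ofReal_toReal (ENNReal.pow_ne_top hfin)]
    have e : ∀ y : Fin n → X, (∏ i, p (y i)) *
        powTrace (1 - s) s (outputState ρ y) (prodOp n fun _ => stateB p ρ)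
          = ∏ i, p (y i) * powTrace (1 - s) s (ρ (y i)) (stateB p ρ) := by
      intro y
      rw [outputState, powTrace_prodOp (fun i => hρ _) (fun i => hB)
        (by linarith [hs.2]) hs.1.le, Finset.prod_mul_distrib]
    rw [tsum_congr e,
      tsum_prod_pi n fun _ x => p x * powTrace (1 - s) s (ρ x) (stateB p ρ)]
    simp [chernoffSum]
  have h := one_sub_le_expectation (q := fun y : Fin n → X => ∏ i, p (y i))
    (tsum_prod_eq_one p.tsum_coe n) (W := fun y => outputState ρ y)
    (fun y => isDensity_prodOp fun i => hρ _) (isDensity_prodOp fun _ => hB)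
    (fun T hT => trPair_prodOp_stateB p hρ n hT) hM hs (by positivity) hQ
  refine h.trans (le_of_eq ?_)
  simp only [expectedTraceDist, codebookProb, codebookState, ENNReal.toReal_prod, Finset.smul_sum]

end ProdOp

/-! ### Petz–Rényi divergence and relative entropy in eigenbases -/

section Quantities

variable {H : Type u} [NormedAddCommGroup H] [InnerProductSpace ℂ H] [CompleteSpace H]
variable {ι : Type v} {κ : Type w}

omit [CompleteSpace H] in
theorem tsum_norm_inner_sq (b : HilbertBasis ι ℂ H) (c : HilbertBasis κ ℂ H) (i : ι) :
    ∑' j, ENNReal.ofReal (‖⟪b i, c j⟫_ℂ‖ ^ 2) = 1 := by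
  simp only [norm_inner_symm (b i)]
  rw [parseval_ennreal, b.orthonormal.1 i]
  simp

omit [CompleteSpace H] in
theorem tsum_tsum_mul_norm_inner_sq (b : HilbertBasis ι ℂ H) (c : HilbertBasis κ ℂ H)
    (f : ι → ℝ≥0∞) :
    ∑' i, ∑' j, f i * ENNReal.ofReal (‖⟪b i, c j⟫_ℂ‖ ^ 2) = ∑' i, f i := by
  simp only [ENNReal.tsum_mul_left, tsum_norm_inner_sq, mul_one]

omit [CompleteSpace H] in
theorem tsum_tsum_mul_norm_inner_sq' (b : HilbertBasis ι ℂ H) (c : HilbertBasis κ ℂ H)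
    (f : κ → ℝ≥0∞) :
    ∑' i, ∑' j, f j * ENNReal.ofReal (‖⟪b i, c j⟫_ℂ‖ ^ 2) = ∑' j, f j := by
  rw [ENNReal.tsum_comm]
  simp only [norm_inner_symm (b _)]
  exact tsum_tsum_mul_norm_inner_sq c b f

/-- Cruder than the weighted mean inequality, but it serves only to show that traces are finite. -/
theorem rpow_mul_rpow_le_add (x y : ℝ≥0) {r t : ℝ} (hr : 0 ≤ r) (ht : 0 ≤ t)
    (h : r + t = 1) : x ^ r * y ^ t ≤ x + y := by
  calc x ^ r * y ^ t ≤ (x + y) ^ r * (x + y) ^ t :=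
        mul_le_mul' (NNReal.rpow_le_rpow le_self_add hr) (NNReal.rpow_le_rpow le_add_self ht)
    _ = x + y := by rw [← NNReal.rpow_add_of_nonneg _ hr ht, h, NNReal.rpow_one]

theorem powTrace_le_two {A B : H →L[ℂ] H} (hA : IsDensity A) (hB : IsDensity B) {r t : ℝ}
    (hr : 0 ≤ r) (ht : 0 ≤ t) (h : r + t = 1) : powTrace r t A B ≤ 2 := by
  obtain ⟨_, b, a, g⟩ := exists_diag hA.1 hA.ne_top
  obtain ⟨_, c, a', g'⟩ := exists_diag hB.1 hB.ne_top
  rw [g.powTrace g' hr ht]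
  calc _ ≤ ∑' i, ∑' j, ((a i : ℝ≥0∞) * ENNReal.ofReal (‖⟪b i, c j⟫_ℂ‖ ^ 2)
          + (a' j : ℝ≥0∞) * ENNReal.ofReal (‖⟪b i, c j⟫_ℂ‖ ^ 2)) := by
        gcongr with i j
        rw [← add_mul]
        gcongr
        exact_mod_cast rpow_mul_rpow_le_add (a i) (a' j) hr ht h
    _ = 2 := by
        simp only [ENNReal.tsum_add]
        rw [tsum_tsum_mul_norm_inner_sq, tsum_tsum_mul_norm_inner_sq', ← g.posTrace hA.1,
          ← g'.posTrace hB.1, hA.2, hB.2, one_add_one_eq_two]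

theorem powTrace_ne_top {A B : H →L[ℂ] H} (hA : IsDensity A) (hB : IsDensity B) {r t : ℝ}
    (hr : 0 ≤ r) (ht : 0 ≤ t) (h : r + t = 1) : powTrace r t A B ≠ ⊤ :=
  ne_top_of_le_ne_top (by simp) (powTrace_le_two hA hB hr ht h)

theorem rpow_mul_rpow_of_isDensity {A : H →L[ℂ] H} (hA : IsDensity A) {r t : ℝ} (hr : 0 ≤ r)
    (ht : 0 ≤ t) : A ^ r * A ^ t = A ^ (r + t) := by
  obtain ⟨_, b, a, g⟩ := exists_diag hA.1 hA.ne_top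
  refine clm_ext_basis b fun i => ?_
  rw [show (A ^ r * A ^ t) (b i) = (A ^ r) ((A ^ t) (b i)) from rfl, g.rpow hA.1 ht i, map_smul,
    g.rpow hA.1 hr i, g.rpow hA.1 (add_nonneg hr ht) i, smul_smul, ← Complex.ofReal_mul,
    ← NNReal.coe_mul]
  beta_reduce
  rw [NNReal.rpow_add_of_nonneg _ hr ht, mul_comm]

theorem trace_star_re (T : H →L[ℂ] H) : (trace (star T)).re = (trace T).re := by
  have : trace (star T) = starRingEnd ℂ (trace T) := by
    rw [trace, trace, Complex.conj_tsum]
    refine tsum_congr fun i => ?_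
    rw [inner_star_right, inner_conj_symm]
  rw [this, Complex.conj_re]

theorem isSelfAdjoint_rpow (A : H →L[ℂ] H) (r : ℝ) : IsSelfAdjoint (A ^ r) :=
  (CFC.rpow_nonneg (a := A) (y := r)).isSelfAdjoint

/-- The trace is Tr[B^{2t} A^{2r}] with 2r + 2t = 1, so A^r B^t is Hilbert–Schmidt. -/
theorem posTrace_star_mul_rpow_ne_top {A B : H →L[ℂ] H} (hA : IsDensity A) (hB : IsDensity B)
    {r t : ℝ} (hr : 0 ≤ r) (ht : 0 ≤ t) (h : r + t = 1 / 2) :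
    posTrace (star (A ^ r * B ^ t) * (A ^ r * B ^ t)) ≠ ⊤ := by
  have h2 : CFC.sqrt (B ^ (t + t)) = B ^ t :=
    CFC.sqrt_unique (rpow_mul_rpow_of_isDensity hB ht ht) CFC.rpow_nonneg
  have h3 : star (A ^ r * B ^ t) * (A ^ r * B ^ t)
      = CFC.sqrt (B ^ (t + t)) * A ^ (r + r) * CFC.sqrt (B ^ (t + t)) := by
    rw [h2, star_mul, (isSelfAdjoint_rpow _ _).star_eq, (isSelfAdjoint_rpow _ _).star_eq,
      ← rpow_mul_rpow_of_isDensity hA hr hr]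
    simp only [mul_assoc]
  rw [h3]
  exact powTrace_ne_top hB hA (by linarith) (by linarith) (by linarith)

theorem rpow_mul_rpow_eq_sqrt_mul {A : H →L[ℂ] H} (hA : IsDensity A) (B : H →L[ℂ] H) {α t : ℝ}
    (h0 : 1 / 2 ≤ α) : A ^ α * B ^ t = star (CFC.sqrt A) * (A ^ (α - 1 / 2) * B ^ t) := by
  have hα : 0 ≤ α - 1 / 2 := by linarith
  have h2 : (0 : ℝ) ≤ 1 / 2 := by norm_num
  have e := rpow_mul_rpow_of_isDensity hA h2 hα
  rw [add_sub_cancel] at e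
  rw [star_sqrt A, CFC.sqrt_eq_rpow, ← mul_assoc, e]

/-- For α ≥ 1/2 the operator A^α B^{1-α} = √A · A^{α-1/2} B^{1-α} is a product of two
Hilbert–Schmidt operators, so its trace may be taken in an eigenbasis of B. Smaller α follow by
taking adjoints. -/
theorem re_trace_rpow_mul_rpow_of_half_le {A B : H →L[ℂ] H} (hA : IsDensity A) (hB : IsDensity B)
    {α : ℝ} (h0 : 1 / 2 ≤ α) (h1 : α < 1) :
    (trace (A ^ α * B ^ (1 - α))).re = (powTrace α (1 - α) A B).toReal := by
  obtain ⟨_, c, a, g⟩ := exists_diag hB.1 hB.ne_top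
  have hα : 0 ≤ α - 1 / 2 := by linarith
  have hα' : 0 ≤ 1 - α := by linarith
  have e1 := rpow_mul_rpow_eq_sqrt_mul hA B (t := 1 - α) h0
  have fU : posTrace (star (CFC.sqrt A) * CFC.sqrt A) ≠ ⊤ := by
    rw [star_sqrt A, CFC.sqrt_mul_sqrt_self A hA.1]
    exact hA.ne_top
  have hs := re_trace_star_mul c fU (posTrace_star_mul_rpow_ne_top hA hB hα hα' (by ring))
  rw [← e1] at hs
  have gB := g.rpow hB.1 hα'
  have pA : (0 : H →L[ℂ] H) ≤ A ^ α := CFC.rpow_nonneg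
  have pB : (0 : H →L[ℂ] H) ≤ B ^ (1 - α) := CFC.rpow_nonneg
  rw [← hs.tsum_eq, powTrace, trPair_comm pA pB, gB.trPair pB pA,
    ENNReal.tsum_toReal_eq fun i => ENNReal.mul_ne_top ENNReal.coe_ne_top ENNReal.ofReal_ne_top]
  refine tsum_congr fun i => ?_
  have e2 : ⟪CFC.sqrt A (c i), (A ^ (α - 1 / 2) * B ^ (1 - α)) (c i)⟫_ℂ
      = ⟪c i, (A ^ α * B ^ (1 - α)) (c i)⟫_ℂ := by
    rw [e1]
    exact (inner_star_right _ _ _).symm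
  rw [ENNReal.toReal_mul, ENNReal.toReal_ofReal (re_inner_nonneg pA _), ENNReal.coe_toReal, e2,
    show (A ^ α * B ^ (1 - α)) (c i) = (A ^ α) ((B ^ (1 - α)) (c i)) from rfl, gB i, map_smul,
    inner_smul_right, Complex.re_ofReal_mul]

theorem powTrace_comm (r t : ℝ) (A B : H →L[ℂ] H) : powTrace r t A B = powTrace t r B A :=
  trPair_comm CFC.rpow_nonneg CFC.rpow_nonneg

theorem re_trace_rpow_mul_rpow {A B : H →L[ℂ] H} (hA : IsDensity A) (hB : IsDensity B)
    {α : ℝ} (h0 : 0 < α) (h1 : α < 1) :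
    (trace (A ^ α * B ^ (1 - α))).re = (powTrace α (1 - α) A B).toReal := by
  rcases le_total (1 / 2) α with h | h
  · exact re_trace_rpow_mul_rpow_of_half_le hA hB h h1
  · have e : A ^ α * B ^ (1 - α) = star (B ^ (1 - α) * A ^ (1 - (1 - α))) := by
      rw [star_mul, (isSelfAdjoint_rpow _ _).star_eq, (isSelfAdjoint_rpow _ _).star_eq,
        sub_sub_cancel]
    rw [e, trace_star_re, re_trace_rpow_mul_rpow_of_half_le hB hA (by linarith) (by linarith),
      powTrace_comm, sub_sub_cancel]

theorem petzDiv_eq {A B : H →L[ℂ] H} (hA : IsDensity A) (hB : IsDensity B) {α : ℝ} (h0 : 0 < α)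
    (h1 : α < 1) :
    petzDiv α A B = (((α - 1)⁻¹ : ℝ) : EReal) * ENNReal.log (powTrace α (1 - α) A B) := by
  rw [petzDiv, re_trace_rpow_mul_rpow hA hB h0 h1, ENNReal.ofReal_toReal]
  exact powTrace_ne_top hA hB h0.le (by linarith) (by ring)

open scoped Classical in
theorem eigenProj_apply_basis {b : HilbertBasis ι ℂ H} {a : ι → ℝ≥0} {T : H →L[ℂ] H}
    (h : Diag b a T) (l : ℝ) (i : ι) :
    eigenProj T l (b i) = if (a i : ℝ) = l then b i else 0 := by
  split_ifs with hl
  · refine Submodule.starProjection_eq_self_iff.mpr ?_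
    rw [LinearMap.mem_ker]
    change (T - (l : ℂ) • (1 : H →L[ℂ] H)) (b i) = 0
    rw [sub_apply, h i, hl, smul_apply]
    exact sub_self _
  · refine (Submodule.starProjection_apply_eq_zero_iff _).mpr ?_
    rw [Submodule.mem_orthogonal']
    intro y hy
    have hy' : T y = (l : ℂ) • y := by
      have : (T - (l : ℂ) • (1 : H →L[ℂ] H)) y = 0 := hy
      rw [sub_apply, smul_apply] at this
      exact sub_eq_zero.mp this
    have h2 := inner_apply_comm h.nonneg.isSelfAdjoint (b i) y
    rw [h i, hy', inner_smul_left, inner_smul_right, Complex.conj_ofReal, ← sub_eq_zero,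
      ← sub_mul, ← Complex.ofReal_sub] at h2
    rcases mul_eq_zero.mp h2 with h3 | h3
    · exact absurd (sub_eq_zero.mp (Complex.ofReal_eq_zero.mp h3)) hl
    · exact h3

open scoped Classical in
theorem posTrace_eigenProj {b : HilbertBasis ι ℂ H} {a : ι → ℝ≥0} {A : H →L[ℂ] H}
    (h : Diag b a A) {c : HilbertBasis κ ℂ H} {a' : κ → ℝ≥0} {B : H →L[ℂ] H} (h' : Diag c a' B)
    (l m : ℝ) :
    posTrace (eigenProj A l * eigenProj B m * eigenProj A l)
      = ∑' i, ∑' j, if (a i : ℝ) = l ∧ (a' j : ℝ) = m then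
        ENNReal.ofReal (‖⟪b i, c j⟫_ℂ‖ ^ 2) else 0 := by
  have hP : IsStarProjection (eigenProj A l) := isStarProjection_starProjection _
  have hQ : IsStarProjection (eigenProj B m) := isStarProjection_starProjection _
  have e : eigenProj A l * eigenProj B m * eigenProj A l
      = star (eigenProj B m * eigenProj A l) * (eigenProj B m * eigenProj A l) := by
    rw [star_mul, hP.isSelfAdjoint.star_eq, hQ.isSelfAdjoint.star_eq]
    conv_lhs => rw [← hQ.isIdempotentElem.eq]
    simp only [mul_assoc]
  rw [e, posTrace_star_mul_self b]
  refine tsum_congr fun i => ?_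
  rw [← parseval_ennreal c]
  refine tsum_congr fun j => ?_
  rw [show (eigenProj B m * eigenProj A l) (b i) = eigenProj B m (eigenProj A l (b i)) from rfl,
    ← inner_apply_comm hQ.isSelfAdjoint, eigenProj_apply_basis h, eigenProj_apply_basis h',
    norm_inner_symm]
  split_ifs <;> simp_all

/-- All terms lie in [0,∞], so the sums commute. For a fixed pair of eigenvectors only l = a_i and m
= a'_j survive among all real l, m. -/
theorem relEntropy_eq {b : HilbertBasis ι ℂ H} {a : ι → ℝ≥0} {A : H →L[ℂ] H}
    (h : Diag b a A) {c : HilbertBasis κ ℂ H} {a' : κ → ℝ≥0} {B : H →L[ℂ] H} (h' : Diag c a' B) :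
    relEntropy A B = ∑' i, ∑' j, klein (a i) (a' j) * ENNReal.ofReal (‖⟪b i, c j⟫_ℂ‖ ^ 2) := by
  classical
  let F : ℝ → ℝ → ι → κ → ℝ≥0∞ := fun l m i j => if (a i : ℝ) = l ∧ (a' j : ℝ) = m then
    klein l m * ENNReal.ofReal (‖⟪b i, c j⟫_ℂ‖ ^ 2) else 0
  calc relEntropy A B = ∑' (l : ℝ) (m : ℝ), ∑' i, ∑' j, F l m i j := by
        refine tsum_congr fun l => tsum_congr fun m => ?_
        rw [posTrace_eigenProj h h', ← ENNReal.tsum_mul_left]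
        refine tsum_congr fun i => ?_
        rw [← ENNReal.tsum_mul_left]
        refine tsum_congr fun j => ?_
        simp only [F, mul_ite, mul_zero]
    _ = ∑' i, ∑' j, ∑' (l : ℝ) (m : ℝ), F l m i j := by
        have e1 : ∀ l, ∑' m, ∑' i, ∑' j, F l m i j = ∑' i, ∑' j, ∑' m, F l m i j := fun l => by
          rw [ENNReal.tsum_comm]
          exact tsum_congr fun i => ENNReal.tsum_comm
        simp only [e1]
        rw [ENNReal.tsum_comm]
        exact tsum_congr fun i => ENNReal.tsum_comm
    _ = _ := by
        refine tsum_congr fun i => tsum_congr fun j => ?_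
        rw [tsum_eq_single (a i : ℝ) fun l hl => by simp [F, hl.symm],
          tsum_eq_single (a' j : ℝ) fun m hm => by simp [F, hm.symm]]
        simp [F]

end Quantities

/-! ### Classical-quantum states -/

section ClassicalQuantum

variable {X : Type v} {H : Type u} [NormedAddCommGroup H] [InnerProductSpace ℂ H]
  [CompleteSpace H]

/-- The standard basis of `ℓ²(X)`. -/
def registerBasis (X : Type v) : HilbertBasis X ℂ (Register X) :=
  HilbertBasis.ofRepr (LinearIsometryEquiv.refl ℂ _)

open scoped Classical in
theorem registerBasis_apply (x : X) : registerBasis X x = lp.single 2 x (1 : ℂ) := by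
  rw [← (registerBasis X).repr_symm_single x]
  rfl

open scoped Classical in
theorem ketbra_apply_basis (x y : X) :
    ketbra x (registerBasis X y) = if x = y then registerBasis X x else 0 := by
  rw [ketbra, ← registerBasis_apply, InnerProductSpace.rankOne_apply,
    orthonormal_iff_ite.mp (registerBasis X).orthonormal]
  split_ifs <;> simp

theorem norm_ketbra_le (x : X) : ‖ketbra x‖ ≤ 1 := by
  classical
  rw [ketbra, ← registerBasis_apply]
  refine ContinuousLinearMap.opNorm_le_bound _ zero_le_one fun y => ?_
  rw [InnerProductSpace.rankOne_apply, norm_smul, (registerBasis X).orthonormal.1 x, mul_one]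
  refine (norm_inner_le_norm _ _).trans ?_
  rw [(registerBasis X).orthonormal.1 x]

theorem hasSum_apply_vector {K : Type*} [NormedAddCommGroup K] [NormedSpace ℂ K] {α : Type*}
    {f : α → K →L[ℂ] K} {A : K →L[ℂ] K} (h : HasSum f A) (v : K) :
    HasSum (fun i => f i v) (A v) :=
  hasSum_of_additive_of_bound (fun T : K →L[ℂ] K => T v) (fun _ _ => rfl) (C := ‖v‖)
    (fun T => by rw [mul_comm]; exact T.le_opNorm v) h

theorem hasSum_toReal_smul {K : Type*} [NormedAddCommGroup K] [InnerProductSpace ℂ K]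
    [CompleteSpace K] (p : PMF X) {f : X → K →L[ℂ] K} (hf : ∀ x, ‖f x‖ ≤ 1) :
    HasSum (fun x => (p x).toReal • f x) (∑' x, (p x).toReal • f x) := by
  refine Summable.hasSum (Summable.of_norm_bounded (hasSum_toReal p).summable fun y => ?_)
  rw [norm_smul, Real.norm_of_nonneg ENNReal.toReal_nonneg]
  exact mul_le_of_le_one_right ENNReal.toReal_nonneg (hf y)

theorem hasSum_stateX (p : PMF X) : HasSum (fun x => (p x).toReal • ketbra x) (stateX p) :=
  hasSum_toReal_smul p norm_ketbra_le

theorem diag_stateX (p : PMF X) :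
    Diag (registerBasis X) (fun x => (p x).toNNReal) (stateX p) := by
  classical
  intro x
  have h := hasSum_apply_vector (hasSum_stateX p) (registerBasis X x)
  rw [← h.tsum_eq, tsum_eq_single x]
  · rw [smul_apply, ketbra_apply_basis, if_pos rfl, ← algebraMap_smul ℂ]
    rfl
  · intro y hy
    rw [smul_apply, ketbra_apply_basis, if_neg hy, smul_zero]

theorem norm_opTensor_ketbra_le {T : H →L[ℂ] H} (hT : IsDensity T) (x : X) :
    ‖opTensor (ketbra x) T‖ ≤ 1 :=
  (norm_opTensor_le (ketbra x) T).trans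
    (mul_le_one₀ (norm_ketbra_le x) (norm_nonneg T) (norm_le_one_of_isDensity hT))

theorem hasSum_stateXB (p : PMF X) {ρ : X → H →L[ℂ] H} (hρ : ∀ x, IsDensity (ρ x)) :
    HasSum (fun y => (p y).toReal • opTensor (ketbra y) (ρ y)) (stateXB p ρ) :=
  hasSum_toReal_smul p fun y => norm_opTensor_ketbra_le (hρ y) y

open scoped Classical in
theorem opTensor_ketbra_apply_basis {κ : X → Type*} (b : ∀ x, HilbertBasis (κ x) ℂ H) (y : X)
    (T : H →L[ℂ] H) (x : X) (i : κ x) :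
    opTensor (ketbra y) T (tensorBasis (registerBasis X) b ⟨x, i⟩)
      = if y = x then ((registerBasis X x ⊗ₜ[ℂ] T (b x i) : Register X ⊗[ℂ] H) :
        HTensor (Register X) H) else 0 := by
  rw [tensorBasis_apply, opTensor_tmul, ketbra_apply_basis]
  split_ifs with hy
  · rw [hy]
  · rw [TensorProduct.zero_tmul, Completion.coe_zero]

theorem diag_stateXB (p : PMF X) {ρ : X → H →L[ℂ] H} (hρ : ∀ x, IsDensity (ρ x)) {κ : X → Type*}
    {b : ∀ x, HilbertBasis (κ x) ℂ H} {a : ∀ x, κ x → ℝ≥0} (h : ∀ x, Diag (b x) (a x) (ρ x)) :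
    Diag (tensorBasis (registerBasis X) b) (fun z => (p z.1).toNNReal * a z.1 z.2)
      (stateXB p ρ) := by
  classical
  rintro ⟨x, i⟩
  have hv := hasSum_apply_vector (hasSum_stateXB p hρ) (tensorBasis (registerBasis X) b ⟨x, i⟩)
  have h0 : ∀ y, y ≠ x → ((p y).toReal • opTensor (ketbra y) (ρ y))
      (tensorBasis (registerBasis X) b ⟨x, i⟩) = 0 := fun y hy => by
    rw [smul_apply, opTensor_ketbra_apply_basis, if_neg hy, smul_zero]
  rw [← hv.tsum_eq, tsum_eq_single x h0, smul_apply, opTensor_ketbra_apply_basis, if_pos rfl, h x i,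
    TensorProduct.tmul_smul, Completion.coe_smul, tensorBasis_apply, ← Complex.coe_smul, smul_smul,
    ← Complex.ofReal_mul]
  rfl

theorem coe_toNNReal_pmf (p : PMF X) (x : X) : ((p x).toNNReal : ℝ≥0∞) = p x :=
  ENNReal.coe_toNNReal (p.apply_ne_top x)

theorem isDensity_stateX (p : PMF X) : IsDensity (stateX p) := by
  have h := diag_stateX p
  refine ⟨h.nonneg, ?_⟩
  rw [h.posTrace h.nonneg]
  simp only [coe_toNNReal_pmf, p.tsum_coe]

theorem exists_diag_family {ρ : X → H →L[ℂ] H} (hρ : ∀ x, IsDensity (ρ x)) :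
    ∃ (κ : X → Type u) (b : ∀ x, HilbertBasis (κ x) ℂ H) (a : ∀ x, κ x → ℝ≥0),
      ∀ x, Diag (b x) (a x) (ρ x) := by
  choose κ b a h using fun x => exists_diag (hρ x).1 (hρ x).ne_top
  exact ⟨κ, b, a, h⟩

theorem isDensity_stateXB (p : PMF X) {ρ : X → H →L[ℂ] H} (hρ : ∀ x, IsDensity (ρ x)) :
    IsDensity (stateXB p ρ) := by
  obtain ⟨κ, b, a, h⟩ := exists_diag_family hρ
  have hd := diag_stateXB p hρ h
  refine ⟨hd.nonneg, ?_⟩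
  rw [hd.posTrace hd.nonneg, ENNReal.tsum_sigma']
  simp only [ENNReal.coe_mul, ENNReal.tsum_mul_left, ← (h _).posTrace (hρ _).1, (hρ _).2,
    coe_toNNReal_pmf, mul_one, p.tsum_coe]

omit [CompleteSpace H] in
/-- Double sums over the eigenbases of `ρ_XB` and `ρ_X ⊗ ρ_B` localize in the register. -/
theorem tsum_tensorBasis {κ : X → Type*} {ι : Type*} (b : ∀ x, HilbertBasis (κ x) ℂ H)
    (c : HilbertBasis ι ℂ H) (F : (Σ x, κ x) → (Σ _ : X, ι) → ℝ≥0∞) :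
    ∑' z, ∑' z', F z z' * ENNReal.ofReal (‖⟪tensorBasis (registerBasis X) b z,
        tensorBasis (registerBasis X) (fun _ => c) z'⟫_ℂ‖ ^ 2)
      = ∑' x, ∑' i, ∑' j, F ⟨x, i⟩ ⟨x, j⟩ * ENNReal.ofReal (‖⟪b x i, c j⟫_ℂ‖ ^ 2) := by
  rw [ENNReal.tsum_sigma']
  refine tsum_congr fun x => tsum_congr fun i => ?_
  rw [ENNReal.tsum_sigma', tsum_eq_single x]
  · refine tsum_congr fun j => ?_
    rw [norm_inner_tensorBasis, inner_basis_self]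
    simp
  · intro y hy
    refine ENNReal.tsum_eq_zero.mpr fun j => ?_
    rw [norm_inner_tensorBasis, (registerBasis X).orthonormal.2 hy.symm]
    simp

/-- The register is diagonal in both states, with weights that combine to p(x)^{1-s} p(x)^s = p(x).
-/
theorem powTrace_stateXB (p : PMF X) {ρ : X → H →L[ℂ] H} (hρ : ∀ x, IsDensity (ρ x)) {s : ℝ}
    (hs : s ∈ Set.Ioo (0 : ℝ) 1) :
    powTrace (1 - s) s (stateXB p ρ) (opTensor (stateX p) (stateB p ρ)) = chernoffSum p ρ s := by
  obtain ⟨κ, b, a, h⟩ := exists_diag_family hρ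
  have hB := isDensity_stateB p hρ
  obtain ⟨_, c, a', h'⟩ := exists_diag hB.1 hB.ne_top
  have h1 : 0 ≤ 1 - s := by linarith [hs.2]
  rw [(diag_stateXB p hρ h).powTrace ((diag_stateX p).tensor h') h1 hs.1.le, tsum_tensorBasis,
    chernoffSum]
  refine tsum_congr fun x => ?_
  rw [(h x).powTrace h' h1 hs.1.le, ← ENNReal.tsum_mul_left]
  refine tsum_congr fun i => ?_
  rw [← ENNReal.tsum_mul_left]
  refine tsum_congr fun j => ?_
  have e : (p x).toNNReal ^ (1 - s) * (p x).toNNReal ^ s = (p x).toNNReal := by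
    rw [← NNReal.rpow_add_of_nonneg _ h1 hs.1.le]
    simp
  have e' : p x = (((p x).toNNReal ^ (1 - s) : ℝ≥0) : ℝ≥0∞) * (((p x).toNNReal ^ s : ℝ≥0) : ℝ≥0∞) := by
    rw [← ENNReal.coe_mul, e, coe_toNNReal_pmf]
  conv_rhs => rw [e']
  simp only [NNReal.mul_rpow, ENNReal.coe_mul]
  ring

theorem petzInfo_eq (p : PMF X) {ρ : X → H →L[ℂ] H} (hρ : ∀ x, IsDensity (ρ x)) {s : ℝ}
    (hs : s ∈ Set.Ioo (0 : ℝ) 1) :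
    petzInfo (1 - s) p ρ = (((-s)⁻¹ : ℝ) : EReal) * ENNReal.log (chernoffSum p ρ s) := by
  have h := powTrace_stateXB p hρ hs
  rw [petzInfo, petzDiv_eq (isDensity_stateXB p hρ)
    (isDensity_opTensor (isDensity_stateX p) (isDensity_stateB p hρ)) (by linarith [hs.2])
    (by linarith [hs.1]), sub_sub_cancel, h, show 1 - s - 1 = -s by ring]

/-- Homogeneity of degree one. For r = 0 it relies on 0 · ∞ = 0. -/
theorem klein_mul_mul (r : ℝ≥0) (l m : ℝ) : klein (r * l) (r * m) = r * klein l m := by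
  rcases eq_or_ne r 0 with h0 | h0
  · simp [klein, h0]
  have h0' : (r : ℝ) ≠ 0 := by exact_mod_cast h0
  unfold klein
  by_cases h : m = 0 ∧ l ≠ 0
  · rw [if_pos h, if_pos ⟨by simp [h.1], mul_ne_zero h0' h.2⟩, ENNReal.mul_top (by simpa using h0)]
  · rw [if_neg h, if_neg fun h2 => h ⟨by simpa [h0'] using h2.1, right_ne_zero_of_mul h2.2⟩,
      ← ENNReal.ofReal_coe_nnreal, ← ENNReal.ofReal_mul r.coe_nonneg]
    congr 1
    rcases eq_or_ne l 0 with hl | hl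
    · simp [hl]
    · have hm : m ≠ 0 := fun hm => h ⟨hm, hl⟩
      rw [Real.log_mul h0' hl, Real.log_mul h0' hm]
      ring

theorem mutualInfo_eq (p : PMF X) {ρ : X → H →L[ℂ] H} (hρ : ∀ x, IsDensity (ρ x)) {κ : X → Type*}
    {b : ∀ x, HilbertBasis (κ x) ℂ H} {a : ∀ x, κ x → ℝ≥0} (h : ∀ x, Diag (b x) (a x) (ρ x))
    {ι : Type*} {c : HilbertBasis ι ℂ H} {a' : ι → ℝ≥0} (h' : Diag c a' (stateB p ρ)) :
    mutualInfo p ρ = ∑' x, ∑' i, ∑' j, p x * klein (a x i) (a' j)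
      * ENNReal.ofReal (‖⟪b x i, c j⟫_ℂ‖ ^ 2) := by
  rw [mutualInfo, relEntropy_eq (diag_stateXB p hρ h) ((diag_stateX p).tensor h'),
    tsum_tensorBasis b c fun z z' => klein (((p z.1).toNNReal * a z.1 z.2 : ℝ≥0) : ℝ)
      (((p z'.1).toNNReal * a' z'.2 : ℝ≥0) : ℝ)]
  simp only [NNReal.coe_mul, klein_mul_mul, coe_toNNReal_pmf]

end ClassicalQuantum

/-! ### Classical Rényi sums near order one -/

section Weighted

open Filter Topology

variable {Ω : Type*} {u r t : Ω → ℝ≥0}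

theorem klein_of_ne_zero {x y : ℝ≥0} (hy : y ≠ 0) :
    klein x y = ENNReal.ofReal (x * (Real.log x - Real.log y) - x + y) :=
  if_neg fun h => hy (by exact_mod_cast h.1)

theorem klein_zero_left (y : ℝ≥0) : klein (0 : ℝ≥0) y = y := by
  simp [klein]

theorem klein_nonneg {x y : ℝ} (hx : 0 < x) (hy : 0 < y) :
    0 ≤ x * (Real.log x - Real.log y) - x + y := by
  have h := Real.log_le_sub_one_of_pos (div_pos hy hx)
  rw [Real.log_div hy.ne' hx.ne'] at h
  have h2 := mul_le_mul_of_nonneg_left h hx.le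
  have h3 : x * (y / x - 1) = y - x := by field_simp
  linarith

theorem coe_rpow_mul_rpow {x y : ℝ≥0} (hx : x ≠ 0) (hy : y ≠ 0) (s : ℝ) :
    ((x ^ (1 - s) * y ^ s : ℝ≥0) : ℝ) = x * Real.exp (s * (Real.log y - Real.log x)) := by
  have hx' : 0 < (x : ℝ) := by positivity
  have hy' : 0 < (y : ℝ) := by positivity
  rw [NNReal.coe_mul, NNReal.coe_rpow, NNReal.coe_rpow, Real.rpow_sub hx', Real.rpow_one,
    Real.rpow_def_of_pos hx', Real.rpow_def_of_pos hy', mul_sub, Real.exp_sub, mul_comm s,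
    mul_comm s]
  ring

/-- The sums `∑ u r^{1-s} t^s` are bounded away from zero for `s ∈ (0,1)`. -/
theorem exists_pos_le_tsum_rpow (hr : ∑' ω, (u ω : ℝ≥0∞) * r ω = 1)
    (h0 : ∀ ω, t ω = 0 → u ω = 0 ∨ r ω = 0) :
    ∃ q : ℝ≥0, 0 < q ∧ ∀ s ∈ Set.Ioo (0 : ℝ) 1,
      (q : ℝ≥0∞) ≤ ∑' ω, (u ω : ℝ≥0∞) * ((r ω ^ (1 - s) * t ω ^ s : ℝ≥0) : ℝ≥0∞) := by
  obtain ⟨ω, hω⟩ : ∃ ω, (u ω : ℝ≥0∞) * r ω ≠ 0 := by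
    by_contra! h
    simp [h] at hr
  have hu : u ω ≠ 0 := by simpa using left_ne_zero_of_mul hω
  have hx : r ω ≠ 0 := by simpa using right_ne_zero_of_mul hω
  have hy : t ω ≠ 0 := fun h => (h0 ω h).elim hu hx
  -- A single ω of positive weight suffices: r^{1-s} t^s ≥ min(r,t) for all s at once.
  refine ⟨u ω * min (r ω) (t ω),
    mul_pos (pos_iff_ne_zero.mpr hu) (lt_min (pos_iff_ne_zero.mpr hx) (pos_iff_ne_zero.mpr hy)),
    fun s hs => le_trans ?_ (ENNReal.le_tsum ω)⟩
  rw [ENNReal.coe_mul]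
  gcongr
  calc min (r ω) (t ω) = min (r ω) (t ω) ^ (1 - s) * min (r ω) (t ω) ^ s := by
        rw [← NNReal.rpow_add_of_nonneg _ (by linarith [hs.2]) hs.1.le, sub_add_cancel,
          NNReal.rpow_one]
    _ ≤ _ := mul_le_mul' (NNReal.rpow_le_rpow (min_le_left _ _) (by linarith [hs.2]))
        (NNReal.rpow_le_rpow (min_le_right _ _) hs.1.le)

/-- This is x(1 + z) ≤ x e^z with z = sk + s(log y - log x), where s·klein and s·x are moved so that
nothing is subtracted in [0,∞]. -/
theorem add_le_exp_mul_rpow {x y : ℝ≥0} (hy : y ≠ 0) (k s : ℝ≥0) :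
    (x * (1 + s * k) + s * y : ℝ≥0∞)
      ≤ ENNReal.ofReal (Real.exp (s * k)) * ((x ^ (1 - (s : ℝ)) * y ^ (s : ℝ) : ℝ≥0) : ℝ≥0∞)
        + s * klein x y + s * x := by
  rcases eq_or_ne x 0 with rfl | hx
  · rw [klein_zero_left]
    simp
  have hx' : 0 < (x : ℝ) := by positivity
  have hy' : 0 < (y : ℝ) := by positivity
  have hk := klein_nonneg hx' hy'
  rw [klein_of_ne_zero hy, ← ENNReal.ofReal_coe_nnreal (p := x ^ (1 - (s : ℝ)) * y ^ (s : ℝ)),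
    coe_rpow_mul_rpow hx hy, ← ENNReal.ofReal_coe_nnreal (p := x),
    ← ENNReal.ofReal_coe_nnreal (p := s), ← ENNReal.ofReal_coe_nnreal (p := y),
    ← ENNReal.ofReal_coe_nnreal (p := k), ← ENNReal.ofReal_one,
    ← ENNReal.ofReal_mul (by positivity), ← ENNReal.ofReal_mul (by positivity),
    ← ENNReal.ofReal_mul (by positivity), ← ENNReal.ofReal_mul (by positivity),
    ← ENNReal.ofReal_mul (by positivity), ← ENNReal.ofReal_add (by positivity) (by positivity),
    ← ENNReal.ofReal_mul (by positivity), ← ENNReal.ofReal_add (by positivity) (by positivity),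
    ← ENNReal.ofReal_add (by positivity) (by positivity),
    ← ENNReal.ofReal_add (by positivity) (by positivity)]
  refine ENNReal.ofReal_le_ofReal ?_
  have h1 : Real.exp (s * k) * (x * Real.exp (s * (Real.log y - Real.log x)))
      = x * Real.exp (s * k + s * (Real.log y - Real.log x)) := by
    rw [Real.exp_add]
    ring
  have h2 := mul_le_mul_of_nonneg_left
    (Real.add_one_le_exp (s * k + s * (Real.log y - Real.log x))) hx'.le
  rw [h1]
  linarith

/-- The Rényi divergence of order 1 - s is at most the relative entropy k: sum `add_le_exp_mul_rpow`
with weights u and cancel sk + s. -/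
theorem one_le_exp_mul_tsum_rpow (hr : ∑' ω, (u ω : ℝ≥0∞) * r ω = 1)
    (ht : ∑' ω, (u ω : ℝ≥0∞) * t ω = 1) (h0 : ∀ ω, t ω = 0 → u ω = 0 ∨ r ω = 0) {k s : ℝ≥0}
    (hk : ∑' ω, (u ω : ℝ≥0∞) * klein (r ω) (t ω) = k) :
    1 ≤ ENNReal.ofReal (Real.exp (s * k))
      * ∑' ω, (u ω : ℝ≥0∞) * ((r ω ^ (1 - (s : ℝ)) * t ω ^ (s : ℝ) : ℝ≥0) : ℝ≥0∞) := by
  have h : ∀ ω, (1 + s * k) * ((u ω : ℝ≥0∞) * r ω) + s * ((u ω : ℝ≥0∞) * t ω)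
      ≤ ENNReal.ofReal (Real.exp (s * k))
          * ((u ω : ℝ≥0∞) * ((r ω ^ (1 - (s : ℝ)) * t ω ^ (s : ℝ) : ℝ≥0) : ℝ≥0∞))
        + s * ((u ω : ℝ≥0∞) * klein (r ω) (t ω)) + s * ((u ω : ℝ≥0∞) * r ω) := by
    intro ω
    by_cases hω : t ω = 0
    · rcases h0 ω hω with h | h
      · simp [h]
      · simp [h, hω]
    · refine le_trans (le_of_eq ?_) ((mul_le_mul_right (add_le_exp_mul_rpow (x := r ω) hω k s)
        (u ω : ℝ≥0∞)).trans (le_of_eq ?_)) <;> ring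
  have h' := ENNReal.tsum_le_tsum h
  simp only [ENNReal.tsum_add, ENNReal.tsum_mul_left, hr, ht, hk, mul_one] at h'
  rw [add_assoc, add_assoc] at h'
  have hfin : (s * k + s : ℝ≥0∞) ≠ ⊤ := by finiteness
  exact (ENNReal.add_le_add_iff_right hfin).mp h'

/-- Below the relative entropy some sum `∑ u r^{1-s} t^s` decays. -/
theorem exists_tsum_rpow_lt (hr : ∑' ω, (u ω : ℝ≥0∞) * r ω = 1)
    (ht : ∑' ω, (u ω : ℝ≥0∞) * t ω = 1) (h0 : ∀ ω, t ω = 0 → u ω = 0 ∨ r ω = 0) {R : ℝ}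
    (hR0 : 0 ≤ R) (hR : ENNReal.ofReal R < ∑' ω, (u ω : ℝ≥0∞) * klein (r ω) (t ω)) :
    ∃ s ∈ Set.Ioo (0 : ℝ) 1,
      ∑' ω, (u ω : ℝ≥0∞) * ((r ω ^ (1 - s) * t ω ^ s : ℝ≥0) : ℝ≥0∞)
        < ENNReal.ofReal (Real.exp (-(s * R))) := by
  let k : Ω → ℝ := fun ω => u ω * (r ω * (Real.log (r ω) - Real.log (t ω)) - r ω + t ω)
  -- The gap in the weighted mean inequality. It is nonnegative, sums to 1 - Q(s), and s⁻¹ f tends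
  -- to k pointwise as s ↓ 0, by differentiating at s = 0.
  let f : ℝ → Ω → ℝ := fun s ω =>
    u ω * ((1 - s) * r ω + s * t ω - ((r ω ^ (1 - s) * t ω ^ s : ℝ≥0) : ℝ))
  have hkl : ∀ ω, (u ω : ℝ≥0∞) * klein (r ω) (t ω) = ENNReal.ofReal (k ω) := by
    intro ω
    by_cases hω : t ω = 0
    · rcases h0 ω hω with h | h <;> simp [k, h, hω, klein]
    · rw [klein_of_ne_zero hω, ← ENNReal.ofReal_coe_nnreal, ← ENNReal.ofReal_mul (u ω).coe_nonneg]
  have hk0 : ∀ ω, 0 ≤ k ω := by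
    intro ω
    by_cases hω : t ω = 0
    · rcases h0 ω hω with h | h <;> simp [k, h, hω]
    · refine mul_nonneg (u ω).coe_nonneg ?_
      by_cases hx : r ω = 0
      · simp [hx]
      · exact klein_nonneg (by positivity) (by positivity)
  have hf0 : ∀ s ∈ Set.Ioo (0 : ℝ) 1, ∀ ω, 0 ≤ f s ω := by
    intro s hs ω
    refine mul_nonneg (u ω).coe_nonneg (sub_nonneg.mpr ?_)
    rw [NNReal.coe_mul, NNReal.coe_rpow, NNReal.coe_rpow]
    exact Real.geom_mean_le_arith_mean2_weighted (by linarith [hs.2]) hs.1.le (r ω).coe_nonneg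
      (t ω).coe_nonneg (by ring)
  have hlim : ∀ ω, Tendsto (fun s : ℝ => s⁻¹ * f s ω) (𝓝[>] 0) (𝓝 (k ω)) := by
    intro ω
    by_cases hω : u ω = 0 ∨ r ω = 0
    · refine Tendsto.congr' ?_ tendsto_const_nhds
      filter_upwards [Ioo_mem_nhdsGT (zero_lt_one (α := ℝ))] with s hs
      have hs1 : 1 - s ≠ 0 := by linarith [hs.2]
      rcases hω with h | h
      · simp [k, f, h]
      · have hs0 := hs.1.ne'
        simp only [k, f, h, NNReal.zero_rpow hs1, NNReal.coe_zero, NNReal.coe_mul]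
        field_simp
        ring
    · push Not at hω
      have hω' : t ω ≠ 0 := fun h => (h0 ω h).elim hω.1 hω.2
      have hd : HasDerivAt (fun s => f s ω) (k ω) 0 := by
        simp only [f, coe_rpow_mul_rpow hω.2 hω']
        have h1 := ((hasDerivAt_id (0 : ℝ)).mul_const
          (Real.log (t ω) - Real.log (r ω))).exp.const_mul (r ω : ℝ)
        have h2 := (((hasDerivAt_id (0 : ℝ)).const_sub 1).mul_const (r ω : ℝ)).add
          ((hasDerivAt_id (0 : ℝ)).mul_const (t ω : ℝ))
        refine ((h2.sub h1).const_mul (u ω : ℝ)).congr_deriv ?_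
        simp only [k, id, zero_mul, Real.exp_zero]
        ring
      have := hd.tendsto_slope_zero_right
      refine this.congr fun s => ?_
      simp [f]
  -- A finite partial sum already exceeds R. No limit need be exchanged with an infinite sum, and
  -- the relative entropy may be infinite.
  rw [tsum_congr hkl, ENNReal.tsum_eq_iSup_sum, lt_iSup_iff] at hR
  obtain ⟨F, hF⟩ := hR
  rw [← ENNReal.ofReal_sum_of_nonneg fun ω _ => hk0 ω, ENNReal.ofReal_lt_ofReal_iff'] at hF
  have hl := (tendsto_finsetSum F fun ω _ => hlim ω).eventually (lt_mem_nhds hF.1)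
  obtain ⟨s, hs, hsR⟩ := ((Filter.eventually_mem_set.mpr (Ioo_mem_nhdsGT (zero_lt_one (α := ℝ)))).and hl).exists
  refine ⟨s, hs, ?_⟩
  rw [← Finset.mul_sum, lt_inv_mul_iff₀ hs.1] at hsR
  have hsum : ∑' ω, (ENNReal.ofReal (f s ω)
      + (u ω : ℝ≥0∞) * ((r ω ^ (1 - s) * t ω ^ s : ℝ≥0) : ℝ≥0∞)) = 1 := by
    have e : ∀ ω, ENNReal.ofReal (f s ω)
        + (u ω : ℝ≥0∞) * ((r ω ^ (1 - s) * t ω ^ s : ℝ≥0) : ℝ≥0∞)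
          = ENNReal.ofReal (1 - s) * ((u ω : ℝ≥0∞) * r ω)
            + ENNReal.ofReal s * ((u ω : ℝ≥0∞) * t ω) := by
      intro ω
      have hs1 : 0 ≤ 1 - s := by linarith [hs.2]
      have hs0 := hs.1.le
      rw [← ENNReal.coe_mul, ← ENNReal.coe_mul, ← ENNReal.coe_mul, ← ENNReal.ofReal_coe_nnreal,
        ← ENNReal.ofReal_coe_nnreal, ← ENNReal.ofReal_coe_nnreal,
        ← ENNReal.ofReal_add (hf0 s hs ω) (by positivity), ← ENNReal.ofReal_mul hs1,
        ← ENNReal.ofReal_mul hs0, ← ENNReal.ofReal_add (by positivity) (by positivity)]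
      congr 1
      simp only [f, NNReal.coe_mul]
      ring
    rw [tsum_congr e, ENNReal.tsum_add, ENNReal.tsum_mul_left, ENNReal.tsum_mul_left, hr, ht,
      mul_one, mul_one, ← ENNReal.ofReal_add (by linarith [hs.2]) hs.1.le, sub_add_cancel,
      ENNReal.ofReal_one]
  rw [ENNReal.tsum_add] at hsum
  have hlt : ENNReal.ofReal (s * R) < ∑' ω, ENNReal.ofReal (f s ω) := by
    refine lt_of_lt_of_le ?_ (ENNReal.sum_le_tsum F)
    rw [← ENNReal.ofReal_sum_of_nonneg fun ω _ => hf0 s hs ω]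
    exact (ENNReal.ofReal_lt_ofReal_iff_of_nonneg (mul_nonneg hs.1.le hR0)).mpr hsR
  set Q := ∑' ω, (u ω : ℝ≥0∞) * ((r ω ^ (1 - s) * t ω ^ s : ℝ≥0) : ℝ≥0∞) with hQ
  have hQt : Q ≠ ⊤ := ne_top_of_le_ne_top ENNReal.one_ne_top (hsum ▸ le_add_self)
  have h3 : ENNReal.ofReal (s * R) + Q < 1 := hsum ▸ ENNReal.add_lt_add_right hQt hlt
  -- Q(s) < 1 - sR ≤ e^{-sR}.
  have h4 : ENNReal.ofReal (1 - s * R) ≤ ENNReal.ofReal (Real.exp (-(s * R))) :=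
    ENNReal.ofReal_le_ofReal (by linarith [Real.add_one_le_exp (-(s * R))])
  refine lt_of_lt_of_le ?_ h4
  rw [ENNReal.ofReal_sub _ (mul_nonneg hs.1.le hR0), ENNReal.ofReal_one]
  exact lt_tsub_iff_left.mpr h3
end Weighted

/-! ### The strong converse exponent -/

section Exponent

variable {X : Type v} {H : Type u} [NormedAddCommGroup H] [InnerProductSpace ℂ H]
  [CompleteSpace H]

theorem hasSum_re_inner_stateB (p : PMF X) {ρ : X → H →L[ℂ] H} (hρ : ∀ x, IsDensity (ρ x))
    (y : H) :
    HasSum (fun x => (p x).toReal * (⟪y, ρ x y⟫_ℂ).re) (⟪y, stateB p ρ y⟫_ℂ).re := by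
  have h := hasSum_apply_vector (hasSum_stateB p hρ) y
  have h2 := Complex.hasSum_re ((innerSL ℂ y).hasSum h)
  refine h2.congr_fun fun x => ?_
  change (p x).toReal * (⟪y, ρ x y⟫_ℂ).re = (⟪y, ((p x).toReal • ρ x) y⟫_ℂ).re
  rw [smul_apply, ← Complex.coe_smul, inner_smul_right, Complex.re_ofReal_mul]

/-- A kernel vector of ρ_B is a kernel vector of each ρ_x with p(x) > 0, since the nonnegative
numbers p(x)⟪c_j, ρ_x c_j⟫ sum to 0. Hence the infinite value of `klein` never carries weight. -/
theorem eq_zero_of_eigenvalue_stateB_eq_zero (p : PMF X) {ρ : X → H →L[ℂ] H}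
    (hρ : ∀ x, IsDensity (ρ x)) {κ : X → Type*} {b : ∀ x, HilbertBasis (κ x) ℂ H}
    {a : ∀ x, κ x → ℝ≥0} (h : ∀ x, Diag (b x) (a x) (ρ x)) {ι : Type*} {c : HilbertBasis ι ℂ H}
    {a' : ι → ℝ≥0} (h' : Diag c a' (stateB p ρ)) {j : ι} (hj : a' j = 0) (x : X) (i : κ x) :
    (p x).toNNReal * ‖⟪b x i, c j⟫_ℂ‖₊ ^ 2 = 0 ∨ a x i = 0 := by
  have hs := hasSum_re_inner_stateB p hρ (c j)
  have h0 : ∀ x, 0 ≤ (p x).toReal * (⟪c j, ρ x (c j)⟫_ℂ).re := fun x =>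
    mul_nonneg ENNReal.toReal_nonneg (re_inner_nonneg (hρ x).1 _)
  rw [h' j, hj, NNReal.coe_zero, Complex.ofReal_zero, zero_smul, inner_zero_right,
    Complex.zero_re, hasSum_zero_iff_of_nonneg h0] at hs
  rcases mul_eq_zero.mp (congrFun hs x) with hx | hx
  · left
    rw [show (p x).toNNReal = 0 from NNReal.coe_injective hx, zero_mul]
  · have e := (h x).re_inner (hρ x).1 (c j)
    rw [hx, ENNReal.ofReal_zero, eq_comm, ENNReal.tsum_eq_zero] at e
    rcases mul_eq_zero.mp (e i) with h1 | h1
    · exact Or.inr (by exact_mod_cast h1)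
    · left
      have h2 : ‖⟪b x i, c j⟫_ℂ‖ ^ 2 ≤ 0 := ENNReal.ofReal_eq_zero.mp h1
      have h3 : ⟪b x i, c j⟫_ℂ = 0 := by
        rw [← norm_eq_zero]
        exact pow_eq_zero_iff two_ne_zero |>.mp (le_antisymm h2 (by positivity))
      simp [h3]

/-- The Chernoff sums and the mutual information, in terms of a joint classical distribution. -/
theorem exists_classical (p : PMF X) {ρ : X → H →L[ℂ] H} (hρ : ∀ x, IsDensity (ρ x)) :
    ∃ (Ω : Type (max u v)) (u r t : Ω → ℝ≥0), ∑' ω, (u ω : ℝ≥0∞) * r ω = 1 ∧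
      ∑' ω, (u ω : ℝ≥0∞) * t ω = 1 ∧ (∀ ω, t ω = 0 → u ω = 0 ∨ r ω = 0) ∧
      (∀ s ∈ Set.Ioo (0 : ℝ) 1, chernoffSum p ρ s
        = ∑' ω, (u ω : ℝ≥0∞) * ((r ω ^ (1 - s) * t ω ^ s : ℝ≥0) : ℝ≥0∞)) ∧
      mutualInfo p ρ = ∑' ω, (u ω : ℝ≥0∞) * klein (r ω) (t ω) := by
  obtain ⟨κ, b, a, h⟩ := exists_diag_family hρ
  have hB := isDensity_stateB p hρ
  obtain ⟨ι, c, a', h'⟩ := exists_diag hB.1 hB.ne_top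
  have hu : ∀ x i j, (((p x).toNNReal * ‖⟪b x i, c j⟫_ℂ‖₊ ^ 2 : ℝ≥0) : ℝ≥0∞)
      = p x * ENNReal.ofReal (‖⟪b x i, c j⟫_ℂ‖ ^ 2) := by
    intro x i j
    rw [ENNReal.coe_mul, coe_toNNReal_pmf, ← ENNReal.ofReal_coe_nnreal (p := _ ^ 2), NNReal.coe_pow,
      coe_nnnorm]
  have hsum : ∀ F : (Σ x, κ x × ι) → ℝ≥0∞,
      ∑' ω : Σ x, κ x × ι, (((p ω.1).toNNReal * ‖⟪b ω.1 ω.2.1, c ω.2.2⟫_ℂ‖₊ ^ 2 : ℝ≥0) : ℝ≥0∞) * F ω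
        = ∑' x, p x * ∑' i, ∑' j, F ⟨x, i, j⟩ * ENNReal.ofReal (‖⟪b x i, c j⟫_ℂ‖ ^ 2) := by
    intro F
    rw [ENNReal.tsum_sigma']
    refine tsum_congr fun x => ?_
    rw [ENNReal.tsum_prod', ← ENNReal.tsum_mul_left]
    refine tsum_congr fun i => ?_
    rw [← ENNReal.tsum_mul_left]
    refine tsum_congr fun j => ?_
    rw [hu]
    ring
  -- Nussbaum–Szkoła distributions: the points are triples (x, i, j), weighted by p(x)|⟪b_i, c_j⟫|²,
  -- with r the eigenvalue of ρ_x and t that of ρ_B.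
  refine ⟨Σ x, κ x × ι, fun ω => (p ω.1).toNNReal * ‖⟪b ω.1 ω.2.1, c ω.2.2⟫_ℂ‖₊ ^ 2,
    fun ω => a ω.1 ω.2.1, fun ω => a' ω.2.2, ?_, ?_, ?_, ?_, ?_⟩
  · rw [hsum]
    simp only [tsum_tsum_mul_norm_inner_sq (b _) c fun i => (a _ i : ℝ≥0∞),
      ← (h _).posTrace (hρ _).1, (hρ _).2, mul_one, p.tsum_coe]
  · rw [hsum]
    simp only [tsum_tsum_mul_norm_inner_sq' (b _) c fun j => (a' j : ℝ≥0∞),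
      ← h'.posTrace hB.1, hB.2, mul_one, p.tsum_coe]
  · rintro ⟨x, i, j⟩ hj
    exact eq_zero_of_eigenvalue_stateB_eq_zero p hρ h h' hj x i
  · intro s hs
    rw [hsum, chernoffSum]
    refine tsum_congr fun x => ?_
    rw [(h x).powTrace h' (by linarith [hs.2]) hs.1.le]
    simp only [ENNReal.coe_mul]
  · rw [hsum, mutualInfo_eq p hρ h h']
    simp only [mul_assoc, ENNReal.tsum_mul_left]

theorem chernoffSum_ne_top (p : PMF X) {ρ : X → H →L[ℂ] H} (hρ : ∀ x, IsDensity (ρ x)) {s : ℝ}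
    (hs : s ∈ Set.Ioo (0 : ℝ) 1) : chernoffSum p ρ s ≠ ⊤ := by
  refine ne_top_of_le_ne_top (b := 2) (by simp) ?_
  calc chernoffSum p ρ s ≤ ∑' x, p x * 2 := ENNReal.tsum_le_tsum fun x => by
        gcongr
        exact powTrace_le_two (hρ x) (isDensity_stateB p hρ) (by linarith [hs.2]) hs.1.le (by ring)
    _ = 2 := by rw [ENNReal.tsum_mul_right, p.tsum_coe, one_mul]

theorem exists_le_chernoffSum (p : PMF X) {ρ : X → H →L[ℂ] H} (hρ : ∀ x, IsDensity (ρ x)) :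
    ∃ q : ℝ, 0 < q ∧ ∀ s ∈ Set.Ioo (0 : ℝ) 1, q ≤ (chernoffSum p ρ s).toReal := by
  obtain ⟨Ω, u, r, t, hr, -, h0, hQ, -⟩ := exists_classical p hρ
  obtain ⟨q, hq, h⟩ := exists_pos_le_tsum_rpow hr h0
  refine ⟨q, hq, fun s hs => ?_⟩
  have h2 := h s hs
  rw [← hQ s hs] at h2
  exact ENNReal.toReal_mono (chernoffSum_ne_top p hρ hs) h2

/-- `-log ∑ₓ p(x) Tr[ρ_x^{1-s} ρ_B^s] - s R`. -/
def chernoffExponent (p : PMF X) (ρ : X → H →L[ℂ] H) (R s : ℝ) : ℝ :=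
  -Real.log (chernoffSum p ρ s).toReal - s * R

theorem chernoffSum_toReal_pos (p : PMF X) {ρ : X → H →L[ℂ] H} (hρ : ∀ x, IsDensity (ρ x)) {s : ℝ}
    (hs : s ∈ Set.Ioo (0 : ℝ) 1) : 0 < (chernoffSum p ρ s).toReal := by
  obtain ⟨q, hq, h⟩ := exists_le_chernoffSum p hρ
  exact hq.trans_le (h s hs)

theorem petzInfo_eq_coe (p : PMF X) {ρ : X → H →L[ℂ] H} (hρ : ∀ x, IsDensity (ρ x)) {s : ℝ}
    (hs : s ∈ Set.Ioo (0 : ℝ) 1) :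
    petzInfo (1 - s) p ρ = (((-s)⁻¹ * Real.log (chernoffSum p ρ s).toReal : ℝ) : EReal) := by
  have hpos := chernoffSum_toReal_pos p hρ hs
  rw [petzInfo_eq p hρ hs, ENNReal.log_pos_real (fun h => by simp [h] at hpos)
    (chernoffSum_ne_top p hρ hs), EReal.coe_mul]

/-- The map α ↦ s = (1-α)/α, with inverse s ↦ 1/(1+s), is a bijection from (1/2,1) onto (0,1), and 2
- 1/α = 1 - s. -/
theorem scExponent_eq (p : PMF X) {ρ : X → H →L[ℂ] H} (hρ : ∀ x, IsDensity (ρ x)) (R : ℝ) :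
    scExponent p ρ R = ⨆ s ∈ Set.Ioo (0 : ℝ) 1, (chernoffExponent p ρ R s : EReal) := by
  have term : ∀ s ∈ Set.Ioo (0 : ℝ) 1,
      ((s : ℝ) : EReal) * (petzInfo (1 - s) p ρ - (R : EReal)) = chernoffExponent p ρ R s := by
    intro s hs
    have hs0 := hs.1.ne'
    rw [petzInfo_eq_coe p hρ hs, ← EReal.coe_sub, ← EReal.coe_mul, chernoffExponent]
    congr 1
    field_simp
  refine le_antisymm (iSup₂_le fun α hα => ?_) (iSup₂_le fun s hs => ?_)
  · have hα0 : 0 < α := by linarith [hα.1]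
    have hs : (1 - α) / α ∈ Set.Ioo (0 : ℝ) 1 :=
      ⟨div_pos (by linarith [hα.2]) hα0, by rw [div_lt_one hα0]; linarith [hα.1]⟩
    rw [show 2 - 1 / α = 1 - (1 - α) / α by field_simp; ring, term _ hs]
    exact le_iSup₂_of_le _ hs le_rfl
  · have h1 : 0 < 1 + s := by linarith [hs.1]
    have hα : 1 / (1 + s) ∈ Set.Ioo (1 / 2 : ℝ) 1 :=
      ⟨one_div_lt_one_div_of_lt h1 (by linarith [hs.2]), by
        rw [div_lt_one h1]; linarith [hs.1]⟩
    refine le_iSup₂_of_le _ hα ?_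
    rw [show (1 - 1 / (1 + s)) / (1 / (1 + s)) = s by field_simp; ring,
      show 2 - 1 / (1 / (1 + s)) = 1 - s by field_simp; ring, term s hs]

theorem exists_isLUB_chernoffExponent (p : PMF X) {ρ : X → H →L[ℂ] H} (hρ : ∀ x, IsDensity (ρ x))
    {R : ℝ} (hR : 0 ≤ R) :
    ∃ E : ℝ, scExponent p ρ R = E ∧ IsLUB (chernoffExponent p ρ R '' Set.Ioo 0 1) E := by
  obtain ⟨q, hq, h⟩ := exists_le_chernoffSum p hρ
  have hb : ∀ s ∈ Set.Ioo (0 : ℝ) 1, chernoffExponent p ρ R s ≤ -Real.log q := fun s hs => by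
    have h1 := Real.log_le_log hq (h s hs)
    have h2 := mul_nonneg hs.1.le hR
    rw [chernoffExponent]
    linarith
  have hlub : IsLUB (chernoffExponent p ρ R '' Set.Ioo 0 1)
      (sSup (chernoffExponent p ρ R '' Set.Ioo 0 1)) :=
    isLUB_csSup ((Set.nonempty_Ioo.mpr one_pos).image _) ⟨-Real.log q, by
      rintro _ ⟨s, hs, rfl⟩
      exact hb s hs⟩
  refine ⟨_, ?_, hlub⟩
  rw [scExponent_eq p hρ]
  refine le_antisymm (iSup₂_le fun s hs =>
    EReal.coe_le_coe_iff.mpr (hlub.1 (Set.mem_image_of_mem _ hs))) (le_of_not_gt fun hlt => ?_)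
  -- If the extended supremum were smaller, a real number in between would be an upper bound below
  -- the least one.
  obtain ⟨y, hy1, hy2⟩ := EReal.lt_iff_exists_real_btwn.mp hlt
  refine absurd (EReal.coe_lt_coe_iff.mp hy2) (not_lt.mpr (hlub.2 ?_))
  rintro _ ⟨s, hs, rfl⟩
  exact EReal.coe_le_coe_iff.mp ((le_iSup₂_of_le s hs le_rfl).trans hy1.le)

theorem one_sub_exp_chernoffExponent_le (p : PMF X) {ρ : X → H →L[ℂ] H}
    (hρ : ∀ x, IsDensity (ρ x)) {R : ℝ} {n M : ℕ} (hn : 0 < n) (hM : 0 < M)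
    (h : 1 / (n : ℝ) * Real.log M ≤ R) {s : ℝ} (hs : s ∈ Set.Ioo (0 : ℝ) 1) :
    1 - 4 * Real.exp (-(n * chernoffExponent p ρ R s)) ≤ expectedTraceDist p ρ n M := by
  refine le_trans ?_ (expectedTraceDist_ge p hρ hM hs (chernoffSum_ne_top p hρ hs))
  have hn' : (0 : ℝ) < n := by exact_mod_cast hn
  have hM' : (0 : ℝ) < M := by exact_mod_cast hM
  have hlog : Real.log M ≤ n * R := by
    rwa [one_div, inv_mul_le_iff₀ hn'] at h
  have e : (M : ℝ) ^ s * (chernoffSum p ρ s).toReal ^ n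
      ≤ Real.exp (-(n * chernoffExponent p ρ R s)) := by
    rw [Real.rpow_def_of_pos hM', ← Real.exp_log (chernoffSum_toReal_pos p hρ hs),
      ← Real.exp_nat_mul, ← Real.exp_add, Real.exp_le_exp, chernoffExponent]
    nlinarith [mul_le_mul_of_nonneg_right hlog hs.1.le]
  linarith

theorem exists_chernoffExponent_pos (p : PMF X) {ρ : X → H →L[ℂ] H} (hρ : ∀ x, IsDensity (ρ x))
    {R : ℝ} (hR : 0 ≤ R) (h : ENNReal.ofReal R < mutualInfo p ρ) :
    ∃ s ∈ Set.Ioo (0 : ℝ) 1, 0 < chernoffExponent p ρ R s := by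
  obtain ⟨Ω, u, r, t, hr, ht, h0, hQ, hI⟩ := exists_classical p hρ
  rw [hI] at h
  obtain ⟨s, hs, hlt⟩ := exists_tsum_rpow_lt hr ht h0 hR h
  refine ⟨s, hs, ?_⟩
  rw [← hQ s hs] at hlt
  have h2 := (ENNReal.lt_ofReal_iff_toReal_lt (chernoffSum_ne_top p hρ hs)).mp hlt
  have h3 := (Real.log_lt_iff_lt_exp (chernoffSum_toReal_pos p hρ hs)).mpr h2
  rw [chernoffExponent]
  linarith

theorem chernoffExponent_nonpos (p : PMF X) {ρ : X → H →L[ℂ] H} (hρ : ∀ x, IsDensity (ρ x))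
    {R : ℝ} (h : mutualInfo p ρ ≤ ENNReal.ofReal R) {s : ℝ} (hs : s ∈ Set.Ioo (0 : ℝ) 1)
    (hR : 0 ≤ R) : chernoffExponent p ρ R s ≤ 0 := by
  obtain ⟨Ω, u, r, t, hr, ht, h0, hQ, hI⟩ := exists_classical p hρ
  have hfin : mutualInfo p ρ ≠ ⊤ := ne_top_of_le_ne_top ENNReal.ofReal_ne_top h
  obtain ⟨k, hk⟩ : ∃ k : ℝ≥0, (k : ℝ≥0∞) = mutualInfo p ρ := ⟨_, ENNReal.coe_toNNReal hfin⟩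
  have hkR : (k : ℝ) ≤ R := by
    rw [← hk, ← ENNReal.ofReal_coe_nnreal] at h
    exact (ENNReal.ofReal_le_ofReal_iff hR).mp h
  lift s to ℝ≥0 using hs.1.le
  have h1 := one_le_exp_mul_tsum_rpow hr ht h0 (hI.symm.trans hk.symm) (s := s)
  rw [← hQ s hs, ← ENNReal.ofReal_toReal (chernoffSum_ne_top p hρ hs),
    ← ENNReal.ofReal_mul (Real.exp_pos _).le, ENNReal.one_le_ofReal] at h1
  have h2 := Real.log_nonneg h1
  rw [Real.log_mul (Real.exp_ne_zero _) (chernoffSum_toReal_pos p hρ hs).ne', Real.log_exp] at h2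
  rw [chernoffExponent]
  nlinarith [mul_le_mul_of_nonneg_left hkR hs.1.le]

end Exponent

end SoftCovering

end

theorem mainTheorem5 {X : Type*} {H : Type*} [NormedAddCommGroup H] [InnerProductSpace ℂ H]
    [CompleteSpace H] (p : PMF X) (ρ : X → (H →L[ℂ] H))
    (hρ : ∀ x, SoftCovering.IsDensity (ρ x)) (R : ℝ) (hR : 0 < R) :
    ∃ E : ℝ, SoftCovering.scExponent p ρ R = (E : EReal) ∧
      (∀ n M : ℕ, 0 < n → R = 1 / (n : ℝ) * Real.log M →
        1 - 4 * Real.exp (-(n * E)) ≤ SoftCovering.expectedTraceDist p ρ n M) ∧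
      (0 < E ↔ (R : EReal) < (SoftCovering.mutualInfo p ρ : EReal)) ∧
      ((R : EReal) < (SoftCovering.mutualInfo p ρ : EReal) →
        ∃ c : ℝ, 0 < c ∧ ∀ n M : ℕ, 0 < n → 0 < M → 1 / (n : ℝ) * Real.log M ≤ R →
          1 - 4 * Real.exp (-(n * c)) ≤ SoftCovering.expectedTraceDist p ρ n M) := by
  obtain ⟨E, hE, hlub⟩ := SoftCovering.exists_isLUB_chernoffExponent p hρ hR.le
  have hRI : (R : EReal) < (SoftCovering.mutualInfo p ρ : EReal)
      ↔ ENNReal.ofReal R < SoftCovering.mutualInfo p ρ := by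
    rw [← EReal.coe_ennreal_lt_coe_ennreal_iff, EReal.coe_ennreal_ofReal, max_eq_left hR.le]
  rw [hRI]
  refine ⟨E, hE, fun n M hn hRM => ?_, ⟨fun hpos => ?_, fun h => ?_⟩, fun h => ?_⟩
  · have hM : 0 < M := by
      -- M = 0 would give R = 0, since `Real.log 0 = 0`.
      rcases Nat.eq_zero_or_pos M with rfl | hM
      · simp [hR.ne'] at hRM
      · exact hM
    have hn' : (0 : ℝ) < n := by exact_mod_cast hn
    -- The supremum E need not be attained. The bounds for the individual s are therefore solved for
    -- the exponent, which gives an upper bound independent of s and hence one for E.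
    by_contra! hlt
    have hd : 0 < (1 - SoftCovering.expectedTraceDist p ρ n M) / 4 := by
      linarith [Real.exp_pos (-(n * E))]
    have hub : E ≤ -Real.log ((1 - SoftCovering.expectedTraceDist p ρ n M) / 4) / n := by
      refine hlub.2 ?_
      rintro _ ⟨s, hs, rfl⟩
      have h1 := SoftCovering.one_sub_exp_chernoffExponent_le p hρ hn hM hRM.ge hs
      have h2 := (Real.log_le_iff_le_exp hd).mpr (by linarith :
        _ ≤ Real.exp (-(n * SoftCovering.chernoffExponent p ρ R s)))
      rw [le_div_iff₀ hn']
      linarith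
    rw [le_div_iff₀ hn'] at hub
    have h3 := (Real.log_le_iff_le_exp hd).mp (by linarith :
      Real.log ((1 - SoftCovering.expectedTraceDist p ρ n M) / 4) ≤ -(n * E))
    linarith
  · by_contra! h
    refine absurd hpos (not_lt.mpr (hlub.2 ?_))
    rintro _ ⟨s, hs, rfl⟩
    exact SoftCovering.chernoffExponent_nonpos p hρ h hs hR.le
  · obtain ⟨s, hs, hpos⟩ := SoftCovering.exists_chernoffExponent_pos p hρ hR.le h
    exact hpos.trans_le (hlub.1 (Set.mem_image_of_mem _ hs))
  -- The exponent at a single good s serves as c, since the bound at fixed s holds for every rate up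
  -- to R.
  · obtain ⟨s, hs, hpos⟩ := SoftCovering.exists_chernoffExponent_pos p hρ hR.le h
    exact ⟨_, hpos, fun n M hn hM hRM =>
      SoftCovering.one_sub_exp_chernoffExponent_le p hρ hn hM hRM hs⟩
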